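/- **Theorem (Young towers with exponential tail).** *Setting.* Let $X$ be a metric space that is standard Borel (for instance a Borel subset of a compact metric space), $\tilde\mu$ a Borel probability measure on $X$ and $\tilde T:X\to X$ a mixing Gibbs–Markov map with respect to a countable measurable partition $\mathcal A$ of $X$. That is: $\tilde T$ preserves $\tilde\mu$ and is mixing; $\tilde\mu(A)>0$, $\tilde T|_A$ is injective and $\tilde T(A)$ is a union of elements of $\mathcal A$, for every $A\in\mathcal A$; the elements of $\mathcal A^n=\bigvee_{j=0}^{n-1}\tilde T^{-j}\mathcal A$ ($n$-cylinders) containing a point $x$ shrink to $\{x\}$; $\inf_{A\in\mathcal A}\tilde\mu(\tilde T(A))>0$; and for some $\lambda\in(0,1)$ there is a Jacobian $g=\frac{d\tilde\mu}{d\tilde\mu\circ \tilde T}>0$ such that $\log g$ is Lipschitz on all elements of $\mathcal A$, with one common constant, for $d_\lambda(x,y)=\lambda^{s(x,y)}$, where $s(x,y)$ is the largest $n$ such that $x,y$ lie in the same $n$-cylinder. Let $R:X\to\{1,2,\dots\}$ be constant on the elements of $\mathcal A$ with exponential tail: $\tilde\mu(R>n)\le C\theta^n$ for some $C$ and some $\theta\in(0,1)$.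 The *Young tower* is $\Omega=\{(x,k):x\in X,\ 0\le k<R(x)\}$ with the map $T(x,k)=(x,k+1)$ if $k+1<R(x)$ and $T(x,R(x)-1)=(\tilde Tx,0)$, and with the $T$-invariant probability $\mu(A)=\big(\int R\,d\tilde\mu\big)^{-1}\sum_{k\ge0}\tilde\mu\{x:k<R(x),\ (x,k)\in A\}$; $X$ is identified with the base $X\times\{0\}$. For a measure preserving system $(S,m)$ and a set $V$ let $\tau_V(x)=\min\{j\ge1:S^jx\in V\}$, $\tau^0_V=0$, $\tau_V^{j+1}(x)=\tau_V^{j}(x)+\tau_V(S^{\tau_V^{j}(x)}x)$. The lower and upper escape rates $\underline\rho(V)\le\overline\rho(V)$ are the $\liminf$ and $\limsup$ of $\frac1t|\log m(\tau_V>t)|\in[0,\infty]$ as $t\to\infty$; if they coincide, the escape rate $\rho(V)$ is said to exist and is their common value. The *localized escape rate* along $(V_n)$ exists and equals $\alpha\in\mathbb R$ if $\rho(V_n)$ exists for all large $n$ and $\rho(V_n)/m(V_n)\to\alpha$. Let $(U_n)$ be a sequence of subsets of $X$ such that, for the base system $(\tilde T,\tilde\mu)$, the limits $\hat\alpha_\ell(K)=\lim_n\tilde\mu_{U_n}(\tau_{U_n}^{\ell-1}\le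 K)$ exist for every $\ell\ge1$ and all sufficiently large $K$, and $\hat\alpha_\ell=\lim_{K\to\infty}\hat\alpha_\ell(K)$ satisfies $\sum_\ell \ell\hat\alpha_\ell<\infty$ (here $\tilde\mu_{U}$ is $\tilde\mu$ conditioned on $U$). Assume one of the following. **(Cylinder case)** $U_{n+1}\subset U_n$, $\tilde\mu(U_n)>0$, $\tilde\mu(U_n)\to0$, and $U_n$ is a union of $\kappa_n$-cylinders, where $(\kappa_n)$ is non-decreasing with $\kappa_n\to\infty$; $\kappa_n\tilde\mu(U_n)^\varepsilon\to0$ for some $\varepsilon\in(0,1)$; and there are $C>0$, $p'>1$ such that for all $n$ and all $1\le j<\kappa_n$ the union $U_n^j$ of the $j$-cylinders that meet $U_n$ satisfies $\tilde\mu(U_n^j)\le\tilde\mu(U_n)+Cj^{-p'}$. **(Open case)** $U_n=\{\varphi>u_n\}$ has positive measure, where $\varphi:X\to\mathbb R\cup\{+\infty\}$ is continuous and attains its maximum, exactly on a null set, and $u_n\nearrow\sup\varphi$ are real numbers. There are $r_n>0$ decreasing to $0$ such that $\tilde\mu(U_n^o\setminus U_n^i)/\tilde\mu(U_n)\to0$,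 where $U_n^o$ is the set of points at distance $\le r_n$ from some point of $U_n$ and $U_n^i$ is the set of points at distance $>r_n$ from every point of $X\setminus U_n$. There is a least positive integer $\kappa_n$ for which all $\kappa_n$-cylinders have diameter $\le r_n$, and $\kappa_n\tilde\mu(U_n)^\varepsilon\to0$ for some $\varepsilon\in(0,1)$. There are $C>0$, $p'>1$ such that for all $n$ and all $1\le j\le\kappa_n$ the union of the $j$-cylinders that meet the $r_n$-neighborhood of $\partial U_n$, or that meet both $U_n$ and $X\setminus U_n$, has measure at most $Cj^{-p'}$. (If cylinders are connected, those of the second kind are among those of the first.) *Conclusion.* The extremal index $\alpha_1=\lim_{K\to\infty}\lim_{n\to\infty}\tilde\mu_{U_n}(\tau_{U_n}>K)$ of the base system exists, and: 1. In the cylinder case the localized escape rate along $(U_n)$ for the tower system $(\Omega,T,\mu)$ exists and equals $\alpha_1$. In the open case $\underline\rho(U_n)/\mu(U_n)\to\alpha_1$ and $\overline\rho(U_n)/\mu(U_n)\to\alpha_1$; in particular, if $\rho(U_n)$ exists for all large $n$, the localized escape rate exists and equals $\alpha_1$. 2. Let $f:M\to M$ be a $C^2$ map of a manifold modelled by this tower: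 $X$ is Borel embedded in $M$, and $f^{R(x)}(x)=\tilde T(x)$ for $x\in X$. Suppose that for every $n$ and $\tilde\mu$-almost every $x\in X$ one has $f^k(x)\notin U_n$ for $0<k<R(x)$ (for instance, $R$ is the first return time of $f$ to $X$). Then the same conclusions hold for the sets $U_n\subset M$ and the system $(M,f,\pi_*\mu)$, where $\pi(x,k)=f^k(x)$. -/

import Mathlib

open MeasureTheory Filter Topology

/-! ### Entry times -/

/-- The first entry time `τ_U(x) = min {j ≥ 1 : T^j x ∈ U}`, equal to `⊤` if there is no entry. -/
noncomputable def entryTime {X : Type*} (T : X → X) (U : Set X) (x : X) : ℕ∞ :=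
  ⨅ (j : ℕ) (_ : 1 ≤ j ∧ T^[j] x ∈ U), (j : ℕ∞)

/-- The higher order entry times: `τ⁰ = 0` and `τ^{j+1}(x) = τ^j(x) + τ_U(T^{τ^j(x)} x)`
(which is `⊤` as soon as `τ^j(x) = ⊤`). -/
noncomputable def entryTimes {X : Type*} (T : X → X) (U : Set X) : ℕ → X → ℕ∞
  | 0, _ => 0
  | j + 1, x => entryTimes T U j x + entryTime T U (T^[(entryTimes T U j x).toNat] x)

/-! ### Escape rates -/

/-- `-(1/t) log μ(τ_U > t)`, as an extended real number (`⊤` if `μ(τ_U > t) = 0`). For a probability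
measure this is `(1/t) |log μ(τ_U > t)|`. -/
noncomputable def escapeExponent {X : Type*} [MeasurableSpace X] (T : X → X) (μ : Measure X)
    (U : Set X) (t : ℕ) : EReal :=
  -(ENNReal.log (μ {x | (t : ℕ∞) < entryTime T U x})) / (t : EReal)

/-- The escape rate `ρ(U) = lim_t (1/t) |log μ(τ_U > t)|` exists and equals `r`. -/
def HasEscapeRate {X : Type*} [MeasurableSpace X] (T : X → X) (μ : Measure X)
    (U : Set X) (r : EReal) : Prop :=
  Tendsto (escapeExponent T μ U) atTop (𝓝 r)

/-- The lower escape rate. -/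
noncomputable def lowerEscapeRate {X : Type*} [MeasurableSpace X] (T : X → X) (μ : Measure X)
    (U : Set X) : EReal :=
  liminf (escapeExponent T μ U) atTop

/-- The upper escape rate. -/
noncomputable def upperEscapeRate {X : Type*} [MeasurableSpace X] (T : X → X) (μ : Measure X)
    (U : Set X) : EReal :=
  limsup (escapeExponent T μ U) atTop

/-- The localized escape rate `lim_n ρ(U_n) / μ(U_n)` exists and equals `α`: the escape rates `ρ(U_n)`
exist for all large `n`, and their quotients by `μ(U_n)` converge to `α`. -/
def HasLocalizedEscapeRate {X : Type*} [MeasurableSpace X] (T : X → X) (μ : Measure X)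
    (U : ℕ → Set X) (α : ℝ) : Prop :=
  ∃ ρ : ℕ → EReal, (∀ᶠ n in atTop, HasEscapeRate T μ (U n) (ρ n)) ∧
    Tendsto (fun n => ρ n / (μ (U n) : EReal)) atTop (𝓝 (α : EReal))

/-- The localized lower and upper escape rates exist and both equal `α`. If the escape rates `ρ(U_n)`
exist for all large `n`, this says that the localized escape rate exists and equals `α`. -/
def HasLocalizedLowerUpperEscapeRate {X : Type*} [MeasurableSpace X] (T : X → X) (μ : Measure X)
    (U : ℕ → Set X) (α : ℝ) : Prop :=
  Tendsto (fun n => lowerEscapeRate T μ (U n) / (μ (U n) : EReal)) atTop (𝓝 (α : EReal)) ∧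
    Tendsto (fun n => upperEscapeRate T μ (U n) / (μ (U n) : EReal)) atTop (𝓝 (α : EReal))

/-! ### Short returns and the extremal index -/

/-- The limits `α̂_ℓ(K) = lim_n μ_{U_n}(τ^{ℓ-1}_{U_n} ≤ K)` exist for every `ℓ ≥ 1` and all large `K`, and
their limits `α̂_ℓ` as `K → ∞` satisfy `∑ ℓ α̂_ℓ < ∞`. -/
def HasSummableReturnLimits {X : Type*} [MeasurableSpace X] (T : X → X) (μ : Measure X)
    (U : ℕ → Set X) : Prop :=
  ∃ (a : ℕ → ℕ → ℝ) (ahat : ℕ → ℝ),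
    (∀ ℓ, 1 ≤ ℓ →
      (∀ᶠ K : ℕ in atTop,
        Tendsto (fun n => (ProbabilityTheory.cond μ (U n)).real
          {x | entryTimes T (U n) (ℓ - 1) x ≤ (K : ℕ∞)}) atTop (𝓝 (a ℓ K))) ∧
      Tendsto (a ℓ) atTop (𝓝 (ahat ℓ))) ∧
    Summable (fun ℓ : ℕ => (ℓ : ℝ) * ahat ℓ)

/-- The extremal index `lim_K lim_n μ_{U_n}(τ_{U_n} > K)` exists and equals `α`. -/
def IsExtremalIndex {X : Type*} [MeasurableSpace X] (T : X → X) (μ : Measure X)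
    (U : ℕ → Set X) (α : ℝ) : Prop :=
  ∃ a : ℕ → ℝ,
    (∀ᶠ K : ℕ in atTop,
      Tendsto (fun n => (ProbabilityTheory.cond μ (U n)).real
        {x | (K : ℕ∞) < entryTime T (U n) x}) atTop (𝓝 (a K))) ∧
    Tendsto a atTop (𝓝 α)

/-! ### Cylinders and Gibbs-Markov maps -/

/-- The `n`-cylinder of `x`: the points whose first `n` iterates (from `0` to `n - 1`) lie in the same
elements of the partition `𝒜` as those of `x`. -/
def cylinder {X : Type*} (T : X → X) (𝒜 : Set (Set X)) (n : ℕ) (x : X) : Set X :=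
  {y | ∀ j < n, ∀ A ∈ 𝒜, (T^[j] x ∈ A ↔ T^[j] y ∈ A)}

/-- The join `𝒜ⁿ`, as the set of all `n`-cylinders. -/
def cylinders {X : Type*} (T : X → X) (𝒜 : Set (Set X)) (n : ℕ) : Set (Set X) :=
  Set.range (cylinder T 𝒜 n)

/-- The distance `d_lam(x, y) = lam ^ s(x, y)`, where `s(x, y)` is the largest `n` for which `x` and `y`
lie in the same `n`-cylinder (and `d_lam(x, y) = 0` if there is no largest one). -/
noncomputable def cylinderDist {X : Type*} (T : X → X) (𝒜 : Set (Set X)) (lam : ℝ) (x y : X) : ℝ :=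
  ⨅ n : {n : ℕ // y ∈ cylinder T 𝒜 n x}, lam ^ (n : ℕ)

/-- `(T, μ)` is a Gibbs-Markov system with respect to the partition `𝒜`. -/
structure IsGibbsMarkov {X : Type*} [MeasurableSpace X] (T : X → X) (𝒜 : Set (Set X))
    (μ : Measure X) : Prop where
  isPartition : Setoid.IsPartition 𝒜
  countable : 𝒜.Countable
  measurableSet : ∀ A ∈ 𝒜, MeasurableSet A
  measure_pos : ∀ A ∈ 𝒜, 0 < μ A
  measurePreserving : MeasurePreserving T μ μ
  injOn : ∀ A ∈ 𝒜, Set.InjOn T A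
  markov : ∀ A ∈ 𝒜, ∃ 𝒮 ⊆ 𝒜, T '' A = ⋃₀ 𝒮
  generating : ∀ x, ⋂ n, cylinder T 𝒜 n x = {x}
  bigImage : ∃ c : ℝ, 0 < c ∧ ∀ A ∈ 𝒜, c < μ.real (T '' A)
  /-- There is a positive Jacobian `g = dμ/d(μ ∘ T)`, that is, `μ (T B) = ∫_B g⁻¹ dμ` for `B` inside an
  element of the partition, whose logarithm is Lipschitz on the elements of the partition for `d_lam`,
  with one constant. -/
  distortion : ∃ (lam C : ℝ) (g : X → ℝ), 0 < lam ∧ lam < 1 ∧ Measurable g ∧ (∀ x, 0 < g x) ∧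
    (∀ A ∈ 𝒜, ∀ B ⊆ A, MeasurableSet B → μ (T '' B) = ∫⁻ x in B, ENNReal.ofReal (g x)⁻¹ ∂μ) ∧
    ∀ A ∈ 𝒜, ∀ x ∈ A, ∀ y ∈ A,
      |Real.log (g x) - Real.log (g y)| ≤ C * cylinderDist T 𝒜 lam x y

/-- Mixing: `μ(A ∩ T⁻ⁿ B) → μ(A) μ(B)` for all measurable `A`, `B`. -/
def IsMixingMap {X : Type*} [MeasurableSpace X] (T : X → X) (μ : Measure X) : Prop :=
  ∀ A B : Set X, MeasurableSet A → MeasurableSet B →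
    Tendsto (fun n : ℕ => μ (A ∩ T^[n] ⁻¹' B)) atTop (𝓝 (μ A * μ B))

/-! ### Young towers -/

/-- The data of a Young tower: a mixing Gibbs-Markov base and a return time function that is constant on
the elements of the partition. -/
structure IsYoungTower {X : Type*} [MeasurableSpace X] (T : X → X) (𝒜 : Set (Set X))
    (R : X → ℕ+) (μ : Measure X) : Prop where
  gibbsMarkov : IsGibbsMarkov T 𝒜 μ
  mixing : IsMixingMap T μ
  returnTime_const : ∀ A ∈ 𝒜, ∀ x ∈ A, ∀ y ∈ A, R x = R y

/-- Exponential tail of the return time: `μ(R > n) ≤ C lamⁿ` for some `lam ∈ (0, 1)`. -/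
def HasExponentialTail {X : Type*} [MeasurableSpace X] (R : X → ℕ+) (μ : Measure X) : Prop :=
  ∃ C lam : ℝ, 0 < lam ∧ lam < 1 ∧ ∀ n : ℕ, μ.real {x | n < (R x : ℕ)} ≤ C * lam ^ n

/-- The tower over `X` with roof function `R`: the pairs `(x, k)` with `k < R x`. -/
abbrev Tower {X : Type*} (R : X → ℕ+) : Type _ :=
  {p : X × ℕ // p.2 < (R p.1 : ℕ)}

/-- The tower map: `(x, k) ↦ (x, k + 1)` if `k + 1 < R x` and `(x, R x - 1) ↦ (T x, 0)`. -/
def towerMap {X : Type*} (T : X → X) (R : X → ℕ+) (p : Tower R) : Tower R :=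
  if h : p.1.2 + 1 < (R p.1.1 : ℕ) then ⟨(p.1.1, p.1.2 + 1), h⟩ else ⟨(T p.1.1, 0), (R (T p.1.1)).pos⟩

/-- The normalized lift of `μ` to the tower: `A ↦ (∫ R dμ)⁻¹ ∑_k μ {x | k < R x ∧ (x, k) ∈ A}`. -/
noncomputable def towerMeasure {X : Type*} [MeasurableSpace X] (R : X → ℕ+) (μ : Measure X) :
    Measure (Tower R) :=
  (∫⁻ x, ((R x : ℕ) : ENNReal) ∂μ)⁻¹ •
    Measure.comap (Subtype.val : Tower R → X × ℕ) (μ.prod Measure.count)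

/-- A subset of the base, seen in the `0`th floor of the tower. -/
def baseFloor {X : Type*} (R : X → ℕ+) (U : Set X) : Set (Tower R) :=
  {p | p.1.2 = 0 ∧ p.1.1 ∈ U}

/-- The projection `(x, k) ↦ f^k (ι x)` of the tower to the space on which `f` acts. -/
def towerProj {X M : Type*} (f : M → M) (ι : X → M) (R : X → ℕ+) (p : Tower R) : M :=
  f^[p.1.2] (ι p.1.1)

/-- `f` is modelled by the tower, the base being embedded by `ι` so that `f^{R(x)}` acts on it as `T`, and
orbits that start in the base almost surely do not meet the sets `U_n` of the base strictly between time
`0` and the return time. -/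
structure IsModelledByTower {X M : Type*} [MeasurableSpace X] [MeasurableSpace M] (f : M → M)
    (ι : X → M) (T : X → X) (R : X → ℕ+) (μ : Measure X) (U : ℕ → Set X) : Prop where
  measurableEmbedding : MeasurableEmbedding ι
  return_eq : ∀ x, f^[(R x : ℕ)] (ι x) = ι (T x)
  no_early_entry : ∀ n, ∀ᵐ x ∂μ, ∀ k : ℕ, 0 < k → k < (R x : ℕ) → f^[k] (ι x) ∉ ι '' U n

/-! ### The two kinds of nested sets -/

/-- Good neighborhood systems of unions of cylinders. The union of the `j`-cylinders that meet `U_n` is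
the outer approximation `U_n^j`. -/
structure IsGoodNeighborhoodSystem {X : Type*} [MeasurableSpace X] (T : X → X) (𝒜 : Set (Set X))
    (μ : Measure X) (U : ℕ → Set X) : Prop where
  antitone : Antitone U
  measure_pos : ∀ n, 0 < μ (U n)
  tendsto_measure : Tendsto (fun n => μ (U n)) atTop (𝓝 0)
  exists_good : ∃ κ : ℕ → ℕ,
    (∀ n, ∃ 𝒮 ⊆ cylinders T 𝒜 (κ n), U n = ⋃₀ 𝒮) ∧
    Monotone κ ∧ Tendsto κ atTop atTop ∧
    (∃ ε : ℝ, 0 < ε ∧ ε < 1 ∧ Tendsto (fun n => (κ n : ℝ) * μ.real (U n) ^ ε) atTop (𝓝 0)) ∧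
    ∃ C p : ℝ, 0 < C ∧ 1 < p ∧ ∀ n j : ℕ, 1 ≤ j → j < κ n →
      μ.real (⋃₀ {A ∈ cylinders T 𝒜 j | (A ∩ U n).Nonempty}) ≤ μ.real (U n) + C * (j : ℝ) ^ (-p)

/-- The outer approximation: points at distance at most `r` from some point of `U`. -/
def outerApprox {X : Type*} [MetricSpace X] (r : ℝ) (U : Set X) : Set X :=
  ⋃ x ∈ U, Metric.closedBall x r

/-- The inner approximation: points at distance greater than `r` from every point outside `U`. -/
def innerApprox {X : Type*} [MetricSpace X] (r : ℝ) (U : Set X) : Set X :=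
  {x | Metric.closedBall x r ⊆ U}

/-- Superlevel sets `U_n = {φ > u_n}` of a continuous observable with values in `ℝ ∪ {+∞}` whose maximum is
attained on a null set, with thresholds `u_n ↗ sup φ`, that are well approximable and have a small
boundary. -/
def IsGoodOpenSystem {X : Type*} [MetricSpace X] [MeasurableSpace X] (T : X → X)
    (𝒜 : Set (Set X)) (μ : Measure X) (U : ℕ → Set X) : Prop :=
  ∃ (φ : X → EReal) (u : ℕ → ℝ) (r : ℕ → ℝ) (κ : ℕ → ℕ),
    -- the observable and the thresholds
    Continuous φ ∧ (∀ x, φ x ≠ ⊥) ∧ (∃ x, ∀ y, φ y ≤ φ x) ∧ μ {x | ∀ y, φ y ≤ φ x} = 0 ∧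
    Monotone u ∧ Tendsto (fun n => (u n : EReal)) atTop (𝓝 (⨆ x, φ x)) ∧
    (∀ n, U n = {x | (u n : EReal) < φ x}) ∧ (∀ n, 0 < μ (U n)) ∧
    -- approximation from inside and outside at the scales `r n`
    (∀ n, 0 < r n) ∧ Antitone r ∧ Tendsto r atTop (𝓝 0) ∧
    Tendsto (fun n => μ.real (outerApprox (r n) (U n) \ innerApprox (r n) (U n)) / μ.real (U n))
      atTop (𝓝 0) ∧
    -- `κ n` is the least positive integer with `diam 𝒜^{κ n} ≤ r n`
    (∀ n, IsLeast {k : ℕ | 0 < k ∧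
      ∀ A ∈ cylinders T 𝒜 k, Metric.ediam A ≤ ENNReal.ofReal (r n)} (κ n)) ∧
    (∃ ε : ℝ, 0 < ε ∧ ε < 1 ∧ Tendsto (fun n => (κ n : ℝ) * μ.real (U n) ^ ε) atTop (𝓝 0)) ∧
    -- the cylinders that meet the `r n`-neighborhood of the boundary of `U n`, or that meet both `U n`
    -- and its complement
    ∃ C p : ℝ, 0 < C ∧ 1 < p ∧ ∀ n j : ℕ, 1 ≤ j → j ≤ κ n →
      μ.real (⋃₀ {A ∈ cylinders T 𝒜 j |
        (A ∩ Metric.thickening (r n) (frontier (U n))).Nonempty ∨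
          ((A ∩ U n).Nonempty ∧ (A \ U n).Nonempty)}) ≤ C * (j : ℝ) ^ (-p)

/-! ### Unions of cylinders -/

section Cylinders

variable {X : Type*} {T : X → X} {𝒜 : Set (Set X)} {m n : ℕ} {x y z : X} {A B : Set X}

/-! Let r = ∫ R dμ, let S_L = `returnSum T R L`, and consider a hole V that is a union of
κ-cylinders. Let b(t) be the measure of `survivors T R V κ t` and let B(t) be `towerSurvival`, which
is r times the tower measure of {τ_V > t}. Invariance of the tower measure turns entering V exactly
at time t + 1 into starting in V and surviving up to t. This gives the exact identity B(t) - B(t+1)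
= μ(V ∩ {no entry up to t}) (`towerSurvival_eq_add`). It then suffices to show, for n large, that
B(t) ≈ r b(t) for all t (`eventually_abs_towerSurvival_sub_le`) and that μ(V ∩ {no entry up to t}) ≈
α₁ μ(V) b(t) for t large (`eventually_abs_hole_inter_survivors_sub_le`). The ratio B(t+1)/B(t) is
then close to 1 - α₁ μ(V)/r, with an error that is small relative to μ(V), and μ(V)/r is the tower
measure of V.

Two tools carry these asymptotics. The first is mixing with a gap: `exists_hasMixingGap` says that
μ(A ∩ T⁻⁽ⁿ⁺q⁾B) = (1 ± δ) μ(A) μ(B) for unions A of n-cylinders, with q independent of n, A and B.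
It follows from mixing because bounded distortion makes T^n push A forward to a measure that is
almost proportional to μ inside every fine cylinder.

The second is slow decay: b(t-u) ≤ exp(ηu) b(t) at a scale η → 0 with μ(V)/η → 0
(`exists_decay_scale`). Waiting for the end of a cylinder costs a random time S_κ, and slow decay
turns this cost into a factor exp(η S_κ). The tail of R and κ μ(V)^ε → 0 give ∫_V exp(η S_κ) dμ ≈
μ(V), so the cost is negligible even though it is conditioned on V. Slow decay itself is a renewal
argument: the loss from b(t) to b(t+1) is a sum over earlier values b(t-v), which an induction
bounds by C ∫_V exp(η S_κ) dμ · b(t).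

For points that start in V, returns up to a fixed time K produce the factor μ_V(τ_V > K), which
tends to α₁. Returns between K and K + κ + q are negligible because the j-cylinder hulls of V have
measure O(μ(V) + j^(-p)) with p > 1. The rate of B exists by Fekete's lemma, since
`eventually_half_mul_le_survivors_add` makes the survival probabilities in the base
supermultiplicative up to the factor 1/2.

In the open case the sets are squeezed between unions of κ_n-cylinders with the same extremal index
and asymptotically the same measure, and escape rates are monotone in the hole. For a map modelled
by the tower, almost every orbit visits the embedded set exactly when its lift visits the base copy,
so all quantities agree. -/

theorem mem_cylinder_self (T : X → X) (𝒜 : Set (Set X)) (n : ℕ) (x : X) :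
    x ∈ cylinder T 𝒜 n x := fun _ _ _ _ => Iff.rfl

theorem mem_cylinder_symm (h : y ∈ cylinder T 𝒜 n x) : x ∈ cylinder T 𝒜 n y :=
  fun j hj A hA => (h j hj A hA).symm

theorem mem_cylinder_trans (h : y ∈ cylinder T 𝒜 n x) (h' : z ∈ cylinder T 𝒜 n y) :
    z ∈ cylinder T 𝒜 n x :=
  fun j hj A hA => (h j hj A hA).trans (h' j hj A hA)

theorem cylinder_eq_of_mem (h : y ∈ cylinder T 𝒜 n x) :
    cylinder T 𝒜 n y = cylinder T 𝒜 n x :=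
  Set.Subset.antisymm (fun _ hz => mem_cylinder_trans h hz)
    fun _ hz => mem_cylinder_trans (mem_cylinder_symm h) hz

theorem cylinder_anti (h : m ≤ n) (x : X) : cylinder T 𝒜 n x ⊆ cylinder T 𝒜 m x :=
  fun _ hy j hj A hA => hy j (hj.trans_le h) A hA

theorem mem_cylinder_add_iff :
    y ∈ cylinder T 𝒜 (m + n) x ↔
      y ∈ cylinder T 𝒜 m x ∧ T^[m] y ∈ cylinder T 𝒜 n (T^[m] x) := by
  constructor
  · refine fun h => ⟨cylinder_anti (Nat.le_add_right m n) x h, fun j hj A hA => ?_⟩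
    have := h (j + m) (by omega) A hA
    rwa [Function.iterate_add_apply, Function.iterate_add_apply] at this
  · rintro ⟨h1, h2⟩ j hj A hA
    rcases lt_or_ge j m with hjm | hjm
    · exact h1 j hjm A hA
    · have := h2 (j - m) (by omega) A hA
      rwa [← Function.iterate_add_apply, ← Function.iterate_add_apply,
        Nat.sub_add_cancel hjm] at this

theorem mem_cylinder_one_iff : y ∈ cylinder T 𝒜 1 x ↔ ∀ A ∈ 𝒜, (x ∈ A ↔ y ∈ A) := by
  simp [_root_.cylinder]

/-- `A` is a union of `n`-cylinders. -/
def IsCylinderSet (T : X → X) (𝒜 : Set (Set X)) (n : ℕ) (A : Set X) : Prop :=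
  ∀ x ∈ A, cylinder T 𝒜 n x ⊆ A

namespace IsCylinderSet

theorem mono (hA : IsCylinderSet T 𝒜 m A) (h : m ≤ n) : IsCylinderSet T 𝒜 n A :=
  fun x hx => (cylinder_anti h x).trans (hA x hx)

theorem univ : IsCylinderSet T 𝒜 n Set.univ := fun _ _ => Set.subset_univ _

theorem of_cylinder (x : X) : IsCylinderSet T 𝒜 n (cylinder T 𝒜 n x) :=
  fun _ hy => (cylinder_eq_of_mem hy).subset

theorem inter (hA : IsCylinderSet T 𝒜 n A) (hB : IsCylinderSet T 𝒜 n B) :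
    IsCylinderSet T 𝒜 n (A ∩ B) :=
  fun x hx => Set.subset_inter (hA x hx.1) (hB x hx.2)

theorem preimage_iterate (hA : IsCylinderSet T 𝒜 n A) (m : ℕ) :
    IsCylinderSet T 𝒜 (m + n) (T^[m] ⁻¹' A) :=
  fun _ hx _ hy => hA _ hx (mem_cylinder_add_iff.1 hy).2

theorem setOf {P : X → Prop} (h : ∀ x, ∀ y ∈ _root_.cylinder T 𝒜 n x, P x → P y) :
    IsCylinderSet T 𝒜 n {x | P x} :=
  fun x hx y hy => h x y hy hx

/-- Whether T^j x lies in U is decided by the first j + κ symbols of x. -/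
theorem forall_notMem {κ : ℕ} {U : Set X} (hU : IsCylinderSet T 𝒜 κ U) (P : ℕ → Prop) (n : ℕ)
    (h : ∀ j, P j → j + κ ≤ n) : IsCylinderSet T 𝒜 n {x | ∀ j, P j → T^[j] x ∉ U} :=
  setOf fun _ _ hy hx j hj hjU =>
    hx j hj ((hU.preimage_iterate j).mono (h j hj) _ hjU (mem_cylinder_symm hy))

theorem inter_forall_notMem {κ : ℕ} {U : Set X} (hU : IsCylinderSet T 𝒜 κ U) (K : ℕ) :
    IsCylinderSet T 𝒜 (K + κ) (U ∩ {x | ∀ j, (1 ≤ j ∧ j ≤ K) → T^[j] x ∉ U}) :=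
  (hU.mono (by omega)).inter (hU.forall_notMem _ _ fun j hj => by omega)

end IsCylinderSet

/-- The sequence of the elements of the partition that the orbit of `x` visits up to time `n`. -/
noncomputable def itinerary (h : Setoid.IsPartition 𝒜) (T : X → X) (n : ℕ) (x : X) :
    Fin n → 𝒜 :=
  fun j => ⟨(h.2 (T^[j] x)).choose, (h.2 (T^[j] x)).choose_spec.1.1⟩

theorem mem_itinerary (h : Setoid.IsPartition 𝒜) (T : X → X) (n : ℕ) (x : X) (j : Fin n) :
    T^[j] x ∈ (itinerary h T n x j : Set X) :=
  (h.2 (T^[j] x)).choose_spec.1.2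

theorem mem_cylinder_iff_itinerary (h : Setoid.IsPartition 𝒜) :
    y ∈ cylinder T 𝒜 n x ↔ itinerary h T n y = itinerary h T n x := by
  constructor
  · intro hy
    funext j
    have hx := mem_itinerary h T n x j
    have hmem := (hy j j.2 _ (itinerary h T n x j).2).1 hx
    exact Subtype.ext ((h.2 (T^[j] y)).unique ⟨(itinerary h T n y j).2, mem_itinerary h T n y j⟩
      ⟨(itinerary h T n x j).2, hmem⟩)
  · intro hxy j hj A hA
    have key : ∀ z : X, T^[j] z ∈ A ↔ (itinerary h T n z ⟨j, hj⟩ : Set X) = A := fun z =>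
      ⟨fun hz => (h.2 (T^[j] z)).unique
        ⟨(itinerary h T n z ⟨j, hj⟩).2, mem_itinerary h T n z ⟨j, hj⟩⟩ ⟨hA, hz⟩,
        fun hz => hz ▸ mem_itinerary h T n z ⟨j, hj⟩⟩
    rw [key, key, hxy]

theorem cylinder_one_eq_of_mem (h : Setoid.IsPartition 𝒜) (hA : A ∈ 𝒜) (hx : x ∈ A) :
    cylinder T 𝒜 1 x = A := by
  ext y
  rw [mem_cylinder_one_iff]
  exact ⟨fun hy => (hy A hA).1 hx, fun hy B hB =>
    ⟨fun hxB => (h.2 x).unique ⟨hA, hx⟩ ⟨hB, hxB⟩ ▸ hy,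
      fun hyB => (h.2 y).unique ⟨hA, hy⟩ ⟨hB, hyB⟩ ▸ hx⟩⟩

theorem cylinder_one_mem (h : Setoid.IsPartition 𝒜) (T : X → X) (x : X) :
    cylinder T 𝒜 1 x ∈ 𝒜 := by
  obtain ⟨A, ⟨hA, hx⟩, -⟩ := h.2 x
  rwa [cylinder_one_eq_of_mem h hA hx]

theorem cylinder_eq_preimage_itinerary (h : Setoid.IsPartition 𝒜) (T : X → X) (n : ℕ) (x : X) :
    cylinder T 𝒜 n x = itinerary h T n ⁻¹' {itinerary h T n x} := by
  ext y
  exact mem_cylinder_iff_itinerary h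

theorem IsCylinderSet.preimage_itinerary (h : Setoid.IsPartition 𝒜) (s : Set (Fin n → 𝒜)) :
    IsCylinderSet T 𝒜 n (itinerary h T n ⁻¹' s) := by
  intro x hx y hy
  rw [mem_cylinder_iff_itinerary h] at hy
  simpa [Set.mem_preimage, hy] using hx

theorem IsCylinderSet.eq_preimage_itinerary (h : Setoid.IsPartition 𝒜)
    (hA : IsCylinderSet T 𝒜 n A) : A = itinerary h T n ⁻¹' (itinerary h T n '' A) := by
  refine Set.Subset.antisymm (Set.subset_preimage_image _ _) ?_
  rintro y ⟨x, hx, hxy⟩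
  exact hA x hx ((mem_cylinder_iff_itinerary h).2 hxy.symm)

variable [MeasurableSpace X]

theorem measurableSet_cylinder (h : Setoid.IsPartition 𝒜) (hm : ∀ A ∈ 𝒜, MeasurableSet A)
    (hT : Measurable T) (n : ℕ) (x : X) : MeasurableSet (cylinder T 𝒜 n x) := by
  have : cylinder T 𝒜 n x = ⋂ j : Fin n, T^[j] ⁻¹' (itinerary h T n x j : Set X) := by
    ext y
    rw [Set.mem_iInter, mem_cylinder_iff_itinerary h]
    refine ⟨fun hy j => hy ▸ mem_itinerary h T n y j, fun hy => funext fun j => Subtype.ext ?_⟩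
    exact (h.2 (T^[j] y)).unique ⟨(itinerary h T n y j).2, mem_itinerary h T n y j⟩
      ⟨(itinerary h T n x j).2, hy j⟩
  rw [this]
  exact MeasurableSet.iInter fun j => (hT.iterate j) (hm _ (itinerary h T n x j).2)

theorem measurableSet_preimage_itinerary (h : Setoid.IsPartition 𝒜) (hc : 𝒜.Countable)
    (hm : ∀ A ∈ 𝒜, MeasurableSet A) (hT : Measurable T) (n : ℕ) (s : Set (Fin n → 𝒜)) :
    MeasurableSet (itinerary h T n ⁻¹' s) := by
  have := hc.to_subtype
  rw [← Set.biUnion_preimage_singleton]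
  refine MeasurableSet.biUnion s.to_countable fun c _ => ?_
  by_cases hne : (itinerary h T n ⁻¹' {c}).Nonempty
  · obtain ⟨x, rfl⟩ := hne
    rw [← cylinder_eq_preimage_itinerary]
    exact measurableSet_cylinder h hm hT n x
  · rw [Set.not_nonempty_iff_eq_empty.1 hne]
    exact MeasurableSet.empty

theorem IsCylinderSet.measurableSet (h : Setoid.IsPartition 𝒜) (hc : 𝒜.Countable)
    (hm : ∀ A ∈ 𝒜, MeasurableSet A) (hT : Measurable T) (hA : IsCylinderSet T 𝒜 n A) :
    MeasurableSet A := by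
  rw [hA.eq_preimage_itinerary h]
  exact measurableSet_preimage_itinerary h hc hm hT n _

/-- A linear inequality between measures holds on unions of cylinders if it holds on cylinders. -/
theorem IsCylinderSet.measure_mul_le (h : Setoid.IsPartition 𝒜) (hc : 𝒜.Countable)
    (hm : ∀ A ∈ 𝒜, MeasurableSet A) (hT : Measurable T) {μ : Measure X}
    (hA : IsCylinderSet T 𝒜 n A) {P Q : Set X} {a b : ENNReal}
    (hP : MeasurableSet P) (hQ : MeasurableSet Q)
    (hle : ∀ x, μ (_root_.cylinder T 𝒜 n x ∩ P) * a ≤ μ (_root_.cylinder T 𝒜 n x ∩ Q) * b) :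
    μ (A ∩ P) * a ≤ μ (A ∩ Q) * b := by
  have := hc.to_subtype
  have hsum : ∀ P : Set X, MeasurableSet P →
      μ (A ∩ P) = ∑' c : itinerary h T n '' A, μ (itinerary h T n ⁻¹' {c.1} ∩ P) := by
    intro P hP
    rw [← measure_iUnion]
    · congr 1
      nth_rewrite 1 [hA.eq_preimage_itinerary h]
      rw [← Set.iUnion_inter]
      congr 1
      ext x
      simp [eq_comm]
    · intro c d hcd
      refine Disjoint.mono Set.inter_subset_left Set.inter_subset_left ?_
      exact Disjoint.preimage _ (Set.disjoint_singleton.2 fun h => hcd (Subtype.ext h))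
    · exact fun c => (measurableSet_preimage_itinerary h hc hm hT n _).inter hP
  rw [hsum P hP, hsum Q hQ, ← ENNReal.tsum_mul_right, ← ENNReal.tsum_mul_right]
  refine ENNReal.tsum_le_tsum ?_
  rintro ⟨_, x, hx, rfl⟩
  simpa only [← cylinder_eq_preimage_itinerary] using hle x

/-- Finitely many cylinders cover all but a small part of a probability space. -/
theorem exists_finset_itinerary_measure_lt (h : Setoid.IsPartition 𝒜) (hc : 𝒜.Countable)
    (hm : ∀ A ∈ 𝒜, MeasurableSet A) (hT : Measurable T) (μ : Measure X) [IsProbabilityMeasure μ]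
    (n : ℕ) {δ : ℝ} (hδ : 0 < δ) :
    ∃ F : Finset (Fin n → 𝒜), μ.real (itinerary h T n ⁻¹' (F : Set (Fin n → 𝒜))ᶜ) < δ := by
  have := hc.to_subtype
  have hmeas := measurableSet_preimage_itinerary h hc hm hT n
  have hone : ∑' c : Fin n → 𝒜, μ (itinerary h T n ⁻¹' {c}) = 1 := by
    rw [← measure_iUnion]
    · rw [← Set.preimage_iUnion, Set.iUnion_of_singleton, Set.preimage_univ, measure_univ]
    · exact fun c d hcd => Disjoint.preimage _ (Set.disjoint_singleton.2 hcd)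
    · exact fun c => hmeas _
  have hs : HasSum (fun c : Fin n → 𝒜 => μ.real (itinerary h T n ⁻¹' {c})) 1 := by
    have h1 := ENNReal.hasSum_toReal (f := fun c : Fin n → 𝒜 => μ (itinerary h T n ⁻¹' {c}))
      (by rw [hone]; exact ENNReal.one_ne_top)
    rwa [← ENNReal.tsum_toReal_eq (fun c => measure_ne_top _ _), hone, ENNReal.toReal_one] at h1
  obtain ⟨F, hF⟩ := (hs.eventually (lt_mem_nhds (show 1 - δ < 1 by linarith))).exists
  refine ⟨F, ?_⟩
  have hFeq : μ.real (itinerary h T n ⁻¹' (F : Set (Fin n → 𝒜)))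
      = ∑ c ∈ F, μ.real (itinerary h T n ⁻¹' {c}) := by
    rw [← measureReal_biUnion_finset]
    · congr 1
      ext x
      simp
    · exact fun c _ d _ hcd => Disjoint.preimage _ (Set.disjoint_singleton.2 hcd)
    · exact fun c _ => hmeas _
  rw [Set.preimage_compl, measureReal_compl (hmeas _), probReal_univ, hFeq]
  linarith

end Cylinders

/-! ### Bounded distortion of Gibbs-Markov maps -/

namespace IsGibbsMarkov

variable {X : Type*} [MeasurableSpace X] {T : X → X} {𝒜 : Set (Set X)} {μ : Measure X}

theorem measurableSet_of_isCylinderSet (hG : IsGibbsMarkov T 𝒜 μ) {n : ℕ} {A : Set X}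
    (hA : IsCylinderSet T 𝒜 n A) : MeasurableSet A :=
  hA.measurableSet hG.isPartition hG.countable hG.measurableSet hG.measurePreserving.measurable

theorem measurableSet_cylinder (hG : IsGibbsMarkov T 𝒜 μ) (n : ℕ) (x : X) :
    MeasurableSet (cylinder T 𝒜 n x) :=
  hG.measurableSet_of_isCylinderSet (IsCylinderSet.of_cylinder x)

theorem cylinder_one_subset_image (hG : IsGibbsMarkov T 𝒜 μ) (x : X) :
    cylinder T 𝒜 1 (T x) ⊆ T '' cylinder T 𝒜 1 x := by
  obtain ⟨𝒮, h𝒮, h⟩ := hG.markov _ (cylinder_one_mem hG.isPartition T x)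
  have hx : T x ∈ ⋃₀ 𝒮 := h ▸ Set.mem_image_of_mem T (mem_cylinder_self T 𝒜 1 x)
  obtain ⟨A, hA, hxA⟩ := hx
  rw [h, cylinder_one_eq_of_mem hG.isPartition (h𝒮 hA) hxA]
  exact Set.subset_sUnion_of_mem hA

/-- The Markov property, iterated: T^n maps an n-cylinder onto a set that contains every partition
element it meets. This is why r ≥ 1 is required. -/
theorem exists_iterate_eq (hG : IsGibbsMarkov T 𝒜 μ) {r : ℕ} (hr : 1 ≤ r) (n : ℕ) :
    ∀ x : X, ∀ z ∈ cylinder T 𝒜 r (T^[n] x), ∃ y ∈ cylinder T 𝒜 n x, T^[n] y = z := by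
  induction n with
  | zero => exact fun x z _ => ⟨z, fun j hj => absurd hj (Nat.not_lt_zero j), rfl⟩
  | succ n ih =>
    intro x z hz
    obtain ⟨y', hy', rfl⟩ := ih (T x) z hz
    have h1 : y' ∈ cylinder T 𝒜 (n + r) (T x) := mem_cylinder_add_iff.2 ⟨hy', hz⟩
    obtain ⟨y, hy, rfl⟩ := hG.cylinder_one_subset_image x (cylinder_anti (by omega) _ h1)
    refine ⟨y, ?_, rfl⟩
    rw [add_comm n 1, mem_cylinder_add_iff]
    exact ⟨hy, hy'⟩

theorem injOn_iterate (hG : IsGibbsMarkov T 𝒜 μ) (n : ℕ) (x : X) :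
    Set.InjOn T^[n] (cylinder T 𝒜 n x) := by
  induction n generalizing x with
  | zero => exact Function.injective_id.injOn
  | succ n ih =>
    intro y hy z hz hyz
    rw [add_comm n 1, mem_cylinder_add_iff] at hy hz
    exact hG.injOn _ (cylinder_one_mem hG.isPartition T x) hy.1 hz.1
      (ih (T x) hy.2 hz.2 hyz)

/-- On an (m+1)-cylinder log g deviates from log g(x) by at most |C| lam^(m+1), so T scales all
subsets by the same factor up to exp of twice that amount. The product form avoids dividing by null
measures. The second clause is what allows the estimate to be chained. -/
theorem exists_forall_image_measure [IsFiniteMeasure μ] (hG : IsGibbsMarkov T 𝒜 μ) :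
    ∃ lam K : ℝ, 0 < lam ∧ lam < 1 ∧ 0 ≤ K ∧ ∀ (m : ℕ) (x : X) (E F : Set X),
      E ⊆ cylinder T 𝒜 (m + 1) x → F ⊆ cylinder T 𝒜 (m + 1) x →
      MeasurableSet E → MeasurableSet F →
      μ.real E * μ.real (T '' F)
          ≤ Real.exp (K * lam ^ (m + 1)) * (μ.real F * μ.real (T '' E)) ∧
        (μ.real (T '' E) = 0 → μ.real E = 0) := by
  obtain ⟨lam, C, g, h0, h1, hgm, hg, hint, hlip⟩ := hG.distortion
  refine ⟨lam, 2 * |C|, h0, h1, by positivity, fun m x E F hE hF hEm hFm => ?_⟩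
  have hA := cylinder_one_mem hG.isPartition T x
  set A := cylinder T 𝒜 1 x
  have hsub : cylinder T 𝒜 (m + 1) x ⊆ A := cylinder_anti (by omega) x
  have hd : ∀ y ∈ cylinder T 𝒜 (m + 1) x,
      |Real.log (g x) - Real.log (g y)| ≤ |C| * lam ^ (m + 1) := by
    intro y hy
    refine (hlip A hA x (mem_cylinder_self T 𝒜 1 x) y (hsub hy)).trans ?_
    have hnn : 0 ≤ cylinderDist T 𝒜 lam x y := Real.iInf_nonneg fun n => by positivity
    have hle : cylinderDist T 𝒜 lam x y ≤ lam ^ (m + 1) :=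
      ciInf_le (f := fun n : {n : ℕ // y ∈ cylinder T 𝒜 n x} => lam ^ (n : ℕ))
        ⟨0, by rintro _ ⟨n, rfl⟩; positivity⟩ ⟨m + 1, hy⟩
    exact (mul_le_mul_of_nonneg_right (le_abs_self C) hnn).trans
      (mul_le_mul_of_nonneg_left hle (abs_nonneg C))
  set d := |C| * lam ^ (m + 1) with hd_def
  have hup : ∀ y ∈ cylinder T 𝒜 (m + 1) x, (g y)⁻¹ ≤ Real.exp d * (g x)⁻¹ := by
    intro y hy
    rw [← Real.exp_log (inv_pos.2 (hg y)), ← Real.exp_log (inv_pos.2 (hg x)), ← Real.exp_add,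
      Real.exp_le_exp, Real.log_inv, Real.log_inv]
    linarith [(abs_le.1 (hd y hy)).2]
  have hlow : ∀ y ∈ cylinder T 𝒜 (m + 1) x, Real.exp (-d) * (g x)⁻¹ ≤ (g y)⁻¹ := by
    intro y hy
    rw [← Real.exp_log (inv_pos.2 (hg y)), ← Real.exp_log (inv_pos.2 (hg x)), ← Real.exp_add,
      Real.exp_le_exp, Real.log_inv, Real.log_inv]
    linarith [(abs_le.1 (hd y hy)).1]
  have hgx := inv_pos.2 (hg x)
  have hFup : μ.real (T '' F) ≤ Real.exp d * (g x)⁻¹ * μ.real F := by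
    have : μ (T '' F) ≤ ENNReal.ofReal (Real.exp d * (g x)⁻¹) * μ F := by
      rw [hint A hA F (hF.trans hsub) hFm, ← setLIntegral_const]
      exact setLIntegral_mono' hFm fun y hy => ENNReal.ofReal_le_ofReal (hup y (hF hy))
    have h2 := ENNReal.toReal_mono (by finiteness) this
    rwa [ENNReal.toReal_mul, ENNReal.toReal_ofReal (by positivity)] at h2
  have hElow : Real.exp (-d) * (g x)⁻¹ * μ.real E ≤ μ.real (T '' E) := by
    have : ENNReal.ofReal (Real.exp (-d) * (g x)⁻¹) * μ E ≤ μ (T '' E) := by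
      rw [hint A hA E (hE.trans hsub) hEm, ← setLIntegral_const]
      exact setLIntegral_mono' hEm fun y hy => ENNReal.ofReal_le_ofReal (hlow y (hE hy))
    have h2 := ENNReal.toReal_mono (by finiteness) this
    rwa [ENNReal.toReal_mul, ENNReal.toReal_ofReal (by positivity)] at h2
  constructor
  · have hexp : Real.exp (2 * |C| * lam ^ (m + 1)) = Real.exp d * Real.exp d := by
      rw [← Real.exp_add]; congr 1; rw [hd_def]; ring
    have hcancel : Real.exp d * Real.exp (-d) = 1 := by rw [← Real.exp_add]; simp
    calc μ.real E * μ.real (T '' F) ≤ μ.real E * (Real.exp d * (g x)⁻¹ * μ.real F) := by gcongr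
      _ = Real.exp d * Real.exp d * (μ.real F * (Real.exp (-d) * (g x)⁻¹ * μ.real E)) := by
        linear_combination (-(Real.exp d * μ.real E * (g x)⁻¹ * μ.real F)) * hcancel
      _ ≤ Real.exp d * Real.exp d * (μ.real F * μ.real (T '' E)) := by gcongr
      _ = _ := by rw [hexp]
  · intro h0
    rw [h0] at hElow
    have := measureReal_nonneg (μ := μ) (s := E)
    have hpos : 0 < Real.exp (-d) * (g x)⁻¹ := by positivity
    nlinarith

theorem measurableSet_image_iterate [StandardBorelSpace X] (hG : IsGibbsMarkov T 𝒜 μ) (n : ℕ)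
    {x : X} {E : Set X} (hE : E ⊆ cylinder T 𝒜 n x) (hEm : MeasurableSet E) :
    MeasurableSet (T^[n] '' E) :=
  hEm.image_of_measurable_injOn (hG.measurePreserving.measurable.iterate n)
    ((hG.injOn_iterate n x).mono hE)

/-- The sets lie in cylinders whose length drops by one at each application of T, from n + r to r +
1. The distortion errors thus form a geometric series with a bound that depends on r but not on n.
-/
theorem exists_forall_image_iterate_measure [StandardBorelSpace X] [IsFiniteMeasure μ]
    (hG : IsGibbsMarkov T 𝒜 μ) :
    ∃ lam K : ℝ, 0 < lam ∧ lam < 1 ∧ 0 ≤ K ∧ ∀ (n r : ℕ) (x : X) (E F : Set X),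
      E ⊆ cylinder T 𝒜 (n + r) x → F ⊆ cylinder T 𝒜 (n + r) x →
      MeasurableSet E → MeasurableSet F →
      μ.real E * μ.real (T^[n] '' F)
          ≤ Real.exp (K * lam ^ r) * (μ.real F * μ.real (T^[n] '' E)) := by
  obtain ⟨lam, K, h0, h1, hK, h⟩ := hG.exists_forall_image_measure
  have hl : 0 < 1 - lam := by linarith
  refine ⟨lam, K / (1 - lam), h0, h1, by positivity, ?_⟩
  have main : ∀ (n r : ℕ) (x : X) (E F : Set X),
      E ⊆ cylinder T 𝒜 (n + r) x → F ⊆ cylinder T 𝒜 (n + r) x →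
      MeasurableSet E → MeasurableSet F →
      μ.real E * μ.real (T^[n] '' F)
          ≤ Real.exp (K * ∑ i ∈ Finset.range n, lam ^ (i + r + 1))
            * (μ.real F * μ.real (T^[n] '' E)) := by
    intro n
    induction n with
    | zero =>
      intro r x E F _ _ _ _
      simp [mul_comm]
    | succ n ih =>
      intro r x E F hE hF hEm hFm
      have hcyl : n + 1 + r = 1 + (n + r) := by ring
      have himg : ∀ G ⊆ cylinder T 𝒜 (n + 1 + r) x, T '' G ⊆ cylinder T 𝒜 (n + r) (T x) := by
        rintro G hG _ ⟨y, hy, rfl⟩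
        have := hG hy
        rw [hcyl, mem_cylinder_add_iff] at this
        exact this.2
      have hmeas : ∀ G ⊆ cylinder T 𝒜 (n + 1 + r) x, MeasurableSet G → MeasurableSet (T '' G) :=
        fun G hGs hGm => hG.measurableSet_image_iterate 1
          (hGs.trans (cylinder_anti (by omega) x)) hGm
      have hcyl' : n + 1 + r = n + r + 1 := by ring
      obtain ⟨hs, hz⟩ := h (n + r) x E F (hcyl' ▸ hE) (hcyl' ▸ hF) hEm hFm
      have hi := ih r (T x) (T '' E) (T '' F) (himg E hE) (himg F hF) (hmeas E hE hEm)
        (hmeas F hF hFm)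
      rw [Finset.sum_range_succ, mul_add, Real.exp_add, Function.iterate_succ, Set.image_comp,
        Set.image_comp]
      set D := Real.exp (K * ∑ i ∈ Finset.range n, lam ^ (i + r + 1))
      set d := Real.exp (K * lam ^ (n + r + 1))
      have hD : 0 < D := Real.exp_pos _
      have hd : 0 < d := Real.exp_pos _
      have e0 := measureReal_nonneg (μ := μ) (s := E)
      have f0 := measureReal_nonneg (μ := μ) (s := F)
      have e1 := measureReal_nonneg (μ := μ) (s := T '' E)
      have f1 := measureReal_nonneg (μ := μ) (s := T '' F)
      have e2 := measureReal_nonneg (μ := μ) (s := T^[n] '' (T '' E))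
      have f2 := measureReal_nonneg (μ := μ) (s := T^[n] '' (T '' F))
      -- The one-step and the inductive estimate are multiplied and the common factor μ(TE) μ(TF) is
      -- cancelled. The cases where this factor vanishes are treated first.
      rcases e1.eq_or_lt with he | he
      · rw [hz he.symm, zero_mul]; positivity
      rcases f1.eq_or_lt with hf | hf
      · rw [← hf, zero_mul, mul_zero] at hi
        have : μ.real (T^[n] '' (T '' F)) = 0 := by nlinarith
        rw [this, mul_zero]; positivity
      refine le_of_mul_le_mul_right ?_ (mul_pos he hf)
      have := mul_le_mul hs hi (by positivity) (by positivity)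
      linarith
  intro n r x E F hE hF hEm hFm
  refine (main n r x E F hE hF hEm hFm).trans ?_
  refine mul_le_mul_of_nonneg_right (Real.exp_le_exp.2 ?_) (by positivity)
  have hsum : ∑ i ∈ Finset.range n, lam ^ (i + r + 1) ≤ lam ^ r / (1 - lam) := by
    have h2 : ∑ i ∈ Finset.range n, lam ^ (i + r + 1)
        = lam ^ r * (lam * ∑ i ∈ Finset.range n, lam ^ i) := by
      rw [Finset.mul_sum, Finset.mul_sum]
      exact Finset.sum_congr rfl fun i _ => by ring
    have h3 : ∑ i ∈ Finset.range n, lam ^ i ≤ (1 - lam)⁻¹ := by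
      rw [← tsum_geometric_of_lt_one h0.le h1]
      exact (summable_geometric_of_lt_one h0.le h1).sum_le_tsum _ fun i _ => by positivity
    rw [h2, div_eq_mul_inv]
    have h4 : 0 ≤ ∑ i ∈ Finset.range n, lam ^ i := Finset.sum_nonneg fun i _ => by positivity
    have : lam * ∑ i ∈ Finset.range n, lam ^ i ≤ (1 - lam)⁻¹ := by nlinarith
    gcongr
  calc K * ∑ i ∈ Finset.range n, lam ^ (i + r + 1) ≤ K * (lam ^ r / (1 - lam)) := by gcongr
    _ = K / (1 - lam) * lam ^ r := by ring

end IsGibbsMarkov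

/-! ### Mixing of Gibbs-Markov maps, uniformly over cylinders -/

section

variable {X : Type*} [MeasurableSpace X]

/-- `μ (A ∩ T⁻⁽ⁿ⁺q⁾ B) ≤ C μ(A) μ(B)` for all unions of `n`-cylinders `A` and all measurable `B`. -/
def HasProductBound (T : X → X) (𝒜 : Set (Set X)) (μ : Measure X) (q : ℕ) (C : ℝ) : Prop :=
  ∀ (n : ℕ) (A B : Set X), IsCylinderSet T 𝒜 n A → MeasurableSet B →
    μ.real (A ∩ T^[n + q] ⁻¹' B) ≤ C * (μ.real A * μ.real B)

/-- `μ (A ∩ T⁻⁽ⁿ⁺q⁾ B)` differs from `μ(A) μ(B)` by at most `δ μ(A) μ(B)`, for all unions of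
`n`-cylinders `A` and all measurable `B`. -/
def HasMixingGap (T : X → X) (𝒜 : Set (Set X)) (μ : Measure X) (q : ℕ) (δ : ℝ) : Prop :=
  ∀ (n : ℕ) (A B : Set X), IsCylinderSet T 𝒜 n A → MeasurableSet B →
    |μ.real (A ∩ T^[n + q] ⁻¹' B) - μ.real A * μ.real B| ≤ δ * (μ.real A * μ.real B)

theorem IsCylinderSet.measureReal_mul_le {T : X → X} {𝒜 : Set (Set X)} {n : ℕ} {A : Set X}
    (h : Setoid.IsPartition 𝒜) (hc : 𝒜.Countable)
    (hm : ∀ A ∈ 𝒜, MeasurableSet A) (hT : Measurable T) {μ : Measure X} [IsFiniteMeasure μ]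
    (hA : IsCylinderSet T 𝒜 n A) {P Q : Set X} {a b : ℝ} (ha : 0 ≤ a) (hb : 0 ≤ b)
    (hP : MeasurableSet P) (hQ : MeasurableSet Q)
    (hle : ∀ x, μ.real (cylinder T 𝒜 n x ∩ P) * a ≤ μ.real (cylinder T 𝒜 n x ∩ Q) * b) :
    μ.real (A ∩ P) * a ≤ μ.real (A ∩ Q) * b := by
  have key := hA.measure_mul_le h hc hm hT (μ := μ) (a := ENNReal.ofReal a)
    (b := ENNReal.ofReal b) hP hQ (fun x => by
      rw [← ofReal_measureReal, ← ofReal_measureReal, ← ENNReal.ofReal_mul measureReal_nonneg,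
        ← ENNReal.ofReal_mul measureReal_nonneg]
      exact ENNReal.ofReal_le_ofReal (hle x))
  have h2 := ENNReal.toReal_mono (by finiteness) key
  rwa [ENNReal.toReal_mul, ENNReal.toReal_mul, ENNReal.toReal_ofReal ha,
    ENNReal.toReal_ofReal hb] at h2

end

namespace IsGibbsMarkov

variable {X : Type*} [MeasurableSpace X] [StandardBorelSpace X] {T : X → X} {𝒜 : Set (Set X)}
  {μ : Measure X} [IsProbabilityMeasure μ]

/-- For n ≥ 1 distortion compares μ(F ∩ T⁻ⁿB)/μ(F) with μ(B)/μ(TⁿF) on an n-cylinder F, and the big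
image property bounds μ(TⁿF) below. For n = 0 the only cylinder is the whole space, which accounts
for the 1 in the maximum. -/
theorem exists_hasProductBound (hG : IsGibbsMarkov T 𝒜 μ) :
    ∃ C : ℝ, 1 ≤ C ∧ HasProductBound T 𝒜 μ 0 C := by
  obtain ⟨lam, K, -, -, hK, h⟩ := hG.exists_forall_image_iterate_measure
  obtain ⟨c, hc, himg⟩ := hG.bigImage
  have hTm := hG.measurePreserving.measurable
  have hmax : 0 < max 1 (Real.exp K / c) := lt_max_of_lt_left one_pos
  refine ⟨max 1 (Real.exp K / c), le_max_left _ _, fun n A B hA hB => ?_⟩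
  have := hA.measureReal_mul_le hG.isPartition hG.countable hG.measurableSet hTm (μ := μ)
    (P := T^[n + 0] ⁻¹' B) (Q := Set.univ) (a := 1) (b := max 1 (Real.exp K / c) * μ.real B)
    zero_le_one (by positivity) (hTm.iterate _ hB) MeasurableSet.univ (fun x => ?_)
  · rw [Set.inter_univ, mul_one] at this
    linarith
  rw [Set.inter_univ, mul_one, add_zero]
  rcases n with _ | n
  · have hu : cylinder T 𝒜 0 x = Set.univ :=
      Set.eq_univ_of_forall fun y j hj => absurd hj (Nat.not_lt_zero j)
    rw [hu, Set.univ_inter, probReal_univ, one_mul]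
    exact le_mul_of_one_le_left measureReal_nonneg (le_max_left _ _)
  · set F := cylinder T 𝒜 (n + 1) x with hF
    set E := F ∩ T^[n + 1] ⁻¹' B with hE
    have hFm := hG.measurableSet_cylinder (n + 1) x
    have hEm : MeasurableSet E := hFm.inter (hTm.iterate _ hB)
    have h1 := h (n + 1) 0 x E F Set.inter_subset_left subset_rfl hEm hFm
    rw [pow_zero, mul_one] at h1
    have h2 : μ.real (T^[n + 1] '' E) ≤ μ.real B :=
      measureReal_mono (by rintro _ ⟨y, hy, rfl⟩; exact hy.2)
    -- T^n F contains the partition element of T^n x, whose image has measure more than c.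
    have h3 : c ≤ μ.real (T^[n + 1] '' F) := by
      refine (himg _ (cylinder_one_mem hG.isPartition T (T^[n] x))).le.trans
        (measureReal_mono ?_)
      rintro _ ⟨z, hz, rfl⟩
      obtain ⟨y, hy, rfl⟩ := hG.exists_iterate_eq le_rfl n x z hz
      exact ⟨y, mem_cylinder_add_iff.2 ⟨hy, hz⟩, Function.iterate_succ_apply' T n y⟩
    have e0 := measureReal_nonneg (μ := μ) (s := E)
    have f0 := measureReal_nonneg (μ := μ) (s := F)
    have b0 := measureReal_nonneg (μ := μ) (s := B)
    have h4 : μ.real E * c ≤ Real.exp K * (μ.real F * μ.real B) :=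
      (mul_le_mul_of_nonneg_left h3 e0).trans (h1.trans (by gcongr))
    calc μ.real E ≤ Real.exp K * (μ.real F * μ.real B) / c := (le_div_iff₀ hc).2 h4
      _ = μ.real F * (Real.exp K / c * μ.real B) := by ring
      _ ≤ μ.real F * (max 1 (Real.exp K / c) * μ.real B) := by
        gcongr; exact le_max_right _ _

/-- Inside an `r`-cylinder, the push-forwards of the restrictions of `μ` to unions of `n`-cylinders
are proportional to `μ` up to a factor that tends to `1` as `r → ∞`. -/
theorem exists_preimage_measure_mul_le (hG : IsGibbsMarkov T 𝒜 μ) :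
    ∃ lam K : ℝ, 0 < lam ∧ lam < 1 ∧ ∀ (n r : ℕ) (x : X) (A E F : Set X), 1 ≤ r →
      IsCylinderSet T 𝒜 n A → E ⊆ cylinder T 𝒜 r x → F ⊆ cylinder T 𝒜 r x →
      MeasurableSet E → MeasurableSet F →
      μ.real (A ∩ T^[n] ⁻¹' E) * μ.real F
        ≤ Real.exp (K * lam ^ r) * (μ.real (A ∩ T^[n] ⁻¹' F) * μ.real E) := by
  obtain ⟨lam, K, h0, h1, hK, h⟩ := hG.exists_forall_image_iterate_measure
  have hTm := hG.measurePreserving.measurable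
  refine ⟨lam, K, h0, h1, fun n r x A E F hr hA hE hF hEm hFm => ?_⟩
  have := hA.measureReal_mul_le hG.isPartition hG.countable hG.measurableSet hTm (μ := μ)
    (P := T^[n] ⁻¹' E) (Q := T^[n] ⁻¹' F) (a := μ.real F)
    (b := Real.exp (K * lam ^ r) * μ.real E) measureReal_nonneg (by positivity)
    (hTm.iterate _ hEm) (hTm.iterate _ hFm) (fun y => ?_)
  · linarith
  by_cases hne : ∃ z ∈ cylinder T 𝒜 n y, T^[n] z ∈ cylinder T 𝒜 r x
  · obtain ⟨z, hzy, hzx⟩ := hne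
    rw [← cylinder_eq_of_mem hzy]
    rw [← cylinder_eq_of_mem hzx] at hE hF
    have hsub : ∀ G ⊆ cylinder T 𝒜 r (T^[n] z),
        cylinder T 𝒜 n z ∩ T^[n] ⁻¹' G ⊆ cylinder T 𝒜 (n + r) z :=
      fun G hGs w hw => mem_cylinder_add_iff.2 ⟨hw.1, hGs hw.2⟩
    -- By the Markov property each branch of T^n that reaches the r-cylinder covers all of it, so
    -- the images are exactly E and F and do not depend on the branch.
    have himg : ∀ G ⊆ cylinder T 𝒜 r (T^[n] z),
        T^[n] '' (cylinder T 𝒜 n z ∩ T^[n] ⁻¹' G) = G := by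
      intro G hGs
      refine Set.Subset.antisymm (by rintro _ ⟨w, hw, rfl⟩; exact hw.2) fun w hw => ?_
      obtain ⟨v, hv, rfl⟩ := hG.exists_iterate_eq hr n z w (hGs hw)
      exact ⟨v, ⟨hv, hw⟩, rfl⟩
    have hcm := hG.measurableSet_cylinder n z
    have key := h n r z _ _ (hsub E hE) (hsub F hF) (hcm.inter (hTm.iterate n hEm))
      (hcm.inter (hTm.iterate n hFm))
    rw [himg E hE, himg F hF] at key
    linarith
  · have hemp : cylinder T 𝒜 n y ∩ T^[n] ⁻¹' E = ∅ :=
      Set.eq_empty_of_forall_notMem fun z hz => hne ⟨z, hz.1, hE hz.2⟩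
    rw [hemp, measureReal_empty, zero_mul]
    positivity

/-- The proportionality factors exp(K lam^r) tend to 1. Hence, given that T^n lands in a fine
r-cylinder, its law started from A is almost μ conditioned on that cylinder, uniformly in n and A.
-/
theorem exists_abs_preimage_measure_mul_sub_le (hG : IsGibbsMarkov T 𝒜 μ) {δ : ℝ} (hδ : 0 < δ) :
    ∃ r₀ : ℕ, ∀ (n r : ℕ) (x : X) (A E : Set X), r₀ ≤ r →
      IsCylinderSet T 𝒜 n A → MeasurableSet E →
      |μ.real (A ∩ T^[n] ⁻¹' (cylinder T 𝒜 r x ∩ E)) - μ.real (A ∩ T^[n] ⁻¹' cylinder T 𝒜 r x) *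
          (μ.real (cylinder T 𝒜 r x ∩ E) / μ.real (cylinder T 𝒜 r x))|
        ≤ δ * (μ.real (A ∩ T^[n] ⁻¹' cylinder T 𝒜 r x) *
          (μ.real (cylinder T 𝒜 r x ∩ E) / μ.real (cylinder T 𝒜 r x))) := by
  obtain ⟨lam, K, h0, h1, h⟩ := hG.exists_preimage_measure_mul_le
  obtain ⟨C, -, hC⟩ := hG.exists_hasProductBound
  have hlim : Tendsto (fun r : ℕ => Real.exp (K * lam ^ r)) atTop (𝓝 1) := by
    have h2 := ((tendsto_pow_atTop_nhds_zero_of_lt_one h0.le h1).const_mul K).rexp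
    rwa [mul_zero, Real.exp_zero] at h2
  obtain ⟨r₀, hr₀⟩ := eventually_atTop.1 (hlim.eventually (gt_mem_nhds (show 1 < 1 + δ by linarith)))
  refine ⟨max r₀ 1, fun n r x A E hr hA hE => ?_⟩
  have hZm := hG.measurableSet_cylinder r x
  set Z := cylinder T 𝒜 r x with hZ
  have hd := (hr₀ r ((le_max_left _ _).trans hr)).le
  have hr1 : 1 ≤ r := (le_max_right _ _).trans hr
  have i1 := h n r x A (Z ∩ E) Z hr1 hA Set.inter_subset_left subset_rfl (hZm.inter hE) hZm
  have i2 := h n r x A Z (Z ∩ E) hr1 hA subset_rfl Set.inter_subset_left hZm (hZm.inter hE)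
  have i3 := hC n A Z hA hZm
  have hmono : μ.real (A ∩ T^[n] ⁻¹' (Z ∩ E)) ≤ μ.real (A ∩ T^[n] ⁻¹' Z) :=
    measureReal_mono (fun y hy => ⟨hy.1, hy.2.1⟩)
  rw [add_zero] at i3
  set p := μ.real (A ∩ T^[n] ⁻¹' (Z ∩ E))
  set a := μ.real (A ∩ T^[n] ⁻¹' Z)
  set e := μ.real (Z ∩ E)
  set z := μ.real Z
  have p0 : 0 ≤ p := measureReal_nonneg
  have a0 : 0 ≤ a := measureReal_nonneg
  have e0 : 0 ≤ e := measureReal_nonneg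
  have z0 : 0 ≤ z := measureReal_nonneg
  rcases z0.eq_or_lt with hz | hz
  -- If the r-cylinder is null, the quotient is a division by zero. The product bound makes every
  -- term vanish.
  · have ha : a = 0 := by
      rw [← hz, mul_zero, mul_zero] at i3
      exact le_antisymm i3 a0
    have hp : p = 0 := le_antisymm (hmono.trans ha.le) p0
    simp [ha, hp]
  · have j1 : p * z ≤ (1 + δ) * (a * e) := i1.trans (by gcongr)
    have j2 : a * e ≤ (1 + δ) * (p * z) := i2.trans (by gcongr)
    have hy : a * (e / z) = a * e / z := by ring
    rw [hy, abs_le]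
    set y := a * e / z with hy_def
    have hyz : a * e = y * z := by rw [hy_def]; field_simp
    rw [hyz] at j1 j2
    have k1 : p ≤ (1 + δ) * y := le_of_mul_le_mul_right (by linarith) hz
    have k2 : y ≤ (1 + δ) * p := le_of_mul_le_mul_right (by linarith) hz
    constructor
    · nlinarith
    · linarith

end IsGibbsMarkov

theorem measureReal_eq_sum_preimage_add {X ι : Type*} [MeasurableSpace X] {μ : Measure X}
    [IsFiniteMeasure μ] {f : X → ι} (hf : ∀ s, MeasurableSet (f ⁻¹' s)) (F : Finset ι)
    (G : Set X) (hG : MeasurableSet G) :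
    μ.real G = ∑ c ∈ F, μ.real (G ∩ f ⁻¹' {c}) + μ.real (G ∩ f ⁻¹' (F : Set ι)ᶜ) := by
  rw [← measureReal_inter_add_sdiff (s := G) (hf (F : Set ι)), ← measureReal_biUnion_finset]
  · congr 2
    ext x
    simp
  · exact fun c _ d _ hcd => ((Disjoint.preimage f (Set.disjoint_singleton.2 hcd)).mono
      Set.inter_subset_right Set.inter_subset_right)
  · exact fun c _ => hG.inter (hf _)

namespace IsGibbsMarkov

variable {X : Type*} [MeasurableSpace X] [StandardBorelSpace X] {T : X → X} {𝒜 : Set (Set X)}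
  {μ : Measure X} [IsProbabilityMeasure μ]

/-- Indexing the r-cylinders by words allows sums over finite sets of them. A word that does not
occur contributes only zeros. -/
theorem exists_abs_preimage_itinerary_sub_le (hG : IsGibbsMarkov T 𝒜 μ) {δ : ℝ} (hδ : 0 < δ) :
    ∃ r : ℕ, ∀ (n : ℕ) (A E : Set X) (c : Fin r → 𝒜), IsCylinderSet T 𝒜 n A →
      MeasurableSet E →
      |μ.real (A ∩ T^[n] ⁻¹' (itinerary hG.isPartition T r ⁻¹' {c} ∩ E)) -
        μ.real (A ∩ T^[n] ⁻¹' (itinerary hG.isPartition T r ⁻¹' {c})) *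
          (μ.real (itinerary hG.isPartition T r ⁻¹' {c} ∩ E) /
            μ.real (itinerary hG.isPartition T r ⁻¹' {c}))|
        ≤ δ * (μ.real (A ∩ T^[n] ⁻¹' (itinerary hG.isPartition T r ⁻¹' {c})) *
          (μ.real (itinerary hG.isPartition T r ⁻¹' {c} ∩ E) /
            μ.real (itinerary hG.isPartition T r ⁻¹' {c}))) := by
  obtain ⟨r, h⟩ := hG.exists_abs_preimage_measure_mul_sub_le hδ
  refine ⟨r, fun n A E c hA hE => ?_⟩
  by_cases hne : (itinerary hG.isPartition T r ⁻¹' {c}).Nonempty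
  · obtain ⟨x, rfl⟩ := hne
    rw [← cylinder_eq_preimage_itinerary]
    exact h n r x A E le_rfl hA hE
  · rw [Set.not_nonempty_iff_eq_empty.1 hne]
    simp

/-- The set A enters only through the masses that T^n sends to the r-cylinders. Mixing is applied to
the finitely many cylinders in F, which gives one q for all n and A, and the product bound controls
the remaining cylinders. The error is proportional to μ(A), but not yet to μ(Y). -/
theorem eventually_abs_measure_inter_preimage_sub_le (hG : IsGibbsMarkov T 𝒜 μ)
    (hM : IsMixingMap T μ) {Y : Set X} (hY : MeasurableSet Y) {δ : ℝ} (hδ : 0 < δ) :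
    ∀ᶠ q : ℕ in atTop, ∀ (n : ℕ) (A : Set X), IsCylinderSet T 𝒜 n A →
      |μ.real (A ∩ T^[n + q] ⁻¹' Y) - μ.real A * μ.real Y| ≤ δ * μ.real A := by
  have hTm := hG.measurePreserving.measurable
  obtain ⟨C, hC1, hC⟩ := hG.exists_hasProductBound
  obtain ⟨r, hr⟩ := hG.exists_abs_preimage_itinerary_sub_le (show 0 < δ / 4 by positivity)
  have hC0 : 0 < C := by linarith
  obtain ⟨F, hF⟩ := exists_finset_itinerary_measure_lt hG.isPartition hG.countable
    hG.measurableSet hTm μ r (show 0 < δ / (4 * C) by positivity)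
  set f := itinerary hG.isPartition T r
  have hfm : ∀ s, MeasurableSet (f ⁻¹' s) :=
    measurableSet_preimage_itinerary hG.isPartition hG.countable hG.measurableSet hTm r
  have hev : ∀ c : Fin r → 𝒜, ∀ᶠ q : ℕ in atTop, ∀ (n : ℕ) (A : Set X), IsCylinderSet T 𝒜 n A →
      μ.real (A ∩ T^[n] ⁻¹' (f ⁻¹' {c})) *
        |μ.real (f ⁻¹' {c} ∩ T^[q] ⁻¹' Y) / μ.real (f ⁻¹' {c}) - μ.real Y|
        ≤ δ / 4 * μ.real (A ∩ T^[n] ⁻¹' (f ⁻¹' {c})) := by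
    intro c
    rcases (measureReal_nonneg (μ := μ) (s := f ⁻¹' {c})).eq_or_lt with hz | hz
    · refine Eventually.of_forall fun q n A hA => ?_
      have h1 := hC n A _ hA (hfm {c})
      rw [← hz, mul_zero, mul_zero, add_zero] at h1
      rw [le_antisymm h1 measureReal_nonneg]
      simp
    · have hlim : Tendsto (fun q : ℕ => μ.real (f ⁻¹' {c} ∩ T^[q] ⁻¹' Y) / μ.real (f ⁻¹' {c}))
          atTop (𝓝 (μ.real Y)) := by
        have h1 := (ENNReal.tendsto_toReal (by finiteness)).comp (hM _ _ (hfm {c}) hY)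
        have h2 := h1.div_const (μ.real (f ⁻¹' {c}))
        rw [ENNReal.toReal_mul] at h2
        change Tendsto _ _ (𝓝 (μ.real (f ⁻¹' {c}) * μ.real Y / μ.real (f ⁻¹' {c}))) at h2
        rwa [mul_div_cancel_left₀ _ hz.ne'] at h2
      filter_upwards [Metric.tendsto_nhds.1 hlim (δ / 4) (by positivity)] with q hq n A _
      rw [mul_comm (δ / 4)]
      exact mul_le_mul_of_nonneg_left (by rw [← Real.dist_eq]; exact hq.le) measureReal_nonneg
  filter_upwards [(eventually_all_finset F).2 fun c _ => hev c] with q hq n A hA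
  have hAm := hG.measurableSet_of_isCylinderSet hA
  have hEm : MeasurableSet (T^[q] ⁻¹' Y) := hTm.iterate q hY
  have hpre : T^[n + q] ⁻¹' Y = T^[n] ⁻¹' (T^[q] ⁻¹' Y) := by
    rw [add_comm, Function.iterate_add, Set.preimage_comp]
  have hsplit : ∀ E, MeasurableSet E → μ.real (A ∩ T^[n] ⁻¹' E) =
      ∑ c ∈ F, μ.real (A ∩ T^[n] ⁻¹' (f ⁻¹' {c} ∩ E))
        + μ.real (A ∩ T^[n] ⁻¹' (f ⁻¹' (F : Set (Fin r → 𝒜))ᶜ ∩ E)) := by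
    intro E hE
    rw [measureReal_eq_sum_preimage_add (f := f ∘ T^[n])
      (fun s => by rw [Set.preimage_comp]; exact hTm.iterate n (hfm s)) F _
      (hAm.inter (hTm.iterate n hE))]
    congr 1
    · refine Finset.sum_congr rfl fun c _ => congrArg _ ?_
      ext x; simp only [Set.mem_inter_iff, Set.mem_preimage, Function.comp]; tauto
    · congr 1
      ext x; simp only [Set.mem_inter_iff, Set.mem_preimage, Function.comp]; tauto
  have hA' := hsplit Set.univ MeasurableSet.univ
  simp only [Set.preimage_univ, Set.inter_univ] at hA'
  have hrest := hC n A _ hA (hfm (F : Set (Fin r → 𝒜))ᶜ)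
  rw [add_zero] at hrest
  have hmono : μ.real (A ∩ T^[n] ⁻¹' (f ⁻¹' (F : Set (Fin r → 𝒜))ᶜ ∩ T^[q] ⁻¹' Y)) ≤
      μ.real (A ∩ T^[n] ⁻¹' (f ⁻¹' (F : Set (Fin r → 𝒜))ᶜ)) :=
    measureReal_mono fun y hy => ⟨hy.1, hy.2.1⟩
  have hA0 := measureReal_nonneg (μ := μ) (s := A)
  have hrest' : μ.real (A ∩ T^[n] ⁻¹' (f ⁻¹' (F : Set (Fin r → 𝒜))ᶜ)) ≤ δ / 4 * μ.real A := by
    refine hrest.trans ?_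
    calc C * (μ.real A * μ.real (f ⁻¹' (F : Set (Fin r → 𝒜))ᶜ))
        ≤ C * (μ.real A * (δ / (4 * C))) := by gcongr
      _ = δ / 4 * μ.real A := by field_simp
  have hpiece : ∀ c ∈ F, |μ.real (A ∩ T^[n] ⁻¹' (f ⁻¹' {c} ∩ T^[q] ⁻¹' Y)) -
      μ.real (A ∩ T^[n] ⁻¹' (f ⁻¹' {c})) * μ.real Y|
        ≤ δ / 2 * μ.real (A ∩ T^[n] ⁻¹' (f ⁻¹' {c})) := by
    intro c hc
    have h1 := hr n A _ c hA hEm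
    have h2 := hq c hc n A hA
    have h3 : μ.real (f ⁻¹' {c} ∩ T^[q] ⁻¹' Y) / μ.real (f ⁻¹' {c}) ≤ 1 :=
      div_le_one_of_le₀ (measureReal_mono Set.inter_subset_left) measureReal_nonneg
    set a := μ.real (A ∩ T^[n] ⁻¹' (f ⁻¹' {c}))
    set ρ := μ.real (f ⁻¹' {c} ∩ T^[q] ⁻¹' Y) / μ.real (f ⁻¹' {c})
    have a0 : 0 ≤ a := measureReal_nonneg
    have h4 : |a * ρ - a * μ.real Y| ≤ δ / 4 * a := by
      rw [← mul_sub, abs_mul, abs_of_nonneg a0]; exact h2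
    have h5 : a * ρ ≤ a := mul_le_of_le_one_right a0 h3
    calc _ ≤ δ / 4 * (a * ρ) + δ / 4 * a := (abs_sub_le _ _ _).trans (add_le_add h1 h4)
      _ ≤ δ / 4 * a + δ / 4 * a := by gcongr
      _ = δ / 2 * a := by ring
  set ar := μ.real (A ∩ T^[n] ⁻¹' (f ⁻¹' (F : Set (Fin r → 𝒜))ᶜ))
  set pr := μ.real (A ∩ T^[n] ⁻¹' (f ⁻¹' (F : Set (Fin r → 𝒜))ᶜ ∩ T^[q] ⁻¹' Y))
  have ar0 : 0 ≤ ar := measureReal_nonneg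
  have pr0 : 0 ≤ pr := measureReal_nonneg
  have hYle : μ.real Y ≤ 1 := measureReal_le_one
  have hY0 : 0 ≤ μ.real Y := measureReal_nonneg
  have hrabs : |pr - ar * μ.real Y| ≤ ar := by
    have : ar * μ.real Y ≤ ar := mul_le_of_le_one_right ar0 hYle
    have : 0 ≤ ar * μ.real Y := by positivity
    rw [abs_le]; constructor <;> linarith
  have hdiff : μ.real (A ∩ T^[n + q] ⁻¹' Y) - μ.real A * μ.real Y =
      ∑ c ∈ F, (μ.real (A ∩ T^[n] ⁻¹' (f ⁻¹' {c} ∩ T^[q] ⁻¹' Y)) -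
        μ.real (A ∩ T^[n] ⁻¹' (f ⁻¹' {c})) * μ.real Y) + (pr - ar * μ.real Y) := by
    rw [hpre, hsplit _ hEm, Finset.sum_sub_distrib, ← Finset.sum_mul]
    conv_lhs => rw [hA']
    ring
  rw [hdiff]
  calc _ ≤ ∑ c ∈ F, δ / 2 * μ.real (A ∩ T^[n] ⁻¹' (f ⁻¹' {c})) + ar :=
        (abs_add_le _ _).trans (add_le_add ((Finset.abs_sum_le_sum_abs _ _).trans
          (Finset.sum_le_sum hpiece)) hrabs)
    _ = δ / 2 * (μ.real A - ar) + ar := by rw [← Finset.mul_sum, hA']; ring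
    _ ≤ δ * μ.real A := by nlinarith

/-- An error proportional to μ(B) as well is obtained by equidistributing over r-cylinders at time n
+ q and entering B only r steps later. Within each r-cylinder the law is almost conditioned μ, and
the product bound supplies the factor μ(B). The resulting gap is q + r. -/
theorem exists_hasMixingGap (hG : IsGibbsMarkov T 𝒜 μ) (hM : IsMixingMap T μ) {δ : ℝ}
    (hδ : 0 < δ) : ∃ q : ℕ, HasMixingGap T 𝒜 μ q δ := by
  have hTm := hG.measurePreserving.measurable
  obtain ⟨C, hC1, hC⟩ := hG.exists_hasProductBound
  have hC0 : 0 < C := by linarith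
  obtain ⟨r, hr⟩ := hG.exists_abs_preimage_itinerary_sub_le (show 0 < δ / (4 * C) by positivity)
  obtain ⟨F, hF⟩ := exists_finset_itinerary_measure_lt hG.isPartition hG.countable
    hG.measurableSet hTm μ r (show 0 < δ / (4 * C ^ 2) by positivity)
  have hcyl : ∀ s, IsCylinderSet T 𝒜 r (itinerary hG.isPartition T r ⁻¹' s) :=
    IsCylinderSet.preimage_itinerary hG.isPartition
  set f := itinerary hG.isPartition T r
  have hfm : ∀ s, MeasurableSet (f ⁻¹' s) :=
    measurableSet_preimage_itinerary hG.isPartition hG.countable hG.measurableSet hTm r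
  -- The additive errors are summed over the cells in F, so each gets a share of the tolerance. The
  -- + 1 keeps the denominator positive when F is empty.
  have hstep := fun c => hG.eventually_abs_measure_inter_preimage_sub_le hM (hfm {c})
    (show 0 < δ / (4 * C * (F.card + 1)) by positivity)
  obtain ⟨q, hq⟩ := ((eventually_all_finset F).2 fun c _ => hstep c).exists
  refine ⟨q + r, fun n A B hA hB => ?_⟩
  have hA' : IsCylinderSet T 𝒜 (n + q) A := hA.mono (Nat.le_add_right n q)
  have hAm := hG.measurableSet_of_isCylinderSet hA
  have hEm : MeasurableSet (T^[r] ⁻¹' B) := hTm.iterate r hB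
  have hpre : T^[n + (q + r)] ⁻¹' B = T^[n + q] ⁻¹' (T^[r] ⁻¹' B) := by
    rw [← add_assoc, add_comm, Function.iterate_add, Set.preimage_comp]
  have hEB : μ.real (T^[r] ⁻¹' B) = μ.real B :=
    (hG.measurePreserving.iterate r).measureReal_preimage hB.nullMeasurableSet
  have hsplitA : ∀ E, MeasurableSet E → μ.real (A ∩ T^[n + q] ⁻¹' E) =
      ∑ c ∈ F, μ.real (A ∩ T^[n + q] ⁻¹' (f ⁻¹' {c} ∩ E))
        + μ.real (A ∩ T^[n + q] ⁻¹' (f ⁻¹' (F : Set (Fin r → 𝒜))ᶜ ∩ E)) := by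
    intro E hE
    rw [measureReal_eq_sum_preimage_add (f := f ∘ T^[n + q])
      (fun s => by rw [Set.preimage_comp]; exact hTm.iterate _ (hfm s)) F _
      (hAm.inter (hTm.iterate _ hE))]
    congr 1
    · refine Finset.sum_congr rfl fun c _ => congrArg _ ?_
      ext x; simp only [Set.mem_inter_iff, Set.mem_preimage, Function.comp]; tauto
    · congr 1
      ext x; simp only [Set.mem_inter_iff, Set.mem_preimage, Function.comp]; tauto
  have hsplitE : μ.real B = ∑ c ∈ F, μ.real (f ⁻¹' {c} ∩ T^[r] ⁻¹' B) +
      μ.real (f ⁻¹' (F : Set (Fin r → 𝒜))ᶜ ∩ T^[r] ⁻¹' B) := by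
    rw [← hEB, measureReal_eq_sum_preimage_add hfm F _ hEm]
    simp only [Set.inter_comm]
  have hA0 := measureReal_nonneg (μ := μ) (s := A)
  have hB0 := measureReal_nonneg (μ := μ) (s := B)
  have hcell : ∀ s, μ.real (f ⁻¹' s ∩ T^[r] ⁻¹' B) ≤ C * (μ.real (f ⁻¹' s) * μ.real B) :=
    fun s => by simpa using hC r _ B (hcyl s) hB
  have hasum : ∑ c ∈ F, μ.real (A ∩ T^[n + q] ⁻¹' (f ⁻¹' {c})) ≤ μ.real A := by
    have := hsplitA Set.univ MeasurableSet.univ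
    simp only [Set.preimage_univ, Set.inter_univ] at this
    linarith [measureReal_nonneg (μ := μ)
      (s := A ∩ T^[n + q] ⁻¹' (f ⁻¹' (F : Set (Fin r → 𝒜))ᶜ))]
  have hpiece : ∀ c ∈ F, |μ.real (A ∩ T^[n + q] ⁻¹' (f ⁻¹' {c} ∩ T^[r] ⁻¹' B)) -
      μ.real A * μ.real (f ⁻¹' {c} ∩ T^[r] ⁻¹' B)| ≤
        δ / 4 * (μ.real (A ∩ T^[n + q] ⁻¹' (f ⁻¹' {c})) * μ.real B) +
        δ / (4 * (F.card + 1)) * (μ.real A * μ.real B) := by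
    intro c hc
    have h1 := hr (n + q) A _ c hA' hEm
    have h2 := hq c hc n A hA
    have h3 := hcell {c}
    have hwz : μ.real (f ⁻¹' {c} ∩ T^[r] ⁻¹' B) ≤ μ.real (f ⁻¹' {c}) :=
      measureReal_mono Set.inter_subset_left
    set a := μ.real (A ∩ T^[n + q] ⁻¹' (f ⁻¹' {c}))
    set w := μ.real (f ⁻¹' {c} ∩ T^[r] ⁻¹' B)
    set z := μ.real (f ⁻¹' {c})
    have a0 : 0 ≤ a := measureReal_nonneg
    have w0 : 0 ≤ w := measureReal_nonneg
    have z0 : 0 ≤ z := measureReal_nonneg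
    have hρ : w / z ≤ C * μ.real B := div_le_of_le_mul₀ z0 (by positivity) (by linarith)
    have hρ0 : 0 ≤ w / z := by positivity
    have h4 : |a * (w / z) - μ.real A * w| ≤
        δ / (4 * C * (F.card + 1)) * μ.real A * (C * μ.real B) := by
      have : a * (w / z) - μ.real A * w = (a - μ.real A * z) * (w / z) := by
        have hw : z * (w / z) = w := by
          rcases z0.eq_or_lt with hz | hz
          · rw [le_antisymm (hwz.trans hz.symm.le) w0, zero_div, mul_zero]
          · rw [mul_div_assoc', mul_div_cancel_left₀ _ hz.ne']
        rw [sub_mul, mul_assoc (μ.real A), hw]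
      rw [this, abs_mul, abs_of_nonneg hρ0]
      exact mul_le_mul h2 hρ hρ0 (by positivity)
    calc _ ≤ δ / (4 * C) * (a * (w / z)) +
          δ / (4 * C * (F.card + 1)) * μ.real A * (C * μ.real B) :=
          (abs_sub_le _ _ _).trans (add_le_add h1 h4)
      _ ≤ δ / (4 * C) * (a * (C * μ.real B)) +
          δ / (4 * C * (F.card + 1)) * μ.real A * (C * μ.real B) := by gcongr
      _ = _ := by field_simp
  have hrestA := hC (n + q) A _ hA' ((hfm (F : Set (Fin r → 𝒜))ᶜ).inter hEm)
  rw [add_zero] at hrestA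
  have hrestw := hcell (F : Set (Fin r → 𝒜))ᶜ
  set w := μ.real (f ⁻¹' (F : Set (Fin r → 𝒜))ᶜ ∩ T^[r] ⁻¹' B)
  set p := μ.real (A ∩ T^[n + q] ⁻¹' (f ⁻¹' (F : Set (Fin r → 𝒜))ᶜ ∩ T^[r] ⁻¹' B))
  have w0 : 0 ≤ w := measureReal_nonneg
  have p0 : 0 ≤ p := measureReal_nonneg
  have hw : C * w ≤ δ / 4 * μ.real B := by
    calc C * w ≤ C * (C * (μ.real (f ⁻¹' (F : Set (Fin r → 𝒜))ᶜ) * μ.real B)) := by gcongr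
      _ ≤ C * (C * (δ / (4 * C ^ 2) * μ.real B)) := by gcongr
      _ = δ / 4 * μ.real B := by field_simp
  have hrest : |p - μ.real A * w| ≤ δ / 4 * (μ.real A * μ.real B) := by
    have k1 : μ.real A * w ≤ μ.real A * (C * w) :=
      mul_le_mul_of_nonneg_left (le_mul_of_one_le_left w0 hC1) hA0
    have k2 : μ.real A * (C * w) ≤ μ.real A * (δ / 4 * μ.real B) := by gcongr
    have k3 : 0 ≤ μ.real A * w := by positivity
    rw [abs_le]; constructor <;> linarith
  have hdiff : μ.real (A ∩ T^[n + (q + r)] ⁻¹' B) - μ.real A * μ.real B =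
      ∑ c ∈ F, (μ.real (A ∩ T^[n + q] ⁻¹' (f ⁻¹' {c} ∩ T^[r] ⁻¹' B)) -
        μ.real A * μ.real (f ⁻¹' {c} ∩ T^[r] ⁻¹' B)) + (p - μ.real A * w) := by
    rw [hpre, hsplitA _ hEm, hsplitE, Finset.sum_sub_distrib, ← Finset.mul_sum]
    ring
  have hcard : (F.card : ℝ) * (δ / (4 * (F.card + 1)) * (μ.real A * μ.real B)) ≤
      δ / 4 * (μ.real A * μ.real B) := by
    have : (F.card : ℝ) * (δ / (4 * (F.card + 1))) ≤ δ / 4 := by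
      rw [mul_div_assoc', div_le_div_iff₀ (by positivity) (by positivity)]
      nlinarith
    rw [← mul_assoc]
    gcongr
  rw [hdiff]
  calc _ ≤ ∑ c ∈ F, (δ / 4 * (μ.real (A ∩ T^[n + q] ⁻¹' (f ⁻¹' {c})) * μ.real B) +
        δ / (4 * (F.card + 1)) * (μ.real A * μ.real B)) + δ / 4 * (μ.real A * μ.real B) :=
        (abs_add_le _ _).trans (add_le_add ((Finset.abs_sum_le_sum_abs _ _).trans
          (Finset.sum_le_sum hpiece)) hrest)
    _ = δ / 4 * ((∑ c ∈ F, μ.real (A ∩ T^[n + q] ⁻¹' (f ⁻¹' {c}))) * μ.real B) +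
        (F.card : ℝ) * (δ / (4 * (F.card + 1)) * (μ.real A * μ.real B)) +
        δ / 4 * (μ.real A * μ.real B) := by
      rw [Finset.sum_add_distrib, Finset.sum_const, nsmul_eq_mul, ← Finset.mul_sum,
        ← Finset.sum_mul]
    _ ≤ δ / 4 * (μ.real A * μ.real B) + δ / 4 * (μ.real A * μ.real B) +
        δ / 4 * (μ.real A * μ.real B) := by gcongr
    _ ≤ δ * (μ.real A * μ.real B) := by
      have : 0 ≤ δ * (μ.real A * μ.real B) := by positivity
      linarith

end IsGibbsMarkov

/-! ### Return times and survivors -/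

/-- The time `R x + R (T x) + ⋯ + R (Tⁿ⁻¹ x)` of the `n`th return to the base of the tower. -/
def returnSum {X : Type*} (T : X → X) (R : X → ℕ+) (n : ℕ) (x : X) : ℕ :=
  ∑ i ∈ Finset.range n, (R (T^[i] x) : ℕ)

/-- The points `x` for which no `T^j x` with `j ≥ 1` and `returnSum (j + κ) x ≤ t` lies in `U`. For
`κ = 0` these are the points of the base of the tower that do not enter `U` up to time `t`. -/
def survivors {X : Type*} (T : X → X) (R : X → ℕ+) (U : Set X) (κ t : ℕ) : Set X :=
  {x | ∀ j, 1 ≤ j → returnSum T R (j + κ) x ≤ t → T^[j] x ∉ U}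

/-- The properties of a tower with mixing Gibbs-Markov base and exponential tail that are used for
the estimates of escape rates. -/
structure IsMixingTower {X : Type*} [MeasurableSpace X] (T : X → X) (𝒜 : Set (Set X))
    (R : X → ℕ+) (μ : Measure X) (C : ℝ) : Prop where
  measurableSet : ∀ (n : ℕ) (A : Set X), IsCylinderSet T 𝒜 n A → MeasurableSet A
  measurePreserving : MeasurePreserving T μ μ
  one_le : 1 ≤ C
  productBound : HasProductBound T 𝒜 μ 0 C
  mixingGap : ∀ δ : ℝ, 0 < δ → ∃ q, HasMixingGap T 𝒜 μ q δ
  returnTime_eq : ∀ x, ∀ y ∈ cylinder T 𝒜 1 x, R y = R x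
  moment : ∃ z : ℝ, 0 < z ∧ ∫⁻ x, ENNReal.ofReal (Real.exp (z * (R x : ℕ))) ∂μ < ⊤

section

variable {X : Type*} {T : X → X} {R : X → ℕ+} {U : Set X} {κ m n s t : ℕ} {x : X}

theorem returnSum_zero : returnSum T R 0 x = 0 := by simp [returnSum]

theorem returnSum_one : returnSum T R 1 x = R x := by simp [returnSum]

theorem returnSum_add (m n : ℕ) (x : X) :
    returnSum T R (m + n) x = returnSum T R m x + returnSum T R n (T^[m] x) := by
  rw [returnSum, Finset.sum_range_add]
  congr 1
  refine Finset.sum_congr rfl fun i _ => ?_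
  rw [← Function.iterate_add_apply, add_comm]

theorem le_returnSum (n : ℕ) (x : X) : n ≤ returnSum T R n x := by
  calc n = ∑ _i ∈ Finset.range n, 1 := by simp
    _ ≤ _ := Finset.sum_le_sum fun i _ => (R (T^[i] x)).pos

theorem returnSum_strictMono (x : X) : StrictMono fun n => returnSum T R n x :=
  strictMono_nat_of_lt_succ fun n => by
    rw [returnSum_add, returnSum_one]
    exact Nat.lt_add_of_pos_right (R (T^[n] x)).pos

theorem returnSum_mono (h : m ≤ n) (x : X) : returnSum T R m x ≤ returnSum T R n x :=
  (returnSum_strictMono x).monotone h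

theorem survivors_zero : survivors T R U κ 0 = Set.univ :=
  Set.eq_univ_of_forall fun x j hj h => absurd ((le_returnSum (j + κ) x).trans h) (by omega)

theorem survivors_antitone (h : s ≤ t) : survivors T R U κ t ⊆ survivors T R U κ s :=
  fun _ hx j hj hjs => hx j hj (hjs.trans h)

/-- A positive delay κ registers a visit only after κ further returns. When κ is the cylinder length
of U, the whole cylinder that decides the visit has then been traversed, as the renewal argument
needs. -/
theorem survivors_zero_subset : survivors T R U 0 t ⊆ survivors T R U κ t :=
  fun x hx j hj hjs => hx j hj ((returnSum_mono (by omega) x).trans hjs)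

/-- Restarts the clock after n returns. If they take longer than t, the truncated subtraction gives
0 and the claim is void. -/
theorem iterate_mem_survivors (hx : x ∈ survivors T R U κ t) (n : ℕ) :
    T^[n] x ∈ survivors T R U κ (t - returnSum T R n x) := by
  intro j hj h
  rw [← Function.iterate_add_apply]
  have hpos := le_returnSum (T := T) (R := R) (j + κ) (T^[n] x)
  refine hx (j + n) (by omega) ?_
  rw [show j + n + κ = n + (j + κ) by ring, returnSum_add]
  omega

end

namespace IsMixingTower

variable {X : Type*} [MeasurableSpace X] {T : X → X} {𝒜 : Set (Set X)} {R : X → ℕ+}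
  {μ : Measure X} {C : ℝ} {U : Set X} {κ : ℕ}

theorem measurable (hM : IsMixingTower T 𝒜 R μ C) : Measurable T :=
  hM.measurePreserving.measurable

theorem pos (hM : IsMixingTower T 𝒜 R μ C) : 0 < C := one_pos.trans_le hM.one_le

theorem returnSum_eq (hM : IsMixingTower T 𝒜 R μ C) {n m : ℕ} (hmn : m ≤ n) {x y : X}
    (h : y ∈ cylinder T 𝒜 n x) : returnSum T R m y = returnSum T R m x := by
  refine Finset.sum_congr rfl fun i hi => ?_
  have hin := Finset.mem_range.1 hi
  have := cylinder_anti (show i + 1 ≤ n by omega) x h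
  rw [hM.returnTime_eq _ _ (mem_cylinder_add_iff.1 this).2]

theorem isCylinderSet_returnSum (hM : IsMixingTower T 𝒜 R μ C) (n : ℕ) (P : ℕ → Prop) :
    IsCylinderSet T 𝒜 n {x | P (returnSum T R n x)} :=
  IsCylinderSet.setOf fun x y hy h => by rwa [hM.returnSum_eq le_rfl hy]

theorem measurable_returnSum (hM : IsMixingTower T 𝒜 R μ C) (n : ℕ) :
    Measurable (returnSum T R n) :=
  measurable_to_countable' fun v => hM.measurableSet n _ (hM.isCylinderSet_returnSum n (· = v))

theorem measurableSet_survivors (hM : IsMixingTower T 𝒜 R μ C) (hU : MeasurableSet U)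
    (κ t : ℕ) : MeasurableSet (survivors T R U κ t) := by
  have : survivors T R U κ t = ⋂ j : ℕ, ⋂ _ : 1 ≤ j,
      ({x | returnSum T R (j + κ) x ≤ t} ∩ T^[j] ⁻¹' U)ᶜ := by
    ext x
    simp [survivors]
  rw [this]
  refine MeasurableSet.iInter fun j => MeasurableSet.iInter fun _ => MeasurableSet.compl ?_
  exact (hM.measurableSet _ _ (hM.isCylinderSet_returnSum _ (· ≤ t))).inter
    (hM.measurable.iterate j hU)

theorem setLIntegral_returnSum (hM : IsMixingTower T 𝒜 R μ C) {L : ℕ} {A : Set X}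
    (hA : MeasurableSet A) (F : X → ENNReal) :
    ∫⁻ x in A, F x ∂μ = ∑' v, ∫⁻ x in A ∩ {x | returnSum T R L x = v}, F x ∂μ := by
  rw [← lintegral_iUnion]
  · congr 2
    ext x
    simp
  · exact fun v => hA.inter (hM.measurable_returnSum L (measurableSet_singleton v))
  · exact fun v w hvw => Set.disjoint_left.2 fun x hx hx' => hvw (hx.2.symm.trans hx'.2)

variable [IsProbabilityMeasure μ]

/-- The integrand may depend on the elapsed time because S_L is constant on L-cylinders: A is split
by the value of S_L, and the product bound applies to each piece. -/
theorem setLIntegral_comp_le (hM : IsMixingTower T 𝒜 R μ C) {q L : ℕ} {c : ℝ} (hc : 0 ≤ c)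
    (hq : HasProductBound T 𝒜 μ q c) {A : Set X} (hA : IsCylinderSet T 𝒜 L A)
    {h : ℕ → X → ENNReal} (hh : ∀ v, Measurable (h v)) :
    ∫⁻ x in A, h (returnSum T R L x) (T^[L + q] x) ∂μ
      ≤ ENNReal.ofReal c * ∫⁻ x in A, ∫⁻ y, h (returnSum T R L x) y ∂μ ∂μ := by
  have hAm := hM.measurableSet L A hA
  rw [hM.setLIntegral_returnSum (L := L) hAm, hM.setLIntegral_returnSum (L := L) hAm,
    ← ENNReal.tsum_mul_left]
  refine ENNReal.tsum_le_tsum fun v => ?_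
  have hAv : IsCylinderSet T 𝒜 L (A ∩ {x | returnSum T R L x = v}) :=
    hA.inter (hM.isCylinderSet_returnSum L (· = v))
  have hAvm := hM.measurableSet L _ hAv
  set Av := A ∩ {x | returnSum T R L x = v}
  have hle : (μ.restrict Av).map T^[L + q] ≤ (ENNReal.ofReal c * μ Av) • μ := by
    refine Measure.le_iff.2 fun B hB => ?_
    have hTm := hM.measurable.iterate (L + q)
    rw [Measure.map_apply hTm hB, Measure.restrict_apply (hTm hB), Measure.smul_apply,
      smul_eq_mul, Set.inter_comm, ← ofReal_measureReal, mul_assoc,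
      ← ofReal_measureReal (s := Av), ← ofReal_measureReal (s := B),
      ← ENNReal.ofReal_mul measureReal_nonneg, ← ENNReal.ofReal_mul hc]
    exact ENNReal.ofReal_le_ofReal (hq L Av B hAv hB)
  calc ∫⁻ x in Av, h (returnSum T R L x) (T^[L + q] x) ∂μ
      = ∫⁻ x in Av, h v (T^[L + q] x) ∂μ :=
        setLIntegral_congr_fun hAvm fun x hx => by rw [hx.2]
    _ = ∫⁻ y, h v y ∂((μ.restrict Av).map T^[L + q]) :=
        (lintegral_map (hh v) (hM.measurable.iterate _)).symm
    _ ≤ ∫⁻ y, h v y ∂((ENNReal.ofReal c * μ Av) • μ) := lintegral_mono' hle le_rfl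
    _ = ENNReal.ofReal c * ∫⁻ _ in Av, ∫⁻ y, h v y ∂μ ∂μ := by
        rw [lintegral_smul_measure, setLIntegral_const, smul_eq_mul]
        ring
    _ = _ := by
        congr 1
        exact setLIntegral_congr_fun hAvm fun x hx => by rw [hx.2]

theorem measure_setOf_le (hM : IsMixingTower T 𝒜 R μ C) {q L : ℕ} {c : ℝ} (hc : 0 ≤ c)
    (hq : HasProductBound T 𝒜 μ q c) {A : Set X} (hA : IsCylinderSet T 𝒜 L A)
    {B : ℕ → Set X} (hB : ∀ v, MeasurableSet (B v)) :
    μ {x | x ∈ A ∧ T^[L + q] x ∈ B (returnSum T R L x)}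
      ≤ ENNReal.ofReal c * ∫⁻ x in A, μ (B (returnSum T R L x)) ∂μ := by
  have hAm := hM.measurableSet L A hA
  have key := hM.setLIntegral_comp_le hc hq hA (h := fun v => (B v).indicator 1)
    (fun v => measurable_one.indicator (hB v))
  have h1 : ∀ v, ∫⁻ y, (B v).indicator 1 y ∂μ = μ (B v) := fun v => lintegral_indicator_one (hB v)
  simp only [h1] at key
  refine le_trans (le_of_eq ?_) key
  have hBm : MeasurableSet {x | T^[L + q] x ∈ B (returnSum T R L x)} := by
    have : {x | T^[L + q] x ∈ B (returnSum T R L x)} =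
        ⋃ v, {x | returnSum T R L x = v} ∩ T^[L + q] ⁻¹' B v := by
      ext x
      simp
    rw [this]
    exact MeasurableSet.iUnion fun v =>
      (hM.measurable_returnSum L (measurableSet_singleton v)).inter
        (hM.measurable.iterate _ (hB v))
  have h2 : ∀ x, (B (returnSum T R L x)).indicator (1 : X → ENNReal) (T^[L + q] x)
      = {x | T^[L + q] x ∈ B (returnSum T R L x)}.indicator 1 x := fun x => rfl
  simp only [h2]
  rw [lintegral_indicator_one hBm, Measure.restrict_apply hBm]
  congr 1
  ext x
  simp [and_comm]

end IsMixingTower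

/-! ### Exponential moments of return times -/

/-- The exponential moment `∫_A exp (η returnSum L) dμ`. -/
noncomputable def expMoment {X : Type*} [MeasurableSpace X] (T : X → X) (R : X → ℕ+)
    (μ : Measure X) (η : ℝ) (L : ℕ) (A : Set X) : ENNReal :=
  ∫⁻ x in A, ENNReal.ofReal (Real.exp (η * returnSum T R L x)) ∂μ

theorem rpow_le_one_add_mul {y r : ℝ} (hy : 0 ≤ y) (hr : 0 ≤ r) (hr1 : r ≤ 1) :
    y ^ r ≤ 1 + r * (y - 1) := by
  simpa using rpow_one_add_le_one_add_mul_self (s := y - 1) (by linarith) hr hr1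

section

variable {X : Type*} [MeasurableSpace X] {T : X → X} {R : X → ℕ+} {μ : Measure X} {η : ℝ}
  {A : Set X} {L : ℕ}

theorem measure_le_expMoment (hη : 0 ≤ η) (L : ℕ) (A : Set X) : μ A ≤ expMoment T R μ η L A := by
  rw [← setLIntegral_one]
  refine lintegral_mono fun x => ?_
  rw [ENNReal.one_le_ofReal, Real.one_le_exp_iff]
  positivity

theorem expMoment_mono {η' : ℝ} {L' : ℕ} {A' : Set X} (hη' : 0 ≤ η') (hη : η ≤ η') (hL : L ≤ L')
    (hA : A ⊆ A') : expMoment T R μ η L A ≤ expMoment T R μ η' L' A' := by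
  refine lintegral_mono' (Measure.restrict_mono hA le_rfl) fun x => ?_
  have : (returnSum T R L x : ℝ) ≤ returnSum T R L' x := by exact_mod_cast returnSum_mono hL x
  refine ENNReal.ofReal_le_ofReal (Real.exp_le_exp.2 ?_)
  gcongr

/-- With a = μ(A), r = ηL/z₀ and y = exp(z₀ S_L/L), one has exp(η S_L) = a^(-r) (ya)^r ≤ a^(-r) (1 +
r y a) by Bernoulli's inequality. Inserting a before linearizing makes the second term contribute
only a multiple of r a. The moment over A is thus close to μ(A) when r and r log a are small. -/
theorem expMoment_le_of_expMoment_univ_le [IsFiniteMeasure μ] {z₀ C₁ : ℝ} (hz₀ : 0 < z₀)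
    (h : ∀ z, 0 ≤ z → z ≤ z₀ → ∀ L : ℕ,
      expMoment T R μ z L Set.univ ≤ ENNReal.ofReal (Real.exp (C₁ * z * L)))
    (hApos : 0 < μ.real A) (hη : 0 ≤ η) (hL : 1 ≤ L)
    (hηL : η * L ≤ z₀) :
    expMoment T R μ η L A ≤ ENNReal.ofReal (μ.real A *
      (Real.exp (-(η * L / z₀ * Real.log (μ.real A))) *
        (1 + η * L / z₀ * Real.exp (C₁ * z₀)))) := by
  have hL0 : (0 : ℝ) < L := by exact_mod_cast hL
  have hL1 : (1 : ℝ) ≤ L := by exact_mod_cast hL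
  set r := η * L / z₀ with hr
  have hr0 : 0 ≤ r := by positivity
  have hr1 : r ≤ 1 := div_le_one_of_le₀ hηL hz₀.le
  set a := μ.real A
  have hpt : ∀ x, ENNReal.ofReal (Real.exp (η * returnSum T R L x)) ≤
      ENNReal.ofReal (Real.exp (-(r * Real.log a))) +
        ENNReal.ofReal (Real.exp (-(r * Real.log a)) * (r * a)) *
          ENNReal.ofReal (Real.exp (z₀ / L * returnSum T R L x)) := by
    intro x
    rw [← ENNReal.ofReal_mul (by positivity), ← ENNReal.ofReal_add (by positivity) (by positivity)]
    refine ENNReal.ofReal_le_ofReal ?_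
    set y := Real.exp (z₀ / L * returnSum T R L x) with hy
    have hy0 : 0 < y := Real.exp_pos _
    have h1 := rpow_le_one_add_mul (mul_pos hy0 hApos).le hr0 hr1
    have h2 : Real.exp (η * returnSum T R L x) =
        Real.exp (-(r * Real.log a)) * (y * a) ^ r := by
      rw [Real.mul_rpow hy0.le hApos.le, hy, ← Real.exp_mul, Real.rpow_def_of_pos hApos,
        ← Real.exp_add, ← Real.exp_add]
      congr 1
      rw [hr]
      field_simp
      ring
    rw [h2]
    calc _ ≤ Real.exp (-(r * Real.log a)) * (1 + r * (y * a - 1)) := by gcongr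
      _ ≤ Real.exp (-(r * Real.log a)) * (1 + r * (y * a)) := by
          gcongr; linarith
      _ = _ := by ring
  have hu := h (z₀ / L) (by positivity) (div_le_self hz₀.le hL1) L
  have hsub : ∫⁻ x in A, ENNReal.ofReal (Real.exp (z₀ / L * returnSum T R L x)) ∂μ ≤
      ENNReal.ofReal (Real.exp (C₁ * z₀)) := by
    refine (expMoment_mono (by positivity) le_rfl le_rfl (Set.subset_univ A)).trans
      (hu.trans (le_of_eq ?_))
    congr 2
    field_simp
  calc expMoment T R μ η L A ≤ ∫⁻ x in A, (ENNReal.ofReal (Real.exp (-(r * Real.log a))) +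
        ENNReal.ofReal (Real.exp (-(r * Real.log a)) * (r * a)) *
          ENNReal.ofReal (Real.exp (z₀ / L * returnSum T R L x))) ∂μ := lintegral_mono hpt
    _ = ENNReal.ofReal (Real.exp (-(r * Real.log a))) * μ A +
        ENNReal.ofReal (Real.exp (-(r * Real.log a)) * (r * a)) *
          ∫⁻ x in A, ENNReal.ofReal (Real.exp (z₀ / L * returnSum T R L x)) ∂μ := by
        rw [lintegral_add_left measurable_const, setLIntegral_const,
          lintegral_const_mul' _ _ ENNReal.ofReal_ne_top]
    _ ≤ ENNReal.ofReal (Real.exp (-(r * Real.log a))) * μ A +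
        ENNReal.ofReal (Real.exp (-(r * Real.log a)) * (r * a)) *
          ENNReal.ofReal (Real.exp (C₁ * z₀)) := by gcongr
    _ = _ := by
        rw [← ofReal_measureReal, ← ENNReal.ofReal_mul (by positivity),
          ← ENNReal.ofReal_mul (by positivity), ← ENNReal.ofReal_add (by positivity)
            (by positivity)]
        congr 1
        ring

end

namespace IsMixingTower

variable {X : Type*} [MeasurableSpace X] {T : X → X} {𝒜 : Set (Set X)} {R : X → ℕ+}
  {μ : Measure X} {C : ℝ}

theorem measurable_exp_returnSum (hM : IsMixingTower T 𝒜 R μ C) (η : ℝ) (L : ℕ) :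
    Measurable fun x => ENNReal.ofReal (Real.exp (η * returnSum T R L x)) :=
  (measurable_from_top (f := fun v : ℕ => ENNReal.ofReal (Real.exp (η * v)))).comp
    (hM.measurable_returnSum L)

variable [IsProbabilityMeasure μ]

/-- The exponent is linear in z, so the moment stays bounded for z of order 1/L. This is what the
restriction to small sets uses. -/
theorem exists_expMoment_univ_le (hM : IsMixingTower T 𝒜 R μ C) :
    ∃ z₀ C₁ : ℝ, 0 < z₀ ∧ 0 ≤ C₁ ∧ ∀ z, 0 ≤ z → z ≤ z₀ → ∀ L : ℕ,
      expMoment T R μ z L Set.univ ≤ ENNReal.ofReal (Real.exp (C₁ * z * L)) := by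
  obtain ⟨z₀, hz₀, hmom⟩ := hM.moment
  have hC := hM.pos
  set m := (∫⁻ x, ENNReal.ofReal (Real.exp (z₀ * (R x : ℕ))) ∂μ).toReal with hm
  have hm0 : 0 ≤ m := ENNReal.toReal_nonneg
  refine ⟨z₀, C * m / z₀, hz₀, by positivity, fun z hz hzz L => ?_⟩
  have hRm : ∀ z : ℝ, Measurable fun x => ENNReal.ofReal (Real.exp (z * (R x : ℕ)) - 1) := by
    intro z
    have h1 := (measurable_from_top (f := fun v : ℕ => ENNReal.ofReal (Real.exp (z * v) - 1))).comp
      (hM.measurable_returnSum 1)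
    convert h1 using 2 with x
    simp [returnSum_one]
  -- By Bernoulli's inequality exp(zR) - 1 ≤ (z/z₀)(exp(z₀R) - 1).
  have hH : ∫⁻ x, ENNReal.ofReal (Real.exp (z * (R x : ℕ)) - 1) ∂μ
      ≤ ENNReal.ofReal (z / z₀ * m) := by
    rw [ENNReal.ofReal_mul (by positivity), hm, ENNReal.ofReal_toReal hmom.ne,
      ← lintegral_const_mul' _ _ ENNReal.ofReal_ne_top]
    refine lintegral_mono fun x => ?_
    rw [← ENNReal.ofReal_mul (by positivity)]
    refine ENNReal.ofReal_le_ofReal ?_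
    have hr : z / z₀ ≤ 1 := div_le_one_of_le₀ hzz hz₀.le
    have h1 := rpow_le_one_add_mul (Real.exp_pos (z₀ * (R x : ℕ))).le
      (show 0 ≤ z / z₀ by positivity) hr
    have h2 : Real.exp (z * (R x : ℕ)) = Real.exp (z₀ * (R x : ℕ)) ^ (z / z₀) := by
      rw [← Real.exp_mul]; congr 1; field_simp
    have h3 : 0 ≤ z / z₀ := by positivity
    rw [h2]
    linarith
  induction L with
  | zero => simp [expMoment, returnSum_zero]
  | succ L ih =>
    -- The product bound is applied only to the small increment exp(zR) - 1. Applied to the whole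
    -- exponential it would cost a factor C at every return.
    have hstep : expMoment T R μ z (L + 1) Set.univ = expMoment T R μ z L Set.univ +
        ∫⁻ x in Set.univ, ENNReal.ofReal (Real.exp (z * returnSum T R L x)) *
          ENNReal.ofReal (Real.exp (z * (R (T^[L + 0] x) : ℕ)) - 1) ∂μ := by
      rw [expMoment, expMoment, ← lintegral_add_left (hM.measurable_exp_returnSum z L)]
      refine lintegral_congr fun x => ?_
      have h1 : 1 ≤ Real.exp (z * (R (T^[L + 0] x) : ℕ)) := by
        rw [Real.one_le_exp_iff]; positivity
      rw [← ENNReal.ofReal_mul (Real.exp_pos _).le, ← ENNReal.ofReal_add (Real.exp_pos _).le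
        (mul_nonneg (Real.exp_pos _).le (by linarith)), returnSum_add, returnSum_one, add_zero]
      congr 1
      push_cast
      rw [mul_add, Real.exp_add]
      ring
    have hle := hM.setLIntegral_comp_le hM.pos.le hM.productBound
      (IsCylinderSet.univ (T := T) (𝒜 := 𝒜) (n := L))
      (h := fun v y => ENNReal.ofReal (Real.exp (z * v)) *
        ENNReal.ofReal (Real.exp (z * (R y : ℕ)) - 1))
      (fun v => (hRm z).const_mul _)
    have hconst : ∀ v : ℕ, ∫⁻ y, ENNReal.ofReal (Real.exp (z * v)) *
        ENNReal.ofReal (Real.exp (z * (R y : ℕ)) - 1) ∂μ = ENNReal.ofReal (Real.exp (z * v)) *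
          ∫⁻ y, ENNReal.ofReal (Real.exp (z * (R y : ℕ)) - 1) ∂μ :=
      fun v => lintegral_const_mul _ (hRm z)
    simp only [hconst] at hle
    rw [lintegral_mul_const _ (hM.measurable_exp_returnSum z L)] at hle
    change _ ≤ _ * (expMoment T R μ z L Set.univ * _) at hle
    rw [hstep]
    calc _ ≤ expMoment T R μ z L Set.univ + ENNReal.ofReal C *
          (expMoment T R μ z L Set.univ * ENNReal.ofReal (z / z₀ * m)) := by
          refine add_le_add le_rfl (hle.trans ?_)
          gcongr
      _ = expMoment T R μ z L Set.univ * ENNReal.ofReal (1 + C * (z / z₀ * m)) := by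
          rw [ENNReal.ofReal_add zero_le_one (by positivity), ENNReal.ofReal_mul hC.le,
            ENNReal.ofReal_one]
          ring
      _ ≤ ENNReal.ofReal (Real.exp (C * m / z₀ * z * L)) *
          ENNReal.ofReal (Real.exp (C * m / z₀ * z)) := by
          refine mul_le_mul' ih (ENNReal.ofReal_le_ofReal ?_)
          have := Real.add_one_le_exp (C * m / z₀ * z)
          calc 1 + C * (z / z₀ * m) = C * m / z₀ * z + 1 := by ring
            _ ≤ _ := this
      _ = _ := by
          rw [← ENNReal.ofReal_mul (Real.exp_pos _).le, ← Real.exp_add]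
          congr 2
          push_cast
          ring

/-- For η ≤ z₀/2, on {S_q > m} one has exp(η S_q) ≤ exp(-z₀m/2) exp(z₀ S_q). Both η₀ and m are
chosen before η. -/
theorem exists_expMoment_tail_le (hM : IsMixingTower T 𝒜 R μ C) (q : ℕ) {δ : ℝ} (hδ : 0 < δ) :
    ∃ (η₀ : ℝ) (m : ℕ), 0 < η₀ ∧ ∀ η ≤ η₀,
      expMoment T R μ η q {x | m < returnSum T R q x} ≤ ENNReal.ofReal δ := by
  obtain ⟨z₀, C₁, hz₀, hC₁, h⟩ := hM.exists_expMoment_univ_le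
  set D := Real.exp (C₁ * z₀ * q) with hD
  have hD0 : 0 < D := Real.exp_pos _
  have hlim : Tendsto (fun m : ℕ => Real.exp (-(z₀ / 2 * m)) * D) atTop (𝓝 0) := by
    have h1 : Tendsto (fun m : ℕ => z₀ / 2 * (m : ℝ)) atTop atTop :=
      tendsto_natCast_atTop_atTop.const_mul_atTop (by positivity)
    simpa using (Real.tendsto_exp_neg_atTop_nhds_zero.comp h1).mul_const D
  obtain ⟨m, hm⟩ := (hlim.eventually (gt_mem_nhds hδ)).exists
  refine ⟨z₀ / 2, m, by positivity, fun η hη => ?_⟩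
  calc expMoment T R μ η q {x | m < returnSum T R q x}
      ≤ ∫⁻ x in {x | m < returnSum T R q x}, ENNReal.ofReal (Real.exp (-(z₀ / 2 * m))) *
          ENNReal.ofReal (Real.exp (z₀ * returnSum T R q x)) ∂μ := by
        refine setLIntegral_mono' (hM.measurable_returnSum q measurableSet_Ioi) fun x hx => ?_
        rw [← ENNReal.ofReal_mul (Real.exp_pos _).le, ← Real.exp_add]
        refine ENNReal.ofReal_le_ofReal (Real.exp_le_exp.2 ?_)
        have h1 : (m : ℝ) ≤ returnSum T R q x := by exact_mod_cast (le_of_lt hx)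
        have h2 : (0 : ℝ) ≤ returnSum T R q x := by positivity
        nlinarith
    _ ≤ ENNReal.ofReal (Real.exp (-(z₀ / 2 * m))) * ENNReal.ofReal D := by
        rw [lintegral_const_mul' _ _ ENNReal.ofReal_ne_top]
        gcongr
        exact (expMoment_mono hz₀.le le_rfl le_rfl (Set.subset_univ _)).trans (h z₀ hz₀.le le_rfl q)
    _ ≤ ENNReal.ofReal δ := by
        rw [← ENNReal.ofReal_mul (Real.exp_pos _).le]
        exact ENNReal.ofReal_le_ofReal hm.le

end IsMixingTower

/-! ### Growth of the measures of the survivor sets -/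

section

variable {X : Type*} [MeasurableSpace X] {T : X → X} {𝒜 : Set (Set X)} {μ : Measure X}

theorem HasProductBound.measure_le [IsFiniteMeasure μ] {q n : ℕ} {c : ℝ}
    (h : HasProductBound T 𝒜 μ q c) (hc : 0 ≤ c) {A B : Set X} (hA : IsCylinderSet T 𝒜 n A)
    (hB : MeasurableSet B) :
    μ (A ∩ T^[n + q] ⁻¹' B) ≤ ENNReal.ofReal c * (μ A * μ B) := by
  rw [← ofReal_measureReal, ← ofReal_measureReal (s := A), ← ofReal_measureReal (s := B),
    ← ENNReal.ofReal_mul measureReal_nonneg, ← ENNReal.ofReal_mul hc]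
  exact ENNReal.ofReal_le_ofReal (h n A B hA hB)

theorem HasMixingGap.hasProductBound {q : ℕ} {δ : ℝ} (h : HasMixingGap T 𝒜 μ q δ) :
    HasProductBound T 𝒜 μ q (1 + δ) := fun n A B hA hB => by
  linarith [(abs_le.1 (h n A B hA hB)).2]

theorem HasMixingGap.le_measureReal {q : ℕ} {δ : ℝ} (h : HasMixingGap T 𝒜 μ q δ) {n : ℕ}
    {A B : Set X} (hA : IsCylinderSet T 𝒜 n A) (hB : MeasurableSet B) :
    (1 - δ) * (μ.real A * μ.real B) ≤ μ.real (A ∩ T^[n + q] ⁻¹' B) := by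
  linarith [(abs_le.1 (h n A B hA hB)).1]

/-- A finite sum of measures is bounded by the integral of a function that dominates the sum of
the indicator functions. -/
theorem sum_mul_measureReal_le [IsFiniteMeasure μ] {ι : Type*} {s : Finset ι} {c : ι → ℝ}
    (hc : ∀ i, 0 ≤ c i) {P : ι → Set X} (hP : ∀ i, MeasurableSet (P i)) {A : Set X} {m : ℝ}
    (hm : 0 ≤ m) {φ : X → ENNReal}
    (hφ : ∀ x, ∑ i ∈ s, (P i).indicator (fun _ => ENNReal.ofReal (c i)) x ≤ φ x)
    (hint : ∫⁻ x in A, φ x ∂μ ≤ ENNReal.ofReal m) :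
    ∑ i ∈ s, c i * μ.real (A ∩ P i) ≤ m := by
  rw [← ENNReal.ofReal_le_ofReal_iff hm,
    ENNReal.ofReal_sum_of_nonneg fun i _ => mul_nonneg (hc i) measureReal_nonneg]
  refine le_trans (le_of_eq ?_) ((lintegral_mono hφ).trans hint)
  rw [lintegral_finsetSum _ fun i _ => measurable_const.indicator (hP i)]
  refine Finset.sum_congr rfl fun i _ => ?_
  rw [lintegral_indicator_const (hP i), Measure.restrict_apply (hP i), ENNReal.ofReal_mul (hc i),
    ofReal_measureReal, Set.inter_comm]

end

/-- The points that return to the base at time `u` after `N` returns and have not visited `U` at the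
returns `1, …, N - κ`. -/
def renewalSet {X : Type*} (T : X → X) (R : X → ℕ+) (U : Set X) (κ N u : ℕ) : Set X :=
  {x | returnSum T R N x = u} ∩ {x | ∀ j, (1 ≤ j ∧ j + κ ≤ N) → T^[j] x ∉ U}

theorem renewalSet_subset_survivors {X : Type*} {T : X → X} {R : X → ℕ+} {U : Set X}
    {κ N u : ℕ} : renewalSet T R U κ N u ⊆ survivors T R U κ u :=
  fun x hx j hj h => hx.2 j ⟨hj, (returnSum_strictMono x).le_iff_le.1 (h.trans hx.1.ge)⟩

namespace IsMixingTower

variable {X : Type*} [MeasurableSpace X] {T : X → X} {𝒜 : Set (Set X)} {R : X → ℕ+}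
  {μ : Measure X} {C : ℝ} {U : Set X} {κ : ℕ}

theorem isCylinderSet_renewalSet (hM : IsMixingTower T 𝒜 R μ C) (hU : IsCylinderSet T 𝒜 κ U)
    (N u : ℕ) : IsCylinderSet T 𝒜 N (renewalSet T R U κ N u) :=
  (hM.isCylinderSet_returnSum N (· = u)).inter (hU.forall_notMem _ N fun _ h => h.2)

theorem measurableSet_returnSum (hM : IsMixingTower T 𝒜 R μ C) (n : ℕ) (P : ℕ → Prop) :
    MeasurableSet {x | P (returnSum T R n x)} :=
  hM.measurableSet n _ (hM.isCylinderSet_returnSum n P)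

variable [IsProbabilityMeasure μ]

/-- The number N of returns made up to a given time depends on the point, so the product bound is
needed simultaneously for disjoint events of different cylinder lengths N + a. -/
theorem measureReal_iUnion_le (hM : IsMixingTower T 𝒜 R μ C) {q a : ℕ} {c : ℝ} (hc : 0 ≤ c)
    (hq : HasProductBound T 𝒜 μ q c) {A : ℕ → Set X} (hA : ∀ N, IsCylinderSet T 𝒜 (N + a) (A N))
    (hd : Pairwise (Function.onFun Disjoint A)) {F : Set X} (hF : MeasurableSet F) :
    μ.real (⋃ N, A N ∩ T^[N + a + q] ⁻¹' F) ≤ c * (μ.real (⋃ N, A N) * μ.real F) := by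
  have h1 : μ (⋃ N, A N ∩ T^[N + a + q] ⁻¹' F) ≤
      ENNReal.ofReal c * (μ (⋃ N, A N) * μ F) := by
    refine (measure_iUnion_le _).trans ?_
    rw [measure_iUnion hd fun N => hM.measurableSet _ _ (hA N), ← ENNReal.tsum_mul_right,
      ← ENNReal.tsum_mul_left]
    exact ENNReal.tsum_le_tsum fun N => hq.measure_le hc (hA N) hF
  have h2 := ENNReal.toReal_mono (by finiteness) h1
  rwa [ENNReal.toReal_mul, ENNReal.toReal_mul, ENNReal.toReal_ofReal hc] at h2

theorem le_measureReal_iUnion (hM : IsMixingTower T 𝒜 R μ C) {q a : ℕ} {δ : ℝ} (hδ : δ ≤ 1)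
    (hq : HasMixingGap T 𝒜 μ q δ) {A : ℕ → Set X} (hA : ∀ N, IsCylinderSet T 𝒜 (N + a) (A N))
    (hd : Pairwise (Function.onFun Disjoint A)) {F : Set X} (hF : MeasurableSet F) :
    (1 - δ) * (μ.real (⋃ N, A N) * μ.real F) ≤ μ.real (⋃ N, A N ∩ T^[N + a + q] ⁻¹' F) := by
  have hδ' : 0 ≤ 1 - δ := by linarith
  have h1 : ENNReal.ofReal (1 - δ) * (μ (⋃ N, A N) * μ F) ≤
      μ (⋃ N, A N ∩ T^[N + a + q] ⁻¹' F) := by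
    rw [measure_iUnion hd fun N => hM.measurableSet _ _ (hA N),
      measure_iUnion (fun i j hij => (hd hij).mono Set.inter_subset_left Set.inter_subset_left)
        fun N => (hM.measurableSet _ _ (hA N)).inter (hM.measurable.iterate _ hF),
      ← ENNReal.tsum_mul_right, ← ENNReal.tsum_mul_left]
    refine ENNReal.tsum_le_tsum fun N => ?_
    rw [← ofReal_measureReal, ← ofReal_measureReal (s := F), ← ofReal_measureReal (s := _ ∩ _),
      ← ENNReal.ofReal_mul measureReal_nonneg, ← ENNReal.ofReal_mul hδ']
    exact ENNReal.ofReal_le_ofReal (hq.le_measureReal (hA N) hF)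
  have h2 := ENNReal.toReal_mono (by finiteness) h1
  rwa [ENNReal.toReal_mul, ENNReal.toReal_mul, ENNReal.toReal_ofReal hδ'] at h2

/-- A renewal event after N returns is a union of N-cylinders, so the future beyond it is decoupled
without a gap. Return times increase strictly, so the events for different N are disjoint. -/
theorem measureReal_renewal_le (hM : IsMixingTower T 𝒜 R μ C) (hU : IsCylinderSet T 𝒜 κ U)
    (u : ℕ) {F : Set X} (hF : MeasurableSet F) :
    μ.real (⋃ N, renewalSet T R U κ N u ∩ T^[N] ⁻¹' F) ≤
      C * (μ.real (survivors T R U κ u) * μ.real F) := by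
  have h := hM.measureReal_iUnion_le hM.pos.le hM.productBound (a := 0)
    (hM.isCylinderSet_renewalSet hU · u) (fun i j hij => Set.disjoint_left.2 fun x hx hx' =>
      hij ((returnSum_strictMono x).injective (Eq.trans hx.1 (Eq.symm hx'.1)))) hF
  simp only [add_zero] at h
  refine h.trans (mul_le_mul_of_nonneg_left (mul_le_mul_of_nonneg_right ?_ measureReal_nonneg)
    hM.pos.le)
  exact measureReal_mono (Set.iUnion_subset fun N => renewalSet_subset_survivors)

/-- A point lost at time t + 1 has a visit to U at some return j with S_(j+κ) = t + 1. If the κ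
returns after the visit last v + 1, the visit occurs at time t - v, at a renewal. -/
theorem measureReal_survivors_sub_succ_le (hM : IsMixingTower T 𝒜 R μ C)
    (hU : IsCylinderSet T 𝒜 κ U) (hκ : 1 ≤ κ) (t : ℕ) :
    μ.real (survivors T R U κ t) - μ.real (survivors T R U κ (t + 1)) ≤
      ∑ v ∈ Finset.range (t + 1), C * (μ.real (survivors T R U κ (t - v)) *
        μ.real (U ∩ {x | returnSum T R κ x = v + 1})) := by
  have hUm := hM.measurableSet _ _ hU
  rw [← measureReal_sdiff (survivors_antitone (Nat.le_succ t))
    (hM.measurableSet_survivors hUm κ (t + 1))]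
  have hsub : survivors T R U κ t \ survivors T R U κ (t + 1) ⊆
      ⋃ v ∈ Finset.range (t + 1), ⋃ N, renewalSet T R U κ N (t - v) ∩
        T^[N] ⁻¹' (U ∩ {x | returnSum T R κ x = v + 1}) := by
    rintro x ⟨hx, hx'⟩
    simp only [survivors, Set.mem_ofPred_eq, not_forall, not_not] at hx'
    obtain ⟨j, hj, hjt, hjU⟩ := hx'
    have heq : returnSum T R (j + κ) x = t + 1 := by
      by_contra hne
      exact hx j hj (by omega) hjU
    rw [returnSum_add] at heq
    have hpos := le_returnSum (T := T) (R := R) κ (T^[j] x)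
    simp only [Set.mem_iUnion, Finset.mem_range]
    -- Since κ ≥ 1, the time of κ returns is at least 1 and nothing is truncated.
    refine ⟨returnSum T R κ (T^[j] x) - 1, by omega, j, ⟨?_, ?_⟩, hjU, ?_⟩
    · change returnSum T R j x = _
      omega
    · exact fun i hi => hx i hi.1 ((returnSum_mono hi.2 x).trans (by omega))
    · change returnSum T R κ (T^[j] x) = _
      omega
  refine (measureReal_mono hsub (measure_ne_top _ _)).trans ((measureReal_biUnion_finset_le _ _).trans
    (Finset.sum_le_sum fun v _ => ?_))
  exact hM.measureReal_renewal_le hU _ (hUm.inter (hM.measurableSet_returnSum κ (· = v + 1)))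

/-- The two survivor sets differ by points with a visit up to time t whose κ-cylinder is not
completed by then. With the visit at time t - v, this means that S_κ > v from there on. -/
theorem measureReal_survivors_sub_survivors_zero_le (hM : IsMixingTower T 𝒜 R μ C)
    (hU : IsCylinderSet T 𝒜 κ U) (t : ℕ) :
    μ.real (survivors T R U κ t) - μ.real (survivors T R U 0 t) ≤
      ∑ v ∈ Finset.range (t + 1), C * (μ.real (survivors T R U κ (t - v)) *
        μ.real (U ∩ {x | v < returnSum T R κ x})) := by
  have hUm := hM.measurableSet _ _ hU
  rw [← measureReal_sdiff survivors_zero_subset (hM.measurableSet_survivors hUm 0 t)]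
  have hsub : survivors T R U κ t \ survivors T R U 0 t ⊆
      ⋃ v ∈ Finset.range (t + 1), ⋃ N, renewalSet T R U κ N (t - v) ∩
        T^[N] ⁻¹' (U ∩ {x | v < returnSum T R κ x}) := by
    rintro x ⟨hx, hx'⟩
    simp only [survivors, Set.mem_ofPred_eq, not_forall, not_not, add_zero] at hx'
    obtain ⟨j, hj, hjt, hjU⟩ := hx'
    have hlt : t < returnSum T R (j + κ) x := by
      by_contra hne
      exact hx j hj (by omega) hjU
    rw [returnSum_add] at hlt
    simp only [Set.mem_iUnion, Finset.mem_range]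
    refine ⟨t - returnSum T R j x, by omega, j, ⟨?_, ?_⟩, hjU, ?_⟩
    · change returnSum T R j x = _
      omega
    · exact fun i hi => hx i hi.1 ((returnSum_mono hi.2 x).trans (by omega))
    · change _ < returnSum T R κ (T^[j] x)
      omega
  refine (measureReal_mono hsub (measure_ne_top _ _)).trans ((measureReal_biUnion_finset_le _ _).trans
    (Finset.sum_le_sum fun v _ => ?_))
  exact hM.measureReal_renewal_le hU _ (hUm.inter (hM.measurableSet_returnSum κ (v < ·)))

/-- Strong induction on t: slow decay at earlier times bounds b(t-v) by exp(ηv) b(t) in the renewal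
inequality. The loss is then at most C m b(t) ≤ (1 - exp(-η)) b(t), which is slow decay at time t.
-/
theorem measureReal_survivors_le_exp_mul_succ (hM : IsMixingTower T 𝒜 R μ C)
    (hU : IsCylinderSet T 𝒜 κ U) (hκ : 1 ≤ κ) {η m : ℝ} (hη : 0 ≤ η) (hm0 : 0 ≤ m)
    (hm : expMoment T R μ η κ U ≤ ENNReal.ofReal m) (hmη : C * m ≤ 1 - Real.exp (-η)) (t : ℕ) :
    μ.real (survivors T R U κ t) ≤ Real.exp η * μ.real (survivors T R U κ (t + 1)) := by
  induction t using Nat.strong_induction_on with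
  | _ t ih =>
  set b := fun s => μ.real (survivors T R U κ s) with hb
  change b t ≤ Real.exp η * b (t + 1)
  have hgrow : ∀ v ≤ t, b (t - v) ≤ Real.exp (η * v) * b t := by
    intro v
    induction v with
    | zero => simp
    | succ v ihv =>
      intro hv
      have h1 := ih (t - (v + 1)) (by omega)
      rw [show t - (v + 1) + 1 = t - v by omega] at h1
      have h2 := ihv (by omega)
      calc b (t - (v + 1)) ≤ Real.exp η * b (t - v) := h1
        _ ≤ Real.exp η * (Real.exp (η * v) * b t) := by gcongr
        _ = Real.exp (η * (v + 1 : ℕ)) * b t := by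
          rw [← mul_assoc, ← Real.exp_add]; push_cast; ring_nf
  have hbt : 0 ≤ b t := measureReal_nonneg
  -- At most one v satisfies S_κ = v + 1, and exp(ηv) ≤ exp(η S_κ) for it, so the sum is dominated
  -- by the exponential moment over U.
  have hsum : ∑ v ∈ Finset.range (t + 1), Real.exp (η * v) *
      μ.real (U ∩ {x | returnSum T R κ x = v + 1}) ≤ m := by
    refine sum_mul_measureReal_le (fun _ => (Real.exp_pos _).le)
      (fun v => hM.measurableSet_returnSum κ (· = v + 1)) hm0 (fun x => ?_) hm
    by_cases hv : ∃ v, returnSum T R κ x = v + 1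
    · obtain ⟨v, hv⟩ := hv
      refine (Finset.sum_le_sum (g := fun w => if w = v then
        ENNReal.ofReal (Real.exp (η * returnSum T R κ x)) else 0) fun w _ => ?_).trans ?_
      · by_cases hw : returnSum T R κ x = w + 1
        · rw [Set.indicator_of_mem (s := {x | returnSum T R κ x = w + 1}) hw, if_pos (by omega)]
          refine ENNReal.ofReal_le_ofReal (Real.exp_le_exp.2 ?_)
          rw [hw]
          gcongr
          simp
        · rw [Set.indicator_of_notMem (s := {x | returnSum T R κ x = w + 1}) hw]
          exact zero_le
      · rw [Finset.sum_ite_eq']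
        split_ifs <;> simp
    · rw [Finset.sum_eq_zero fun v _ => Set.indicator_of_notMem
        (s := {x | returnSum T R κ x = v + 1}) (fun h => hv ⟨v, h⟩) _]
      exact zero_le
  have hdiff := hM.measureReal_survivors_sub_succ_le hU hκ t
  have hle : ∑ v ∈ Finset.range (t + 1), C * (b (t - v) *
      μ.real (U ∩ {x | returnSum T R κ x = v + 1})) ≤ C * m * b t := by
    calc _ ≤ ∑ v ∈ Finset.range (t + 1), C * b t * (Real.exp (η * v) *
          μ.real (U ∩ {x | returnSum T R κ x = v + 1})) := by
          refine Finset.sum_le_sum fun v hv => ?_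
          have := hgrow v (by have := Finset.mem_range.1 hv; omega)
          have hC := hM.pos
          calc _ ≤ C * (Real.exp (η * v) * b t *
                μ.real (U ∩ {x | returnSum T R κ x = v + 1})) := by gcongr
            _ = _ := by ring
      _ = C * b t * ∑ v ∈ Finset.range (t + 1), (Real.exp (η * v) *
          μ.real (U ∩ {x | returnSum T R κ x = v + 1})) := by rw [Finset.mul_sum]
      _ ≤ C * b t * m := mul_le_mul_of_nonneg_left hsum (mul_nonneg hM.pos.le hbt)
      _ = _ := by ring
  have h1 : Real.exp (-η) * b t ≤ b (t + 1) := by nlinarith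
  calc b t = Real.exp η * (Real.exp (-η) * b t) := by
        rw [← mul_assoc, ← Real.exp_add, add_neg_cancel, Real.exp_zero, one_mul]
    _ ≤ _ := by gcongr

theorem measureReal_survivors_sub_le (hM : IsMixingTower T 𝒜 R μ C)
    (hU : IsCylinderSet T 𝒜 κ U) (hκ : 1 ≤ κ) {η m : ℝ} (hη : 0 ≤ η) (hm0 : 0 ≤ m)
    (hm : expMoment T R μ η κ U ≤ ENNReal.ofReal m) (hmη : C * m ≤ 1 - Real.exp (-η)) (t u : ℕ) :
    μ.real (survivors T R U κ (t - u)) ≤ Real.exp (η * u) * μ.real (survivors T R U κ t) := by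
  induction u with
  | zero => simp
  | succ u ih =>
    have h0 := measureReal_nonneg (μ := μ) (s := survivors T R U κ t)
    rcases Nat.lt_or_ge u t with hu | hu
    · have h1 := hM.measureReal_survivors_le_exp_mul_succ hU hκ hη hm0 hm hmη (t - (u + 1))
      rw [show t - (u + 1) + 1 = t - u by omega] at h1
      calc _ ≤ Real.exp η * (Real.exp (η * u) * μ.real (survivors T R U κ t)) :=
            h1.trans (by gcongr)
        _ = _ := by rw [← mul_assoc, ← Real.exp_add]; push_cast; ring_nf
    -- For u ≥ t the truncated difference stays 0, and only the factor on the right increases.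
    · rw [show t - (u + 1) = t - u by omega]
      refine ih.trans (mul_le_mul_of_nonneg_right (Real.exp_le_exp.2 ?_) h0)
      push_cast
      nlinarith

end IsMixingTower

/-- The measures of the survivor sets decay at most at the exponential rate `η`. -/
def HasSlowDecay {X : Type*} [MeasurableSpace X] (T : X → X) (R : X → ℕ+) (μ : Measure X)
    (U : Set X) (κ : ℕ) (η : ℝ) : Prop :=
  ∀ t u : ℕ, μ.real (survivors T R U κ (t - u)) ≤
    Real.exp (η * u) * μ.real (survivors T R U κ t)

theorem HasSlowDecay.measure_le {X : Type*} [MeasurableSpace X] {T : X → X} {R : X → ℕ+}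
    {μ : Measure X} [IsFiniteMeasure μ] {U : Set X} {κ : ℕ} {η : ℝ}
    (h : HasSlowDecay T R μ U κ η) (t u : ℕ) :
    μ (survivors T R U κ (t - u)) ≤
      ENNReal.ofReal (Real.exp (η * u)) * μ (survivors T R U κ t) := by
  rw [← ofReal_measureReal, ← ofReal_measureReal (s := survivors T R U κ t),
    ← ENNReal.ofReal_mul (Real.exp_pos _).le]
  exact ENNReal.ofReal_le_ofReal (h t u)

theorem HasSlowDecay.exp_neg_le {X : Type*} [MeasurableSpace X] {T : X → X} {R : X → ℕ+}
    {μ : Measure X} [IsProbabilityMeasure μ] {U : Set X} {κ : ℕ} {η : ℝ}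
    (h : HasSlowDecay T R μ U κ η) (t : ℕ) :
    Real.exp (-(η * t)) ≤ μ.real (survivors T R U κ t) := by
  have h1 := h t t
  rw [Nat.sub_self, survivors_zero, probReal_univ] at h1
  rw [Real.exp_neg, inv_le_iff_one_le_mul₀ (Real.exp_pos _), mul_comm]
  exact h1

namespace IsMixingTower

variable {X : Type*} [MeasurableSpace X] {T : X → X} {𝒜 : Set (Set X)} {R : X → ℕ+}
  {μ : Measure X} {C : ℝ} {U : Set X} {κ : ℕ} [IsProbabilityMeasure μ] {η m : ℝ}

/-- Slow decay bounds the sum by weights exp(ηv) over v < S_κ, at most S_κ exp(η S_κ) ≤ η⁻¹ exp(2η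
S_κ). This explains both the moment at 2η and the bound m/η, which is small at the chosen scale. -/
theorem measureReal_survivors_sub_survivors_zero_le_mul (hM : IsMixingTower T 𝒜 R μ C)
    (hU : IsCylinderSet T 𝒜 κ U) (hη : 0 < η) (hm0 : 0 ≤ m)
    (hm : expMoment T R μ (2 * η) κ U ≤ ENNReal.ofReal m)
    (hG : HasSlowDecay T R μ U κ η) (t : ℕ) :
    μ.real (survivors T R U κ t) - μ.real (survivors T R U 0 t) ≤
      C * (m / η) * μ.real (survivors T R U κ t) := by
  refine (hM.measureReal_survivors_sub_survivors_zero_le hU t).trans ?_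
  have hC := hM.pos
  have hsum : ∑ v ∈ Finset.range (t + 1), Real.exp (η * v) *
      μ.real (U ∩ {x | v < returnSum T R κ x}) ≤ m / η := by
    refine sum_mul_measureReal_le (fun _ => (Real.exp_pos _).le)
      (fun v => hM.measurableSet_returnSum κ (v < ·)) (by positivity)
      (φ := fun x => ENNReal.ofReal η⁻¹ *
        ENNReal.ofReal (Real.exp (2 * η * returnSum T R κ x))) (fun x => ?_) ?_
    · set S := returnSum T R κ x with hS
      have h1 : ∀ v ∈ Finset.range (t + 1), {x | v < returnSum T R κ x}.indicator
          (fun _ => ENNReal.ofReal (Real.exp (η * v))) x ≤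
          if v < S then ENNReal.ofReal (Real.exp (η * S)) else 0 := by
        intro v _
        by_cases hv : v < S
        · rw [Set.indicator_of_mem (s := {x | v < returnSum T R κ x}) hv, if_pos hv]
          refine ENNReal.ofReal_le_ofReal (Real.exp_le_exp.2 ?_)
          gcongr
        · rw [Set.indicator_of_notMem (s := {x | v < returnSum T R κ x}) hv]
          exact zero_le
      refine (Finset.sum_le_sum h1).trans ?_
      rw [← Finset.sum_filter, Finset.sum_const, nsmul_eq_mul]
      have hcard : ((Finset.range (t + 1)).filter (· < S)).card ≤ S := by
        calc _ ≤ (Finset.range S).card := Finset.card_le_card fun v hv => by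
              rw [Finset.mem_range]; exact (Finset.mem_filter.1 hv).2
          _ = S := Finset.card_range S
      calc _ ≤ (S : ENNReal) * ENNReal.ofReal (Real.exp (η * S)) := by gcongr
        _ = ENNReal.ofReal (S * Real.exp (η * S)) := by
            rw [ENNReal.ofReal_mul (by positivity), ENNReal.ofReal_natCast]
        _ ≤ ENNReal.ofReal (η⁻¹ * Real.exp (2 * η * S)) := by
            refine ENNReal.ofReal_le_ofReal ?_
            have h2 : (S : ℝ) ≤ η⁻¹ * Real.exp (η * S) := by
              rw [← div_eq_inv_mul, le_div_iff₀ hη]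
              linarith [Real.add_one_le_exp (η * S)]
            calc (S : ℝ) * Real.exp (η * S) ≤ η⁻¹ * Real.exp (η * S) * Real.exp (η * S) := by
                  gcongr
              _ = _ := by rw [mul_assoc, ← Real.exp_add]; ring_nf
        _ = _ := by rw [ENNReal.ofReal_mul (by positivity)]
    · rw [lintegral_const_mul' _ _ ENNReal.ofReal_ne_top, div_eq_inv_mul,
        ENNReal.ofReal_mul (by positivity)]
      gcongr
      exact hm
  calc _ ≤ ∑ v ∈ Finset.range (t + 1), C * μ.real (survivors T R U κ t) * (Real.exp (η * v) *
        μ.real (U ∩ {x | v < returnSum T R κ x})) := by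
        refine Finset.sum_le_sum fun v _ => ?_
        calc _ ≤ C * (Real.exp (η * v) * μ.real (survivors T R U κ t) *
              μ.real (U ∩ {x | v < returnSum T R κ x})) := by gcongr; exact hG t v
          _ = _ := by ring
    _ = C * μ.real (survivors T R U κ t) * ∑ v ∈ Finset.range (t + 1), (Real.exp (η * v) *
        μ.real (U ∩ {x | v < returnSum T R κ x})) := by rw [Finset.mul_sum]
    _ ≤ C * μ.real (survivors T R U κ t) * (m / η) := by gcongr
    _ = _ := by ring

theorem setLIntegral_measure_survivors_le (hM : IsMixingTower T 𝒜 R μ C)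
    (hG : HasSlowDecay T R μ U κ η) (L s : ℕ) (A : Set X) :
    ∫⁻ x in A, μ (survivors T R U κ (s - returnSum T R L x)) ∂μ ≤
      expMoment T R μ η L A * μ (survivors T R U κ s) := by
  rw [expMoment, ← lintegral_mul_const _ (hM.measurable_exp_returnSum η L)]
  exact lintegral_mono fun x => hG.measure_le s _

/-- For j ≥ κ this is the product bound. For j < κ the event U is still being decided at time j, so
the clock is restarted after κ returns, and slow decay charges exp(η S_κ) for the time lost. -/
theorem measure_inter_preimage_survivors_le (hM : IsMixingTower T 𝒜 R μ C)
    (hU : IsCylinderSet T 𝒜 κ U) (hη : 0 ≤ η) (hG : HasSlowDecay T R μ U κ η) (j s : ℕ) :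
    μ (U ∩ T^[j] ⁻¹' survivors T R U κ s) ≤
      ENNReal.ofReal C * (expMoment T R μ η κ U * μ (survivors T R U κ s)) := by
  have hEm := fun s => hM.measurableSet_survivors (hM.measurableSet _ _ hU) κ s
  rcases le_or_gt κ j with hj | hj
  · have h1 := hM.productBound.measure_le hM.pos.le (hU.mono hj) (hEm s)
    rw [add_zero] at h1
    refine h1.trans ?_
    gcongr
    exact measure_le_expMoment hη κ U
  · have hsub : U ∩ T^[j] ⁻¹' survivors T R U κ s ⊆
        {x | x ∈ U ∧ T^[κ + 0] x ∈ survivors T R U κ (s - returnSum T R κ x)} := by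
      rintro x ⟨hxU, hx⟩
      refine ⟨hxU, ?_⟩
      have h1 := iterate_mem_survivors hx (κ - j)
      have h2 : j + (κ - j) = κ := by omega
      rw [← Function.iterate_add_apply, Nat.sub_add_cancel hj.le] at h1
      refine survivors_antitone ?_ h1
      nth_rewrite 1 [← h2]
      rw [returnSum_add]
      omega
    refine (measure_mono hsub).trans ((hM.measure_setOf_le hM.pos.le hM.productBound hU
      (B := fun v => survivors T R U κ (s - v)) fun v => hEm _).trans ?_)
    gcongr
    exact hM.setLIntegral_measure_survivors_le hG κ s U

theorem measureReal_inter_preimage_survivors_le (hM : IsMixingTower T 𝒜 R μ C)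
    (hU : IsCylinderSet T 𝒜 κ U) (hη : 0 ≤ η) (hG : HasSlowDecay T R μ U κ η) (hm0 : 0 ≤ m)
    (hm : expMoment T R μ η κ U ≤ ENNReal.ofReal m) (j s : ℕ) :
    μ.real (U ∩ T^[j] ⁻¹' survivors T R U 0 s) ≤ C * (m * μ.real (survivors T R U κ s)) := by
  have h1 : μ (U ∩ T^[j] ⁻¹' survivors T R U 0 s) ≤
      ENNReal.ofReal C * (ENNReal.ofReal m * μ (survivors T R U κ s)) := by
    refine (measure_mono (Set.inter_subset_inter_right U
      (Set.preimage_mono survivors_zero_subset))).trans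
      ((hM.measure_inter_preimage_survivors_le hU hη hG j s).trans ?_)
    gcongr
  have h2 := ENNReal.toReal_mono (by finiteness) h1
  rwa [ENNReal.toReal_mul, ENNReal.toReal_mul, ENNReal.toReal_ofReal hM.pos.le,
    ENNReal.toReal_ofReal hm0] at h2

/-- The probability of surviving up to time `t`, starting from a union of `L`-cylinders. -/
theorem measure_inter_survivors_le (hM : IsMixingTower T 𝒜 R μ C)
    (hU : MeasurableSet U) (hG : HasSlowDecay T R μ U κ η) {q k : ℕ} {c δ ε : ℝ}
    (hc : 0 ≤ c) (hδ : 0 ≤ δ)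
    (hq : HasProductBound T 𝒜 μ q c)
    (htail : expMoment T R μ η q {x | k < returnSum T R q x} ≤ ENNReal.ofReal δ)
    (hε : c * Real.exp (η * k) + C ^ 2 * δ ≤ 1 + ε) {L : ℕ} {A : Set X}
    (hA : IsCylinderSet T 𝒜 L A) (t : ℕ) :
    μ (A ∩ survivors T R U 0 t) ≤
      ENNReal.ofReal (1 + ε) * (expMoment T R μ η L A * μ (survivors T R U κ t)) := by
  have hEm := fun s => hM.measurableSet_survivors hU κ s
  have hC := hM.pos
  -- Points from which the q returns of the gap take longer than k, followed by survival for what is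
  -- left of t - v.
  set B : ℕ → Set X := fun v => {y | y ∈ {y | k < returnSum T R q y} ∧
    T^[q + 0] y ∈ survivors T R U κ (t - v - returnSum T R q y)} with hB
  have hBm : ∀ v, MeasurableSet (B v) := by
    intro v
    have : B v = ⋃ w, ({y | k < returnSum T R q y} ∩ {y | returnSum T R q y = w}) ∩
        T^[q + 0] ⁻¹' survivors T R U κ (t - v - w) := by
      ext y
      simp [hB]
    rw [this]
    exact MeasurableSet.iUnion fun w => ((hM.measurableSet_returnSum q (k < ·)).inter
      (hM.measurableSet_returnSum q (· = w))).inter (hM.measurable.iterate _ (hEm _))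
  -- If the gap takes time at most k, the constant c of the gap q applies, and the lost time costs
  -- exp(ηk). If it takes longer, the product bound with constant C is used twice, before and after
  -- the gap, and the tail moment contributes C²δ.
  have hsub : A ∩ survivors T R U 0 t ⊆
      {x | x ∈ A ∧ T^[L + q] x ∈ survivors T R U κ (t - k - returnSum T R L x)} ∪
        {x | x ∈ A ∧ T^[L + 0] x ∈ B (returnSum T R L x)} := by
    rintro x ⟨hxA, hx⟩
    have h1 := iterate_mem_survivors (survivors_zero_subset (κ := κ) hx) L
    have h2 := iterate_mem_survivors h1 q
    rcases le_or_gt (returnSum T R q (T^[L] x)) k with h | h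
    · refine Or.inl ⟨hxA, ?_⟩
      rw [add_comm, Function.iterate_add_apply]
      exact survivors_antitone (by omega) h2
    · exact Or.inr ⟨hxA, h, h2⟩
  have hfirst : μ {x | x ∈ A ∧ T^[L + q] x ∈ survivors T R U κ (t - k - returnSum T R L x)} ≤
      ENNReal.ofReal (c * Real.exp (η * k)) *
        (expMoment T R μ η L A * μ (survivors T R U κ t)) := by
    refine (hM.measure_setOf_le hc hq hA (B := fun v => survivors T R U κ (t - k - v))
      fun v => hEm _).trans ?_
    rw [ENNReal.ofReal_mul hc, mul_assoc]
    gcongr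
    refine (hM.setLIntegral_measure_survivors_le hG L (t - k) A).trans ?_
    calc _ ≤ expMoment T R μ η L A *
          (ENNReal.ofReal (Real.exp (η * k)) * μ (survivors T R U κ t)) := by
          gcongr; exact hG.measure_le t k
      _ = _ := by ring
  have hBle : ∀ v, μ (B v) ≤ ENNReal.ofReal (C * δ) * μ (survivors T R U κ (t - v)) := by
    intro v
    refine (hM.measure_setOf_le hM.pos.le hM.productBound
      (hM.isCylinderSet_returnSum q (k < ·))
      (B := fun w => survivors T R U κ (t - v - w)) fun w => hEm _).trans ?_
    rw [ENNReal.ofReal_mul hM.pos.le, mul_assoc]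
    gcongr
    refine (hM.setLIntegral_measure_survivors_le hG q (t - v) _).trans ?_
    gcongr
  have hsecond : μ {x | x ∈ A ∧ T^[L + 0] x ∈ B (returnSum T R L x)} ≤
      ENNReal.ofReal (C ^ 2 * δ) * (expMoment T R μ η L A * μ (survivors T R U κ t)) := by
    refine (hM.measure_setOf_le hM.pos.le hM.productBound hA hBm).trans ?_
    calc _ ≤ ENNReal.ofReal C * ∫⁻ x in A, ENNReal.ofReal (C * δ) *
          μ (survivors T R U κ (t - returnSum T R L x)) ∂μ := by
          gcongr with x
          exact hBle _
      _ = ENNReal.ofReal C * (ENNReal.ofReal (C * δ) *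
          ∫⁻ x in A, μ (survivors T R U κ (t - returnSum T R L x)) ∂μ) := by
          rw [lintegral_const_mul' _ _ ENNReal.ofReal_ne_top]
      _ ≤ ENNReal.ofReal C * (ENNReal.ofReal (C * δ) *
          (expMoment T R μ η L A * μ (survivors T R U κ t))) := by
          gcongr
          exact hM.setLIntegral_measure_survivors_le hG L t A
      _ = _ := by
          rw [← mul_assoc, ← ENNReal.ofReal_mul hM.pos.le]
          congr 2
          ring
  calc μ (A ∩ survivors T R U 0 t) ≤ _ := (measure_mono hsub).trans (measure_union_le _ _)
    _ ≤ _ := add_le_add hfirst hsecond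
    _ = ENNReal.ofReal (c * Real.exp (η * k) + C ^ 2 * δ) *
        (expMoment T R μ η L A * μ (survivors T R U κ t)) := by
        rw [ENNReal.ofReal_add (by positivity) (by positivity), add_mul]
    _ ≤ _ := by gcongr

end IsMixingTower

/-! ### Near-supermultiplicativity, and survival from cylinder sets and from the hole -/

namespace IsMixingTower

variable {X : Type*} [MeasurableSpace X] {T : X → X} {𝒜 : Set (Set X)} {R : X → ℕ+}
  {μ : Measure X} {C : ℝ} {U : Set X} {κ : ℕ} [IsProbabilityMeasure μ] {η m : ℝ}

/-- Surviving up to t, then waiting κ + q returns beyond the last return before t, then surviving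
for s more forces survival up to t + s unless U is visited during the wait. Each of the κ + q
possible visits costs a factor m, so the loss is relatively small when (κ + q) m is. -/
theorem mul_measureReal_survivors_le_add (hM : IsMixingTower T 𝒜 R μ C)
    (hU : IsCylinderSet T 𝒜 κ U) (hκ : 1 ≤ κ) (hη : 0 ≤ η) (hG : HasSlowDecay T R μ U κ η)
    (hm0 : 0 ≤ m) (hm : expMoment T R μ η κ U ≤ ENNReal.ofReal m) {q : ℕ} {δ : ℝ} (hδ : δ ≤ 1)
    (hq : HasMixingGap T 𝒜 μ q δ) (t s : ℕ) :
    (1 - δ) * (μ.real (survivors T R U 0 t) * μ.real (survivors T R U 0 s)) ≤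
      μ.real (survivors T R U 0 (t + s)) + (κ + q : ℕ) * (C * (C * m) *
        (μ.real (survivors T R U κ t) * μ.real (survivors T R U κ s))) := by
  have hUm := hM.measurableSet _ _ hU
  have hC := hM.pos
  have hEs := hM.measurableSet_survivors hUm 0 s
  -- The event that N is the number of returns made up to time t.
  set G : ℕ → Set X := fun N => {x | returnSum T R N x ≤ t} ∩ {x | t < returnSum T R (N + 1) x}
  have hGcyl : ∀ N, IsCylinderSet T 𝒜 (N + 1) (G N) := fun N =>
    ((hM.isCylinderSet_returnSum N (· ≤ t)).mono (Nat.le_succ N)).inter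
      (hM.isCylinderSet_returnSum (N + 1) (t < ·))
  have hGd : ∀ x N N', x ∈ G N → x ∈ G N' → N = N' := by
    have key : ∀ x N N', x ∈ G N → x ∈ G N' → N ≤ N' := fun x N N' h h' => by
      by_contra hlt
      have h1 : returnSum T R N x ≤ t := h.1
      have h2 : t < returnSum T R (N' + 1) x := h'.2
      have h3 := returnSum_mono (T := T) (R := R) (show N' + 1 ≤ N by omega) x
      omega
    exact fun x N N' h h' => le_antisymm (key x N N' h h') (key x N' N h' h)
  -- Excluding visits up to the return N needs N + κ symbols, too many for decoupling a visit right
  -- after N. The larger set A' N excludes only visits that N + 1 symbols decide, and it still lies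
  -- in the delayed survivor set.
  set A : ℕ → Set X := fun N => {x | ∀ j, (1 ≤ j ∧ j ≤ N) → T^[j] x ∉ U} ∩ G N
  set A' : ℕ → Set X := fun N => {x | ∀ j, (1 ≤ j ∧ j + κ ≤ N + 1) → T^[j] x ∉ U} ∩ G N
  have hAcyl : ∀ N, IsCylinderSet T 𝒜 (N + κ) (A N) := fun N =>
    (hU.forall_notMem _ _ fun j hj => by omega).inter ((hGcyl N).mono (by omega))
  have hA'cyl : ∀ N, IsCylinderSet T 𝒜 (N + 1) (A' N) := fun N =>
    (hU.forall_notMem _ _ fun j hj => hj.2).inter (hGcyl N)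
  have hAd : Pairwise (Function.onFun Disjoint A) := fun i j hij =>
    Set.disjoint_left.2 fun x hx hx' => hij (hGd x i j hx.2 hx'.2)
  have hA'd : Pairwise (Function.onFun Disjoint A') := fun i j hij =>
    Set.disjoint_left.2 fun x hx hx' => hij (hGd x i j hx.2 hx'.2)
  have hAU : survivors T R U 0 t ⊆ ⋃ N, A N := by
    intro x hx
    have hex : ∃ N, t < returnSum T R (N + 1) x := ⟨t, le_returnSum (t + 1) x⟩
    classical
    refine Set.mem_iUnion.2 ⟨Nat.find hex, ?_, ?_, Nat.find_spec hex⟩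
    · intro j hj
      refine hx j hj.1 ?_
      have h1 := Nat.find_min hex (m := j - 1) (by omega)
      rw [Nat.sub_add_cancel hj.1] at h1
      exact not_lt.1 h1
    · change returnSum T R _ x ≤ t
      rcases Nat.eq_zero_or_pos (Nat.find hex) with h0 | h0
      · rw [h0, returnSum_zero]; exact Nat.zero_le t
      · have h1 := Nat.find_min hex (m := Nat.find hex - 1) (by omega)
        rw [Nat.sub_add_cancel h0] at h1
        exact not_lt.1 h1
  have hA'U : ⋃ N, A' N ⊆ survivors T R U κ t := by
    refine Set.iUnion_subset fun N x hx j hj hjt => hx.1 j ⟨hj, ?_⟩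
    by_contra hlt
    have h1 : t < returnSum T R (N + 1) x := hx.2.2
    have h2 := returnSum_mono (T := T) (R := R) (show N + 1 ≤ j + κ by omega) x
    omega
  -- The index i encodes a visit at return j = N + 1 + i, after which κ + q - 1 - i returns of the
  -- waiting period remain.
  set F : ℕ → Set X := fun i =>
    T^[i] ⁻¹' (U ∩ T^[κ + q - 1 - i] ⁻¹' survivors T R U 0 s)
  have hF0 : ∀ i, MeasurableSet (U ∩ T^[κ + q - 1 - i] ⁻¹' survivors T R U 0 s) := fun i =>
    hUm.inter (hM.measurable.iterate _ hEs)
  have hFm : ∀ i, MeasurableSet (F i) := fun i => hM.measurable.iterate i (hF0 i)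
  have hFle : ∀ i, μ.real (F i) ≤ C * (m * μ.real (survivors T R U κ s)) := by
    intro i
    rw [(hM.measurePreserving.iterate i).measureReal_preimage (hF0 i).nullMeasurableSet]
    exact hM.measureReal_inter_preimage_survivors_le hU hη hG hm0 hm _ s
  have hsub : ⋃ N, A N ∩ T^[N + κ + q] ⁻¹' survivors T R U 0 s ⊆
      survivors T R U 0 (t + s) ∪
        ⋃ i ∈ Finset.range (κ + q), ⋃ N, A' N ∩ T^[N + 1 + 0] ⁻¹' F i := by
    refine Set.iUnion_subset fun N x hx => ?_
    obtain ⟨hxA, hxs⟩ := hx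
    by_cases hxts : x ∈ survivors T R U 0 (t + s)
    · exact Or.inl hxts
    right
    simp only [survivors, Set.mem_ofPred_eq, not_forall, not_not, add_zero] at hxts
    obtain ⟨j, hj, hjt, hjU⟩ := hxts
    have hjN : N < j := by
      by_contra hlt
      exact hxA.1 j ⟨hj, by omega⟩ hjU
    have hjL : j ≤ N + κ + q := by
      by_contra hlt
      refine hxs (j - (N + κ + q)) (by omega) ?_ ?_
      · have h1 : returnSum T R (N + κ + q + (j - (N + κ + q))) x ≤ t + s := by
          rwa [show N + κ + q + (j - (N + κ + q)) = j by omega]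
        rw [returnSum_add] at h1
        have h2 : t < returnSum T R (N + 1) x := hxA.2.2
        have h3 := returnSum_mono (T := T) (R := R) (show N + 1 ≤ N + κ + q by omega) x
        rw [add_zero]
        omega
      · rw [← Function.iterate_add_apply, Nat.sub_add_cancel (by omega)]
        exact hjU
    simp only [Set.mem_iUnion, Finset.mem_range]
    refine ⟨j - N - 1, by omega, N, ⟨fun i hi => hxA.1 i ⟨hi.1, by omega⟩, hxA.2⟩, ?_⟩
    change T^[j - N - 1] (T^[N + 1 + 0] x) ∈
      U ∩ T^[κ + q - 1 - (j - N - 1)] ⁻¹' survivors T R U 0 s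
    rw [← Function.iterate_add_apply, show j - N - 1 + (N + 1 + 0) = j by omega]
    refine ⟨hjU, ?_⟩
    change T^[κ + q - 1 - (j - N - 1)] (T^[j] x) ∈ survivors T R U 0 s
    rw [← Function.iterate_add_apply, show κ + q - 1 - (j - N - 1) + j = N + κ + q by omega]
    exact hxs
  calc _ ≤ (1 - δ) * (μ.real (⋃ N, A N) * μ.real (survivors T R U 0 s)) := by
        have : 0 ≤ 1 - δ := by linarith
        have h2 := measureReal_mono (μ := μ) hAU
        gcongr
    _ ≤ μ.real (⋃ N, A N ∩ T^[N + κ + q] ⁻¹' survivors T R U 0 s) :=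
        hM.le_measureReal_iUnion hδ hq hAcyl hAd hEs
    _ ≤ μ.real (survivors T R U 0 (t + s)) + ∑ i ∈ Finset.range (κ + q),
        μ.real (⋃ N, A' N ∩ T^[N + 1 + 0] ⁻¹' F i) :=
        (measureReal_mono hsub (measure_ne_top _ _)).trans ((measureReal_union_le _ _).trans
          (add_le_add le_rfl (measureReal_biUnion_finset_le _ _)))
    _ ≤ μ.real (survivors T R U 0 (t + s)) + ∑ _i ∈ Finset.range (κ + q),
        C * (C * m) * (μ.real (survivors T R U κ t) * μ.real (survivors T R U κ s)) := by
        refine add_le_add le_rfl (Finset.sum_le_sum fun i _ => ?_)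
        refine (hM.measureReal_iUnion_le hM.pos.le hM.productBound hA'cyl hA'd (hFm i)).trans ?_
        calc _ ≤ C * (μ.real (survivors T R U κ t) *
              (C * (m * μ.real (survivors T R U κ s)))) := by
              have h2 := measureReal_mono (μ := μ) hA'U
              have h3 := hFle i
              gcongr
          _ = _ := by ring
    _ = _ := by rw [Finset.sum_const, Finset.card_range, nsmul_eq_mul]

/-- The probability of surviving up to time `s`, starting from a union of `L`-cylinders `A` whose
points do not visit `U` at the times `1, …, a`. -/
theorem le_measureReal_inter_survivors (hM : IsMixingTower T 𝒜 R μ C)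
    (hU : IsCylinderSet T 𝒜 κ U) (hη : 0 ≤ η) (hG : HasSlowDecay T R μ U κ η)
    (hm0 : 0 ≤ m) (hm : expMoment T R μ η κ U ≤ ENNReal.ofReal m) {q : ℕ} {δ : ℝ}
    (hq : HasMixingGap T 𝒜 μ q δ) {L a : ℕ} {A : Set X} (hA : IsCylinderSet T 𝒜 L A)
    (hAa : ∀ x ∈ A, ∀ j, 1 ≤ j → j ≤ a → T^[j] x ∉ U) {W : ℕ → Set X}
    (hW : ∀ i ∈ Finset.Ioc a (L + q), IsCylinderSet T 𝒜 i (W i) ∧ A ⊆ W i) (s : ℕ) :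
    (1 - δ) * (μ.real A * μ.real (survivors T R U 0 s)) ≤
      μ.real (A ∩ survivors T R U 0 s) +
        C * (C * m) * μ.real (survivors T R U κ s) * ∑ i ∈ Finset.Ioc a (L + q), μ.real (W i) := by
  have hUm := hM.measurableSet _ _ hU
  have hC := hM.pos
  have hEs := hM.measurableSet_survivors hUm 0 s
  -- A point that survives for s after time L + q, but not from the start, visits U at some i in (a,
  -- L + q]. For i < L the set A need not be a union of i-cylinders, so it is enlarged to W i before
  -- decoupling.
  have hsub : A ∩ T^[L + q] ⁻¹' survivors T R U 0 s ⊆ A ∩ survivors T R U 0 s ∪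
      ⋃ i ∈ Finset.Ioc a (L + q),
        W i ∩ T^[i + 0] ⁻¹' (U ∩ T^[L + q - i] ⁻¹' survivors T R U 0 s) := by
    rintro x ⟨hxA, hxs⟩
    by_cases hx : x ∈ survivors T R U 0 s
    · exact Or.inl ⟨hxA, hx⟩
    right
    simp only [survivors, Set.mem_ofPred_eq, not_forall, not_not, add_zero] at hx
    obtain ⟨j, hj, hjs, hjU⟩ := hx
    have hja : a < j := by
      by_contra hlt
      exact hAa x hxA j hj (by omega) hjU
    have hjL : j ≤ L + q := by
      by_contra hlt
      refine hxs (j - (L + q)) (by omega) ?_ ?_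
      · have h1 : returnSum T R (L + q + (j - (L + q))) x ≤ s := by
          rwa [show L + q + (j - (L + q)) = j by omega]
        rw [returnSum_add] at h1
        rw [add_zero]
        omega
      · rw [← Function.iterate_add_apply, Nat.sub_add_cancel (by omega)]
        exact hjU
    have hmem : j ∈ Finset.Ioc a (L + q) := Finset.mem_Ioc.2 ⟨hja, hjL⟩
    simp only [Set.mem_iUnion]
    refine ⟨j, hmem, (hW j hmem).2 hxA, hjU, ?_⟩
    change T^[L + q - j] (T^[j] x) ∈ survivors T R U 0 s
    rw [← Function.iterate_add_apply, Nat.sub_add_cancel hjL]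
    exact hxs
  calc _ ≤ μ.real (A ∩ T^[L + q] ⁻¹' survivors T R U 0 s) := hq.le_measureReal hA hEs
    _ ≤ μ.real (A ∩ survivors T R U 0 s) + ∑ i ∈ Finset.Ioc a (L + q),
        μ.real (W i ∩ T^[i + 0] ⁻¹' (U ∩ T^[L + q - i] ⁻¹' survivors T R U 0 s)) :=
        (measureReal_mono hsub (measure_ne_top _ _)).trans ((measureReal_union_le _ _).trans
          (add_le_add le_rfl (measureReal_biUnion_finset_le _ _)))
    _ ≤ μ.real (A ∩ survivors T R U 0 s) + ∑ i ∈ Finset.Ioc a (L + q),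
        C * (C * m) * μ.real (survivors T R U κ s) * μ.real (W i) := by
        refine add_le_add le_rfl (Finset.sum_le_sum fun i hi => ?_)
        refine (hM.productBound i _ _ (hW i hi).1
          (hUm.inter (hM.measurable.iterate _ hEs))).trans ?_
        calc _ ≤ C * (μ.real (W i) * (C * (m * μ.real (survivors T R U κ s)))) := by
              have h3 := hM.measureReal_inter_preimage_survivors_le hU hη hG hm0 hm (L + q - i) s
              gcongr
          _ = _ := by ring
    _ = _ := by rw [Finset.mul_sum]

/-- Either the first K returns are over by time t, and then none of them lies in U and the set A of
such points is a union of (K+κ)-cylinders. Or S_K > t, which is rarer than survival up to t. -/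
theorem measureReal_hole_inter_survivors_le (hM : IsMixingTower T 𝒜 R μ C)
    (hU : IsCylinderSet T 𝒜 κ U) (hη : 0 ≤ η) (hG : HasSlowDecay T R μ U κ η) {q k K : ℕ}
    {c δ ε : ℝ} (hc : 0 ≤ c) (hδ : 0 ≤ δ) (hq : HasProductBound T 𝒜 μ q c)
    (htail : expMoment T R μ η q {x | k < returnSum T R q x} ≤ ENNReal.ofReal δ)
    (hε : c * Real.exp (η * k) + C ^ 2 * δ ≤ 1 + ε) (hε0 : 0 ≤ ε) (hm0 : 0 ≤ m)
    (hm : expMoment T R μ (2 * η) (K + κ) U ≤ ENNReal.ofReal m) (t : ℕ) :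
    μ.real (U ∩ survivors T R U 0 t) ≤ μ.real (survivors T R U κ t) *
      ((1 + ε) * (μ.real (U ∩ {x | ∀ j, (1 ≤ j ∧ j ≤ K) → T^[j] x ∉ U}) + (m - μ.real U)) +
        Real.exp (-(η * t)) * m) := by
  have hUm := hM.measurableSet _ _ hU
  have hAcyl := hU.inter_forall_notMem K
  have hAm := hM.measurableSet _ _ hAcyl
  set A := U ∩ {x | ∀ j, (1 ≤ j ∧ j ≤ K) → T^[j] x ∉ U} with hA
  have hmU : μ.real U ≤ m := by
    have := (measure_le_expMoment (μ := μ) (T := T) (R := R) (by positivity : 0 ≤ 2 * η)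
      (K + κ) U).trans hm
    exact ENNReal.toReal_le_of_le_ofReal hm0 this
  have hAU : μ.real A ≤ μ.real U := measureReal_mono Set.inter_subset_left
  -- The integrand is at least 1 on U \ A, so removing this part lowers the moment by at least μ(U)
  -- - μ(A). The excess over μ(A) is therefore no larger than the excess m - μ(U) for the whole
  -- hole.
  have hmom : expMoment T R μ η (K + κ) A ≤ ENNReal.ofReal (μ.real A + (m - μ.real U)) := by
    have h1 : expMoment T R μ η (K + κ) A + μ (U \ A) ≤ ENNReal.ofReal m := by
      calc _ ≤ expMoment T R μ η (K + κ) A + expMoment T R μ η (K + κ) (U \ A) := by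
            gcongr; exact measure_le_expMoment hη _ _
        _ = expMoment T R μ η (K + κ) U := by
            rw [expMoment, expMoment, ← lintegral_union (hUm.diff hAm)
              Set.disjoint_sdiff_right, Set.union_sdiff_cancel Set.inter_subset_left, expMoment]
        _ ≤ _ := (expMoment_mono (by positivity) (by linarith) le_rfl subset_rfl).trans hm
    have h2 : μ.real (U \ A) = μ.real U - μ.real A :=
      measureReal_sdiff Set.inter_subset_left hAm
    rw [← ofReal_measureReal, h2] at h1
    have h3 : expMoment T R μ η (K + κ) A ≤
        ENNReal.ofReal m - ENNReal.ofReal (μ.real U - μ.real A) :=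
      ENNReal.le_sub_of_add_le_right ENNReal.ofReal_ne_top h1
    rw [← ENNReal.ofReal_sub _ (by linarith)] at h3
    convert h3 using 2
    ring
  have hsub : U ∩ survivors T R U 0 t ⊆
      (A ∩ survivors T R U 0 t) ∪ (U ∩ {x | t < returnSum T R K x}) := by
    rintro x ⟨hxU, hx⟩
    rcases le_or_gt (returnSum T R K x) t with h | h
    · exact Or.inl ⟨⟨hxU, fun j hj => hx j hj.1 ((returnSum_mono hj.2 x).trans h)⟩, hx⟩
    · exact Or.inr ⟨hxU, h⟩
  have hAm0 : 0 ≤ μ.real A + (m - μ.real U) := by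
    have := measureReal_nonneg (μ := μ) (s := A); linarith
  have hfirst : μ.real (A ∩ survivors T R U 0 t) ≤
      (1 + ε) * ((μ.real A + (m - μ.real U)) * μ.real (survivors T R U κ t)) := by
    have h1 : μ (A ∩ survivors T R U 0 t) ≤ ENNReal.ofReal (1 + ε) *
        (ENNReal.ofReal (μ.real A + (m - μ.real U)) * μ (survivors T R U κ t)) := by
      refine (hM.measure_inter_survivors_le hUm hG hc hδ hq htail hε hAcyl t).trans ?_
      gcongr
    have h2 := ENNReal.toReal_mono (by finiteness) h1
    rwa [ENNReal.toReal_mul, ENNReal.toReal_mul, ENNReal.toReal_ofReal (by linarith),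
      ENNReal.toReal_ofReal hAm0] at h2
  -- Chebyshev at 2η gives exp(-2ηt) m. One factor exp(-ηt) is absorbed by the lower bound for the
  -- survivor set that slow decay provides; the other remains and vanishes as t → ∞.
  have hsecond : μ.real (U ∩ {x | t < returnSum T R K x}) ≤
      Real.exp (-(η * t)) * m * μ.real (survivors T R U κ t) := by
    have h1 : μ (U ∩ {x | t < returnSum T R K x}) ≤
        ENNReal.ofReal (Real.exp (-(2 * η * t)) * m) := by
      rw [← setLIntegral_one]
      calc _ ≤ ∫⁻ x in U ∩ {x | t < returnSum T R K x}, ENNReal.ofReal (Real.exp (-(2 * η * t))) *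
            ENNReal.ofReal (Real.exp (2 * η * returnSum T R K x)) ∂μ := by
            refine setLIntegral_mono' (hUm.inter (hM.measurableSet_returnSum K (t < ·)))
              fun x hx => ?_
            rw [← ENNReal.ofReal_mul (Real.exp_pos _).le, ← Real.exp_add,
              ENNReal.one_le_ofReal, Real.one_le_exp_iff]
            have h3 : (t : ℝ) ≤ returnSum T R K x := by exact_mod_cast (le_of_lt hx.2)
            nlinarith
        _ ≤ _ := by
            rw [lintegral_const_mul' _ _ ENNReal.ofReal_ne_top,
              ENNReal.ofReal_mul (Real.exp_pos _).le]
            gcongr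
            exact (expMoment_mono (by positivity) le_rfl (by omega)
              Set.inter_subset_left).trans hm
    have h2 := ENNReal.toReal_le_of_le_ofReal (by positivity) h1
    refine h2.trans ?_
    have h3 := hG.exp_neg_le t
    have h4 : Real.exp (-(2 * η * t)) = Real.exp (-(η * t)) * Real.exp (-(η * t)) := by
      rw [← Real.exp_add]; ring_nf
    rw [h4]
    calc _ = Real.exp (-(η * t)) * m * Real.exp (-(η * t)) := by ring
      _ ≤ _ := by gcongr
  calc _ ≤ _ := (measureReal_mono hsub).trans (measureReal_union_le _ _)
    _ ≤ _ := add_le_add hfirst hsecond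
    _ = _ := by ring

end IsMixingTower

/-! ### Survival in the tower -/

/-- The measure of the points of the tower that do not enter `U` (in the base) up to time `t`, before
normalization. -/
noncomputable def towerSurvival {X : Type*} [MeasurableSpace X] (T : X → X) (R : X → ℕ+)
    (μ : Measure X) (U : Set X) (t : ℕ) : ENNReal :=
  ∑' k : ℕ, μ ({x | k < (R x : ℕ)} ∩ survivors T R U 0 (t + k))

namespace IsMixingTower

variable {X : Type*} [MeasurableSpace X] {T : X → X} {𝒜 : Set (Set X)} {R : X → ℕ+}
  {μ : Measure X} {C : ℝ} {U : Set X} {κ : ℕ} {η m : ℝ}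

theorem isCylinderSet_returnTime (hM : IsMixingTower T 𝒜 R μ C) (P : ℕ → Prop) :
    IsCylinderSet T 𝒜 1 {x | P (R x)} := by
  have := hM.isCylinderSet_returnSum 1 P
  simpa only [returnSum_one] using this

theorem measurableSet_returnTime (hM : IsMixingTower T 𝒜 R μ C) (P : ℕ → Prop) :
    MeasurableSet {x | P (R x)} :=
  hM.measurableSet 1 _ (hM.isCylinderSet_returnTime P)

theorem measurable_comp_returnTime (hM : IsMixingTower T 𝒜 R μ C) {β : Type*} [MeasurableSpace β]
    (φ : ℕ → β) : Measurable fun x => φ (R x) := by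
  have h1 := (measurable_from_top (f := φ)).comp (hM.measurable_returnSum 1)
  convert h1 using 2 with x
  simp [returnSum_one]

theorem tsum_setLIntegral_returnTime (hM : IsMixingTower T 𝒜 R μ C) {φ : X → ENNReal}
    (hφ : Measurable φ) :
    ∑' k : ℕ, ∫⁻ x in {x | k < (R x : ℕ)}, φ x ∂μ = ∫⁻ x, (R x : ℕ) * φ x ∂μ := by
  have h1 : ∀ k : ℕ, ∫⁻ x in {x | k < (R x : ℕ)}, φ x ∂μ =
      ∫⁻ x, {x | k < (R x : ℕ)}.indicator φ x ∂μ := fun k =>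
    (lintegral_indicator (hM.measurableSet_returnTime (k < ·)) φ).symm
  simp only [h1]
  rw [← lintegral_tsum fun k =>
    (hφ.indicator (hM.measurableSet_returnTime (k < ·))).aemeasurable]
  refine lintegral_congr fun x => ?_
  rw [tsum_eq_sum (s := Finset.range (R x)) fun k hk => Set.indicator_of_notMem
    (s := {x | k < (R x : ℕ)}) (fun h => hk (Finset.mem_range.2 h)) φ]
  rw [Finset.sum_congr rfl fun k hk => Set.indicator_of_mem (s := {x | k < (R x : ℕ)})
    (show x ∈ {x | k < (R x : ℕ)} from Finset.mem_range.1 hk) φ]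
  rw [Finset.sum_const, Finset.card_range, nsmul_eq_mul]

theorem lintegral_returnTime_lt_top (hM : IsMixingTower T 𝒜 R μ C) :
    ∫⁻ x, ((R x : ℕ) : ENNReal) ∂μ < ⊤ := by
  obtain ⟨z, hz, hfin⟩ := hM.moment
  refine lt_of_le_of_lt (b := ENNReal.ofReal z⁻¹ *
    ∫⁻ x, ENNReal.ofReal (Real.exp (z * (R x : ℕ))) ∂μ) ?_
    (ENNReal.mul_lt_top ENNReal.ofReal_lt_top hfin)
  rw [← lintegral_const_mul' _ _ ENNReal.ofReal_ne_top]
  refine lintegral_mono fun x => ?_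
  rw [← ENNReal.ofReal_mul (by positivity), ← ENNReal.ofReal_natCast]
  refine ENNReal.ofReal_le_ofReal ?_
  rw [← div_eq_inv_mul, le_div_iff₀ hz]
  linarith [Real.add_one_le_exp (z * (R x : ℕ))]

theorem tendsto_lintegral_returnTime_mul_exp (hM : IsMixingTower T 𝒜 R μ C) :
    Tendsto (fun η : ℝ => ∫⁻ x, (R x : ℕ) * ENNReal.ofReal (Real.exp (η * (R x : ℕ))) ∂μ) (𝓝 0)
      (𝓝 (∫⁻ x, ((R x : ℕ) : ENNReal) ∂μ)) := by
  obtain ⟨z, hz, hfin⟩ := hM.moment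
  refine tendsto_lintegral_filter_of_dominated_convergence
    (fun x => ENNReal.ofReal (2 / z) * ENNReal.ofReal (Real.exp (z * (R x : ℕ)))) ?_ ?_ ?_ ?_
  · exact Eventually.of_forall fun η => hM.measurable_comp_returnTime
      fun v : ℕ => (v : ENNReal) * ENNReal.ofReal (Real.exp (η * v))
  · filter_upwards [gt_mem_nhds (show (0 : ℝ) < z / 2 by positivity)] with η hη
    refine Eventually.of_forall fun x => ?_
    rw [← ENNReal.ofReal_natCast, ← ENNReal.ofReal_mul (by positivity),
      ← ENNReal.ofReal_mul (by positivity)]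
    refine ENNReal.ofReal_le_ofReal ?_
    have h1 := Real.add_one_le_exp (z / 2 * (R x : ℕ))
    have h2 : ((R x : ℕ) : ℝ) ≤ 2 / z * Real.exp (z / 2 * (R x : ℕ)) := by
      rw [div_mul_eq_mul_div, le_div_iff₀ hz]
      linarith
    calc ((R x : ℕ) : ℝ) * Real.exp (η * (R x : ℕ))
        ≤ 2 / z * Real.exp (z / 2 * (R x : ℕ)) * Real.exp (z / 2 * (R x : ℕ)) := by gcongr
      _ = _ := by rw [mul_assoc, ← Real.exp_add]; ring_nf
  · rw [lintegral_const_mul' _ _ ENNReal.ofReal_ne_top]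
    exact (ENNReal.mul_lt_top ENNReal.ofReal_lt_top hfin).ne
  · refine Eventually.of_forall fun x => ?_
    have h1 : Tendsto (fun η : ℝ => ENNReal.ofReal (((R x : ℕ) : ℝ) * Real.exp (η * (R x : ℕ))))
        (𝓝 0) (𝓝 (ENNReal.ofReal (((R x : ℕ) : ℝ) * Real.exp (0 * (R x : ℕ))))) :=
      (ENNReal.continuous_ofReal.comp (by fun_prop)).tendsto 0
    simp only [zero_mul, Real.exp_zero, mul_one, ENNReal.ofReal_natCast] at h1
    refine h1.congr fun η => ?_
    rw [ENNReal.ofReal_mul (by positivity), ENNReal.ofReal_natCast]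

/-- Invariance of the tower measure. On floor k, survival up to t + 1 means moving up to floor k + 1
and surviving for t, or falling to the base outside U and surviving for t. The falling parts add up
to μ(E \ U), E being the survivors in the base up to t, whereas floor 0 contributes μ(E) to the
survival at t. -/
theorem towerSurvival_eq_add (hM : IsMixingTower T 𝒜 R μ C) (hU : MeasurableSet U) (t : ℕ) :
    towerSurvival T R μ U t = towerSurvival T R μ U (t + 1) + μ (U ∩ survivors T R U 0 t) := by
  have hE := fun s => hM.measurableSet_survivors hU 0 s
  have hR := fun P => hM.measurableSet_returnTime P
  have hsplit : ∀ k : ℕ, μ ({x | k < (R x : ℕ)} ∩ survivors T R U 0 (t + 1 + k)) =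
      μ ({x | k + 1 < (R x : ℕ)} ∩ survivors T R U 0 (t + (k + 1))) +
        μ ({x | (R x : ℕ) = k + 1} ∩ T ⁻¹' (survivors T R U 0 t \ U)) := by
    intro k
    rw [← measure_union]
    · congr 1
      ext x
      have hiff : (R x : ℕ) = k + 1 →
          (x ∈ survivors T R U 0 (t + 1 + k) ↔ T x ∈ survivors T R U 0 t \ U) := by
        intro hRx
        have hsum : ∀ j, returnSum T R (1 + j) x = k + 1 + returnSum T R j (T x) := fun j => by
          rw [returnSum_add, returnSum_one, hRx]; rfl
        constructor
        · refine fun h => ⟨fun j hj hjt => ?_, ?_⟩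
          · rw [← Function.iterate_succ_apply]
            refine h (j + 1) (by omega) ?_
            rw [add_zero, add_comm, hsum]
            rw [add_zero] at hjt
            omega
          · refine h 1 le_rfl ?_
            rw [add_zero, returnSum_one, hRx]
            omega
        · rintro ⟨h1, h2⟩ j hj hjt
          obtain ⟨i, rfl⟩ := Nat.exists_eq_add_of_le hj
          rw [add_zero, hsum] at hjt
          rcases Nat.eq_zero_or_pos i with rfl | hi
          · exact h2
          · rw [add_comm, Function.iterate_succ_apply]
            refine h1 i hi ?_
            rw [add_zero]
            omega
      simp only [Set.mem_inter_iff, Set.mem_union, Set.mem_ofPred_eq, Set.mem_preimage]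
      rw [show t + 1 + k = t + (k + 1) by ring] at hiff ⊢
      constructor
      · rintro ⟨h1, h2⟩
        rcases Nat.lt_or_ge (k + 1) (R x) with h | h
        · exact Or.inl ⟨h, h2⟩
        · have heq : (R x : ℕ) = k + 1 := by omega
          exact Or.inr ⟨heq, (hiff heq).1 h2⟩
      · rintro (⟨h1, h2⟩ | ⟨h1, h2⟩)
        · exact ⟨by omega, h2⟩
        · exact ⟨by omega, (hiff h1).2 h2⟩
    · refine Set.disjoint_left.2 fun x hx hx' => ?_
      have h1 : k + 1 < (R x : ℕ) := hx.1
      have h2 : (R x : ℕ) = k + 1 := hx'.1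
      omega
    · exact (hR (· = k + 1)).inter (hM.measurable ((hE t).diff hU))
  have hfiber : ∑' k : ℕ, μ ({x | (R x : ℕ) = k + 1} ∩ T ⁻¹' (survivors T R U 0 t \ U)) =
      μ (survivors T R U 0 t \ U) := by
    rw [← hM.measurePreserving.measure_preimage ((hE t).diff hU).nullMeasurableSet,
      ← measure_iUnion]
    · congr 1
      ext x
      simp only [Set.mem_iUnion, Set.mem_inter_iff, Set.mem_ofPred_eq, exists_and_right]
      refine ⟨fun h => h.2, fun h => ⟨⟨(R x : ℕ) - 1, ?_⟩, h⟩⟩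
      have := (R x).pos
      omega
    · refine fun i j hij => Set.disjoint_left.2 fun x hx hx' => hij ?_
      have h1 : (R x : ℕ) = i + 1 := hx.1
      have h2 : (R x : ℕ) = j + 1 := hx'.1
      omega
    · exact fun k => (hR (· = k + 1)).inter (hM.measurable ((hE t).diff hU))
  have h0 : μ ({x | 0 < (R x : ℕ)} ∩ survivors T R U 0 (t + 0)) =
      μ (survivors T R U 0 t \ U) + μ (U ∩ survivors T R U 0 t) := by
    have : {x | 0 < (R x : ℕ)} ∩ survivors T R U 0 (t + 0) = survivors T R U 0 t := by
      ext x
      simp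
    rw [this, Set.inter_comm, measure_sdiff_add_inter _ hU]
  rw [towerSurvival, towerSurvival, tsum_congr hsplit, ENNReal.tsum_add, hfiber,
    _root_.tsum_eq_zero_add' ENNReal.summable, h0]
  ring

variable [IsProbabilityMeasure μ]

theorem one_le_lintegral_returnTime (R : X → ℕ+) : 1 ≤ ∫⁻ x, ((R x : ℕ) : ENNReal) ∂μ := by
  calc (1 : ENNReal) = ∫⁻ _, 1 ∂μ := by simp
    _ ≤ _ := lintegral_mono fun x => Nat.one_le_cast.2 (R x).pos

/-- Each set {k < R} is a union of 1-cylinders, so survival decouples from it at the price exp(ηR).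
Summing over the floors k < R gives the weight R. -/
theorem towerSurvival_le (hM : IsMixingTower T 𝒜 R μ C) (hU : MeasurableSet U)
    (hG : HasSlowDecay T R μ U κ η) {q k : ℕ} {c δ ε : ℝ} (hc : 0 ≤ c) (hδ : 0 ≤ δ)
    (hq : HasProductBound T 𝒜 μ q c)
    (htail : expMoment T R μ η q {x | k < returnSum T R q x} ≤ ENNReal.ofReal δ)
    (hε : c * Real.exp (η * k) + C ^ 2 * δ ≤ 1 + ε) (t : ℕ) :
    towerSurvival T R μ U t ≤ ENNReal.ofReal (1 + ε) *
      ((∫⁻ x, (R x : ℕ) * ENNReal.ofReal (Real.exp (η * (R x : ℕ))) ∂μ) *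
        μ (survivors T R U κ t)) := by
  rw [← hM.tsum_setLIntegral_returnTime (hM.measurable_comp_returnTime
    fun v : ℕ => ENNReal.ofReal (Real.exp (η * v))), ← ENNReal.tsum_mul_right,
    ← ENNReal.tsum_mul_left]
  refine ENNReal.tsum_le_tsum fun k => ?_
  refine (measure_mono (Set.inter_subset_inter_right _ (survivors_antitone
    (Nat.le_add_right t k)))).trans ?_
  have h1 := hM.measure_inter_survivors_le hU hG hc hδ hq htail hε
    (hM.isCylinderSet_returnTime (k < ·)) t
  rw [expMoment] at h1
  simpa only [returnSum_one] using h1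

/-- Floor k asks for survival up to t + k in the base, which slow decay bounds below by exp(-ηk)
times survival up to t. Since exp(-ηR) ≤ exp(-ηk) on {k < R}, the sum can be written as an integral
of R exp(-ηR). -/
theorem le_towerSurvival (hM : IsMixingTower T 𝒜 R μ C)
    (hU : IsCylinderSet T 𝒜 κ U) (hη : 0 ≤ η) (hG : HasSlowDecay T R μ U κ η)
    (hm0 : 0 ≤ m) (hm : expMoment T R μ η κ U ≤ ENNReal.ofReal m) {q : ℕ} {δ ζ : ℝ} (hδ : δ ≤ 1)
    (hq : HasMixingGap T 𝒜 μ q δ)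
    (hζ : ∀ s, (1 - ζ) * μ.real (survivors T R U κ s) ≤ μ.real (survivors T R U 0 s)) (t : ℕ) :
    ENNReal.ofReal ((1 - δ) * (1 - ζ) - C * (C * m) * (1 + q)) *
      ((∫⁻ x, (R x : ℕ) * ENNReal.ofReal (Real.exp (-η * (R x : ℕ))) ∂μ) *
        μ (survivors T R U κ t)) ≤ towerSurvival T R μ U t := by
  have hC := hM.pos
  rw [← hM.tsum_setLIntegral_returnTime (hM.measurable_comp_returnTime
    fun v : ℕ => ENNReal.ofReal (Real.exp (-η * v))), ← ENNReal.tsum_mul_right,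
    ← ENNReal.tsum_mul_left]
  refine ENNReal.tsum_le_tsum fun k => ?_
  have hRcyl := hM.isCylinderSet_returnTime (k < ·)
  have hRm := hM.measurableSet_returnTime (k < ·)
  set A := {x | k < (R x : ℕ)}
  -- `ENNReal.ofReal` truncates a nonpositive constant to 0, in which case there is nothing to
  -- prove.
  rcases le_or_gt ((1 - δ) * (1 - ζ) - C * (C * m) * (1 + q)) 0 with hneg | hpos
  · rw [ENNReal.ofReal_of_nonpos hneg, zero_mul]
    exact zero_le
  have hint : ∫⁻ x in A, ENNReal.ofReal (Real.exp (-η * (R x : ℕ))) ∂μ ≤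
      ENNReal.ofReal (Real.exp (-(η * k)) * μ.real A) := by
    rw [ENNReal.ofReal_mul (Real.exp_pos _).le, ofReal_measureReal, ← setLIntegral_const]
    refine setLIntegral_mono' hRm fun x hx => ENNReal.ofReal_le_ofReal (Real.exp_le_exp.2 ?_)
    have h1 : (k : ℝ) ≤ (R x : ℕ) := by exact_mod_cast (le_of_lt hx)
    nlinarith
  have hbk : Real.exp (-(η * k)) * μ.real (survivors T R U κ t) ≤
      μ.real (survivors T R U κ (t + k)) := by
    have h1 := hG (t + k) k
    rw [Nat.add_sub_cancel] at h1
    calc _ ≤ Real.exp (-(η * k)) * (Real.exp (η * k) * μ.real (survivors T R U κ (t + k))) := by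
          gcongr
      _ = _ := by rw [← mul_assoc, ← Real.exp_add, neg_add_cancel, Real.exp_zero, one_mul]
  -- The set {k < R} is already a union of i-cylinders for each i ≥ 1, so it serves as its own hull
  -- at the 1 + q times involved.
  have hlow := hM.le_measureReal_inter_survivors hU hη hG hm0 hm hq (a := 0) hRcyl
    (fun x _ j hj hj0 => by omega) (W := fun _ => A)
    (fun i hi => ⟨hRcyl.mono (Finset.mem_Ioc.1 hi).1, subset_rfl⟩) (t + k)
  rw [Finset.sum_const, Nat.card_Ioc, nsmul_eq_mul, Nat.sub_zero] at hlow
  push_cast at hlow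
  have hreal : ((1 - δ) * (1 - ζ) - C * (C * m) * (1 + q)) *
      (Real.exp (-(η * k)) * μ.real A * μ.real (survivors T R U κ t)) ≤
      μ.real (A ∩ survivors T R U 0 (t + k)) := by
    have hA0 := measureReal_nonneg (μ := μ) (s := A)
    have h1 : (1 - δ) * (μ.real A * ((1 - ζ) * μ.real (survivors T R U κ (t + k)))) ≤
        (1 - δ) * (μ.real A * μ.real (survivors T R U 0 (t + k))) :=
      mul_le_mul_of_nonneg_left (mul_le_mul_of_nonneg_left (hζ _) hA0) (by linarith)
    calc _ = ((1 - δ) * (1 - ζ) - C * (C * m) * (1 + q)) * (μ.real A *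
          (Real.exp (-(η * k)) * μ.real (survivors T R U κ t))) := by ring
      _ ≤ ((1 - δ) * (1 - ζ) - C * (C * m) * (1 + q)) * (μ.real A *
          μ.real (survivors T R U κ (t + k))) := by gcongr
      _ ≤ _ := by linarith
  calc _ ≤ ENNReal.ofReal ((1 - δ) * (1 - ζ) - C * (C * m) * (1 + q)) *
        (ENNReal.ofReal (Real.exp (-(η * k)) * μ.real A) *
          ENNReal.ofReal (μ.real (survivors T R U κ t))) := by
        rw [ofReal_measureReal]
        gcongr
    _ = ENNReal.ofReal (((1 - δ) * (1 - ζ) - C * (C * m) * (1 + q)) *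
      (Real.exp (-(η * k)) * μ.real A * μ.real (survivors T R U κ t))) := by
        rw [← ENNReal.ofReal_mul (by positivity), ← ENNReal.ofReal_mul hpos.le]
    _ ≤ ENNReal.ofReal (μ.real (A ∩ survivors T R U 0 (t + k))) := ENNReal.ofReal_le_ofReal hreal
    _ = _ := ofReal_measureReal

end IsMixingTower

/-! ### Shrinking holes -/

/-- A sequence of unions of `κ n`-cylinders with measures tending to `0`, without short returns of
positive order, and with extremal index `α`. -/
structure IsShrinkingHoleSystem {X : Type*} [MeasurableSpace X] (T : X → X) (𝒜 : Set (Set X))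
    (μ : Measure X) (V : ℕ → Set X) (κ : ℕ → ℕ) (α : ℝ) : Prop where
  isCylinderSet : ∀ᶠ n in atTop, IsCylinderSet T 𝒜 (κ n) (V n)
  one_le : ∀ᶠ n in atTop, 1 ≤ κ n
  measure_pos : ∀ᶠ n in atTop, 0 < μ.real (V n)
  tendsto_measure : Tendsto (fun n => μ.real (V n)) atTop (𝓝 0)
  exists_exponent : ∃ ε : ℝ, 0 < ε ∧ ε < 1 ∧
    Tendsto (fun n => (κ n : ℝ) * μ.real (V n) ^ ε) atTop (𝓝 0)
  exists_hull : ∃ C p : ℝ, 1 ≤ C ∧ 1 < p ∧ ∀ᶠ n in atTop, ∀ j, 1 ≤ j → j < κ n →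
    ∃ W, IsCylinderSet T 𝒜 j W ∧ V n ⊆ W ∧ μ.real W ≤ C * (μ.real (V n) + (j : ℝ) ^ (-p))
  extremal : ∃ a : ℕ → ℝ, (∀ᶠ K : ℕ in atTop, Tendsto (fun n =>
      μ.real (V n ∩ {x | ∀ j, (1 ≤ j ∧ j ≤ K) → T^[j] x ∉ V n}) / μ.real (V n)) atTop
      (𝓝 (a K))) ∧ Tendsto a atTop (𝓝 α)

namespace IsMixingTower

variable {X : Type*} [MeasurableSpace X] {T : X → X} {𝒜 : Set (Set X)} {R : X → ℕ+}
  {μ : Measure X} [IsProbabilityMeasure μ] {C : ℝ}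

theorem eventually_expMoment_le (hM : IsMixingTower T 𝒜 R μ C) {V : ℕ → Set X}
    (hpos : ∀ᶠ n in atTop, 0 < μ.real (V n)) {η : ℕ → ℝ} (hη : ∀ n, 0 ≤ η n) {L : ℕ → ℕ}
    (hL : ∀ᶠ n in atTop, 1 ≤ L n) (h1 : Tendsto (fun n => η n * L n) atTop (𝓝 0))
    (h2 : Tendsto (fun n => η n * L n * Real.log (μ.real (V n))) atTop (𝓝 0)) {δ : ℝ}
    (hδ : 0 < δ) :
    ∀ᶠ n in atTop, expMoment T R μ (η n) (L n) (V n) ≤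
      ENNReal.ofReal ((1 + δ) * μ.real (V n)) := by
  obtain ⟨z₀, C₁, hz₀, -, h⟩ := hM.exists_expMoment_univ_le
  have hlim : Tendsto (fun n => Real.exp (-(η n * L n / z₀ * Real.log (μ.real (V n)))) *
      (1 + η n * L n / z₀ * Real.exp (C₁ * z₀))) atTop (𝓝 1) := by
    have e1 : Tendsto (fun n => Real.exp (-(η n * L n / z₀ * Real.log (μ.real (V n))))) atTop
        (𝓝 1) := by
      have := ((h2.div_const z₀).neg).rexp
      rw [zero_div, neg_zero, Real.exp_zero] at this
      refine this.congr fun n => ?_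
      congr 2
      ring
    have e2 := (((h1.div_const z₀).mul_const (Real.exp (C₁ * z₀))).const_add 1)
    rw [zero_div, zero_mul, add_zero] at e2
    simpa using e1.mul e2
  filter_upwards [hpos, hL, h1.eventually (gt_mem_nhds hz₀),
    hlim.eventually (gt_mem_nhds (show 1 < 1 + δ by linarith))] with n p1 p2 p3 p4
  refine (expMoment_le_of_expMoment_univ_le hz₀ h p1 (hη n) p2 p3.le).trans
    (ENNReal.ofReal_le_ofReal ?_)
  rw [mul_comm]
  gcongr

end IsMixingTower

/-- For `v n → 0` with `κ n (v n)^ε → 0` there is a scale `η n → 0` with `v n = o(η n)` and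
`η n κ n log (v n) → 0`. -/
theorem exists_scale {v : ℕ → ℝ} {κ : ℕ → ℕ} {ε : ℝ} (hε0 : 0 < ε) (hε1 : ε < 1)
    (hv : ∀ᶠ n in atTop, 0 < v n) (hv0 : ∀ n, 0 ≤ v n) (hlim : Tendsto v atTop (𝓝 0))
    (hκ : Tendsto (fun n => (κ n : ℝ) * v n ^ ε) atTop (𝓝 0)) :
    ∃ η : ℕ → ℝ, (∀ n, 0 ≤ η n) ∧ (∀ᶠ n in atTop, 0 < η n) ∧ Tendsto η atTop (𝓝 0) ∧
      Tendsto (fun n => v n / η n) atTop (𝓝 0) ∧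
      Tendsto (fun n => κ n * v n) atTop (𝓝 0) ∧ ∀ K : ℕ,
      Tendsto (fun n => η n * (K + κ n : ℕ)) atTop (𝓝 0) ∧
      Tendsto (fun n => η n * (K + κ n : ℕ) * Real.log (v n)) atTop (𝓝 0) := by
  -- The scale is η = v^(ε+s), where ε + 2s = 1. Hence v/η = v^s, while ηκ = (κ v^ε) v^s keeps a
  -- positive power of v to spare, which absorbs the logarithm.
  set s := (1 - ε) / 2 with hs
  have hs0 : 0 < s := by rw [hs]; linarith
  have hvp : Tendsto v atTop (𝓝[>] 0) := tendsto_nhdsWithin_iff.2 ⟨hlim, hv⟩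
  have hrpow : ∀ r : ℝ, 0 < r → Tendsto (fun n => v n ^ r) atTop (𝓝 0) := fun r hr => by
    have := hlim.rpow_const (p := r) (Or.inr hr.le)
    rwa [Real.zero_rpow hr.ne'] at this
  have hlog : ∀ r : ℝ, 0 < r → Tendsto (fun n => Real.log (v n) * v n ^ r) atTop (𝓝 0) :=
    fun r hr => (tendsto_log_mul_rpow_nhdsGT_zero hr).comp hvp
  have hsplit : ∀ᶠ n in atTop, v n ^ (ε + s) = v n ^ ε * v n ^ s := by
    filter_upwards [hv] with n hn using Real.rpow_add hn _ _
  refine ⟨fun n => v n ^ (ε + s), fun n => Real.rpow_nonneg (hv0 n) _,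
    hv.mono fun n hn => Real.rpow_pos_of_pos hn _, hrpow _ (by linarith), ?_, ?_, fun K => ⟨?_, ?_⟩⟩
  · refine (hrpow s hs0).congr' ?_
    filter_upwards [hv] with n hn
    rw [eq_div_iff (Real.rpow_pos_of_pos hn _).ne', ← Real.rpow_add hn,
      show s + (ε + s) = 1 by rw [hs]; ring, Real.rpow_one]
  · have := hκ.mul (hrpow (1 - ε) (by linarith))
    rw [zero_mul] at this
    refine this.congr' ?_
    filter_upwards [hv] with n hn
    rw [mul_assoc, ← Real.rpow_add hn, show ε + (1 - ε) = 1 by ring, Real.rpow_one]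
  · have := ((hrpow (ε + s) (by linarith)).const_mul (K : ℝ)).add (hκ.mul (hrpow s hs0))
    rw [mul_zero, mul_zero, add_zero] at this
    refine this.congr' ?_
    filter_upwards [hsplit] with n hn
    rw [hn]
    push_cast
    ring
  · have := ((hlog (ε + s) (by linarith)).const_mul (K : ℝ)).add (hκ.mul (hlog s hs0))
    rw [mul_zero, mul_zero, add_zero] at this
    refine this.congr' ?_
    filter_upwards [hsplit] with n hn
    rw [hn]
    push_cast
    ring

/-- For a scale `η` the exponential moments of the return times up to the time `K + κ n`, restricted
to the holes, are asymptotic to the measures of the holes, and the survivor sets decay at most at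
the rate `η n`. -/
structure IsDecayScale {X : Type*} [MeasurableSpace X] (T : X → X) (R : X → ℕ+) (μ : Measure X)
    (V : ℕ → Set X) (κ : ℕ → ℕ) (η : ℕ → ℝ) : Prop where
  pos : ∀ᶠ n in atTop, 0 < η n
  tendsto_zero : Tendsto η atTop (𝓝 0)
  tendsto_mul : Tendsto (fun n => κ n * μ.real (V n)) atTop (𝓝 0)
  slowDecay : ∀ᶠ n in atTop, HasSlowDecay T R μ (V n) (κ n) (η n)
  expMoment_le : ∀ (K : ℕ) (δ : ℝ), 0 < δ → ∀ᶠ n in atTop,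
    expMoment T R μ (2 * η n) (K + κ n) (V n) ≤ ENNReal.ofReal ((1 + δ) * μ.real (V n))
  survivors_le : ∀ δ : ℝ, 0 < δ → ∀ᶠ n in atTop, ∀ t,
    (1 - δ) * μ.real (survivors T R (V n) (κ n) t) ≤ μ.real (survivors T R (V n) 0 t)

namespace IsMixingTower

variable {X : Type*} [MeasurableSpace X] {T : X → X} {𝒜 : Set (Set X)} {R : X → ℕ+}
  {μ : Measure X} [IsProbabilityMeasure μ] {C : ℝ} {V : ℕ → Set X} {κ : ℕ → ℕ} {α : ℝ}

theorem exists_decay_scale (hM : IsMixingTower T 𝒜 R μ C)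
    (hV : IsShrinkingHoleSystem T 𝒜 μ V κ α) : ∃ η, IsDecayScale T R μ V κ η := by
  obtain ⟨ε, hε0, hε1, hκ⟩ := hV.exists_exponent
  obtain ⟨η, h0, hpos, hlim, hquot, hκv, hK⟩ := exists_scale hε0 hε1 hV.measure_pos
    (fun n => measureReal_nonneg) hV.tendsto_measure hκ
  have hC := hM.pos
  have hmom : ∀ (K : ℕ) (δ : ℝ), 0 < δ → ∀ᶠ n in atTop,
      expMoment T R μ (2 * η n) (K + κ n) (V n) ≤ ENNReal.ofReal ((1 + δ) * μ.real (V n)) := by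
    intro K δ hδ
    refine hM.eventually_expMoment_le hV.measure_pos (η := fun n => 2 * η n)
      (fun n => mul_nonneg zero_le_two (h0 n)) (L := fun n => K + κ n) ?_ ?_ ?_ hδ
    · filter_upwards [hV.one_le] with n hn using by omega
    · simpa [mul_assoc] using (hK K).1.const_mul 2
    · simpa [mul_assoc] using (hK K).2.const_mul 2
  have hmom0 : ∀ᶠ n in atTop, expMoment T R μ (2 * η n) (κ n) (V n) ≤
      ENNReal.ofReal (2 * μ.real (V n)) := by
    filter_upwards [hmom 0 1 one_pos] with n hn
    rwa [zero_add, one_add_one_eq_two] at hn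
  have hdecay : ∀ᶠ n in atTop, HasSlowDecay T R μ (V n) (κ n) (η n) := by
    filter_upwards [hmom0, hpos, hV.isCylinderSet, hV.one_le,
      hlim.eventually (gt_mem_nhds (show (0 : ℝ) < 1 / 2 by norm_num)),
      hquot.eventually (gt_mem_nhds (show 0 < 1 / (4 * C) by positivity))] with n p1 p2 p3 p4 p5 p6
    refine hM.measureReal_survivors_sub_le p3 p4 p2.le (m := 2 * μ.real (V n)) (by positivity)
      ((expMoment_mono (by positivity) (by linarith) le_rfl subset_rfl).trans p1) ?_
    rw [div_lt_div_iff₀ p2 (by positivity)] at p6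
    -- Together with μ(V n) < η n/(4C), this gives C · 2μ(V n) ≤ 1 - exp(-η n), as the induction for
    -- slow decay requires.
    have h1 : Real.exp (-η n) ≤ 1 - η n / 2 := by
      have h2 := Real.abs_exp_sub_one_sub_id_le (x := -η n) 
        (by rw [abs_neg, abs_of_pos p2]; linarith)
      have h3 := (abs_le.1 h2).2
      nlinarith
    linarith
  refine ⟨η, hpos, hlim, hκv, hdecay, hmom, fun δ hδ => ?_⟩
  filter_upwards [hmom0, hpos, hV.isCylinderSet, hdecay,
    hquot.eventually (gt_mem_nhds (show 0 < δ / (2 * C) by positivity))] with n p1 p2 p3 p4 p5 t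
  have h1 := hM.measureReal_survivors_sub_survivors_zero_le_mul p3 p2
    (m := 2 * μ.real (V n)) (by positivity) p1 p4 t
  have h2 : C * (2 * μ.real (V n) / η n) ≤ δ := by
    calc _ = 2 * C * (μ.real (V n) / η n) := by ring
      _ ≤ 2 * C * (δ / (2 * C)) := by gcongr
      _ = δ := by field_simp
  have h3 := mul_le_mul_of_nonneg_right h2
    (measureReal_nonneg (μ := μ) (s := survivors T R (V n) (κ n) t))
  linarith

end IsMixingTower

theorem IsDecayScale.eventually_expMoment_le_two_mul {X : Type*} [MeasurableSpace X] {T : X → X}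
    {R : X → ℕ+} {μ : Measure X} {V : ℕ → Set X} {κ : ℕ → ℕ} {η : ℕ → ℝ}
    (h : IsDecayScale T R μ V κ η) :
    ∀ᶠ n in atTop, expMoment T R μ (η n) (κ n) (V n) ≤ ENNReal.ofReal (2 * μ.real (V n)) := by
  filter_upwards [h.expMoment_le 0 1 one_pos, h.pos] with n hn hpos
  rw [zero_add, one_add_one_eq_two] at hn
  exact (expMoment_mono (by positivity) (by linarith) le_rfl subset_rfl).trans hn

theorem exists_sum_Ioc_rpow_le {p ε : ℝ} (hp : 1 < p) (hε : 0 < ε) :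
    ∀ᶠ K : ℕ in atTop, ∀ N : ℕ, ∑ i ∈ Finset.Ioc K N, (i : ℝ) ^ (-p) ≤ ε := by
  have hs : Summable fun i : ℕ => (i : ℝ) ^ (-p) := Real.summable_nat_rpow.2 (by linarith)
  have hnn : ∀ i : ℕ, 0 ≤ (i : ℝ) ^ (-p) := fun i => Real.rpow_nonneg (Nat.cast_nonneg i) _
  have h1 := (tendsto_add_atTop_iff_nat 1).2 hs.hasSum.tendsto_sum_nat
  filter_upwards [h1.eventually (lt_mem_nhds (sub_lt_self _ hε))] with K hK N
  rcases le_or_gt K N with hKN | hKN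
  · have h2 := Finset.sum_range_add_sum_Ico (fun i : ℕ => (i : ℝ) ^ (-p))
      (show K + 1 ≤ N + 1 by omega)
    have h3 : Finset.Ioc K N = Finset.Ico (K + 1) (N + 1) := by
      ext i; simp only [Finset.mem_Ioc, Finset.mem_Ico]; omega
    have h4 := hs.sum_le_tsum (Finset.range (N + 1)) fun i _ => hnn i
    rw [h3]
    linarith
  · rw [Finset.Ioc_eq_empty (by omega), Finset.sum_empty]
    exact hε.le

namespace IsMixingTower

variable {X : Type*} [MeasurableSpace X] {T : X → X} {𝒜 : Set (Set X)} {R : X → ℕ+}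
  {μ : Measure X} [IsProbabilityMeasure μ] {C : ℝ} {V : ℕ → Set X} {κ : ℕ → ℕ} {α : ℝ}
  {η : ℕ → ℝ}

/-- The order of choice matters: q from the mixing accuracy, then k and δ from the tail of S_q, and
only then η so small that exp(ηk) is close to 1. -/
theorem exists_gap_tail (hM : IsMixingTower T 𝒜 R μ C) {ε : ℝ} (hε : 0 < ε) :
    ∃ (q k : ℕ) (δ : ℝ), 0 ≤ δ ∧ HasMixingGap T 𝒜 μ q ε ∧ ∀ᶠ η in 𝓝 (0 : ℝ),
      expMoment T R μ η q {x | k < returnSum T R q x} ≤ ENNReal.ofReal δ ∧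
        (1 + ε) * Real.exp (η * k) + C ^ 2 * δ ≤ 1 + 3 * ε := by
  have hC := hM.pos
  obtain ⟨q, hq⟩ := hM.mixingGap ε hε
  obtain ⟨η₀, k, hη₀, htail⟩ := hM.exists_expMoment_tail_le q (show 0 < ε / C ^ 2 by positivity)
  refine ⟨q, k, ε / C ^ 2, by positivity, hq, ?_⟩
  have hlim : Tendsto (fun η : ℝ => (1 + ε) * Real.exp (η * k)) (𝓝 0) (𝓝 (1 + ε)) := by
    have : Continuous fun η : ℝ => (1 + ε) * Real.exp (η * k) := by fun_prop
    simpa using this.tendsto 0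
  filter_upwards [gt_mem_nhds hη₀, hlim.eventually (gt_mem_nhds (show 1 + ε < 1 + 2 * ε by linarith))]
    with η h1 h2
  refine ⟨htail η h1.le, ?_⟩
  rw [mul_div_cancel₀ _ (by positivity)]
  linarith

/-- The two bounds differ by ∫ R exp(±ηR) dμ, both tending to ∫ R dμ as η → 0, and by constants
close to 1. -/
theorem eventually_abs_towerSurvival_sub_le (hM : IsMixingTower T 𝒜 R μ C)
    (hV : IsShrinkingHoleSystem T 𝒜 μ V κ α) (hs : IsDecayScale T R μ V κ η) {δ : ℝ}
    (hδ : 0 < δ) :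
    ∀ᶠ n in atTop, ∀ t, towerSurvival T R μ (V n) t ≠ ⊤ ∧
      |(towerSurvival T R μ (V n) t).toReal - (∫⁻ x, ((R x : ℕ) : ENNReal) ∂μ).toReal *
        μ.real (survivors T R (V n) (κ n) t)| ≤ δ * μ.real (survivors T R (V n) (κ n) t) := by
  have hC := hM.pos
  set r := (∫⁻ x, ((R x : ℕ) : ENNReal) ∂μ).toReal with hr
  have hrR : ∫⁻ x, ((R x : ℕ) : ENNReal) ∂μ = ENNReal.ofReal r :=
    (ENNReal.ofReal_toReal hM.lintegral_returnTime_lt_top.ne).symm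
  have hr1 : 1 ≤ r := by
    have := one_le_lintegral_returnTime (μ := μ) R
    rwa [hrR, ENNReal.one_le_ofReal] at this
  obtain ⟨ε, hε0, hε4, hεδ⟩ : ∃ ε : ℝ, 0 < ε ∧ ε ≤ 1 / 4 ∧ ε * (4 + 3 * r) ≤ δ := by
    refine ⟨min (1 / 4) (δ / (4 + 3 * r)), by positivity, min_le_left _ _, ?_⟩
    rw [← le_div_iff₀ (by positivity)]
    exact min_le_right _ _
  obtain ⟨q, k, δ₀, hδ₀, hq, hηq⟩ := hM.exists_gap_tail hε0
  have hF := hM.tendsto_lintegral_returnTime_mul_exp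
  rw [hrR] at hF
  have hup := (hF.comp hs.tendsto_zero).eventually (gt_mem_nhds
    ((ENNReal.ofReal_lt_ofReal_iff (by linarith)).2 (show r < r + ε by linarith)))
  have hneg : Tendsto (fun n => -η n) atTop (𝓝 0) := by simpa using hs.tendsto_zero.neg
  have hlow := (hF.comp hneg).eventually (lt_mem_nhds
    ((ENNReal.ofReal_lt_ofReal_iff (by linarith)).2 (show r - ε < r by linarith)))
  have hvq : ∀ᶠ n in atTop, C * (C * (2 * μ.real (V n))) * (1 + q) ≤ ε := by
    have h1 : Tendsto (fun n => C * (C * (2 * μ.real (V n))) * (1 + q)) atTop (𝓝 0) := by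
      simpa using (((hV.tendsto_measure.const_mul 2).const_mul C).const_mul C).mul_const (1 + q : ℝ)
    exact (h1.eventually (gt_mem_nhds hε0)).mono fun n hn => hn.le
  filter_upwards [hV.isCylinderSet, hs.pos, hs.slowDecay, hs.eventually_expMoment_le_two_mul,
    hs.survivors_le ε hε0, hs.tendsto_zero.eventually hηq, hup, hlow, hvq]
    with n p1 p2 p3 p4 p5 p6 p7 p8 p9 t
  have hVm := hM.measurableSet _ _ p1
  set b := μ.real (survivors T R (V n) (κ n) t) with hb
  have hb0 : 0 ≤ b := measureReal_nonneg
  have hbE : μ (survivors T R (V n) (κ n) t) = ENNReal.ofReal b := by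
    rw [hb, ofReal_measureReal]
  have h1 : towerSurvival T R μ (V n) t ≤ ENNReal.ofReal ((1 + 3 * ε) * ((r + ε) * b)) := by
    refine (hM.towerSurvival_le hVm p3 (by linarith) hδ₀ hq.hasProductBound p6.1 p6.2 t).trans ?_
    rw [hbE, ENNReal.ofReal_mul (by positivity), ENNReal.ofReal_mul (by positivity)]
    gcongr
    exact p7.le
  have h2 : ENNReal.ofReal ((1 - 3 * ε) * ((r - ε) * b)) ≤ towerSurvival T R μ (V n) t := by
    refine le_trans ?_ (hM.le_towerSurvival p1 p2.le p3 (by positivity) p4 (by linarith) hq p5 t)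
    rw [hbE, ENNReal.ofReal_mul (by linarith), ENNReal.ofReal_mul (by linarith)]
    refine mul_le_mul' (ENNReal.ofReal_le_ofReal ?_) (mul_le_mul' p8.le le_rfl)
    nlinarith [sq_nonneg ε]
  have hne : towerSurvival T R μ (V n) t ≠ ⊤ := ne_top_of_le_ne_top ENNReal.ofReal_ne_top h1
  have h3 := ENNReal.toReal_le_of_le_ofReal (by positivity) h1
  have h4 := (ENNReal.ofReal_le_iff_le_toReal hne).1 h2
  refine ⟨hne, ?_⟩
  have h5 : (1 + 3 * ε) * (r + ε) ≤ r + δ := by nlinarith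
  have h6 : r - δ ≤ (1 - 3 * ε) * (r - ε) := by nlinarith
  have h7 := mul_le_mul_of_nonneg_right h5 hb0
  have h8 := mul_le_mul_of_nonneg_right h6 hb0
  rw [abs_le]
  constructor <;> linarith

/-- The visits during the waiting period have relative weight of order (κ n + q) μ(V n) → 0. A
quarter is reserved for the mixing gap and a quarter for these visits. -/
theorem eventually_half_mul_le_survivors_add (hM : IsMixingTower T 𝒜 R μ C)
    (hV : IsShrinkingHoleSystem T 𝒜 μ V κ α) (hs : IsDecayScale T R μ V κ η) :
    ∀ᶠ n in atTop, ∀ t s, 1 / 2 * (μ.real (survivors T R (V n) 0 t) *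
      μ.real (survivors T R (V n) 0 s)) ≤ μ.real (survivors T R (V n) 0 (t + s)) := by
  have hC := hM.pos
  obtain ⟨q, hq⟩ := hM.mixingGap (1 / 4) (by norm_num)
  have hlim : Tendsto (fun n => (κ n + q : ℕ) * (C * (C * (2 * μ.real (V n)))) * 4) atTop
      (𝓝 0) := by
    have := ((hs.tendsto_mul.add (hV.tendsto_measure.const_mul (q : ℝ))).mul_const
      (C * (C * 2) * 4))
    rw [mul_zero, add_zero, zero_mul] at this
    refine this.congr fun n => ?_
    push_cast
    ring
  filter_upwards [hV.isCylinderSet, hV.one_le, hs.pos, hs.slowDecay,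
    hs.eventually_expMoment_le_two_mul, hs.survivors_le (1 / 2) (by norm_num),
    hlim.eventually (gt_mem_nhds (show (0 : ℝ) < 1 / 4 by norm_num))] with n p1 p2 p3 p4 p5 p6 p7 t s
  have h1 := hM.mul_measureReal_survivors_le_add p1 p2 p3.le p4 (by positivity) p5
    (by norm_num) hq t s
  have ht := p6 t
  have hs' := p6 s
  set bt := μ.real (survivors T R (V n) 0 t)
  set bs := μ.real (survivors T R (V n) 0 s)
  set bt' := μ.real (survivors T R (V n) (κ n) t)
  set bs' := μ.real (survivors T R (V n) (κ n) s)
  have hbt : 0 ≤ bt := measureReal_nonneg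
  have hbs : 0 ≤ bs := measureReal_nonneg
  have hbt' : 0 ≤ bt' := measureReal_nonneg
  have hbs' : 0 ≤ bs' := measureReal_nonneg
  have h2 : bt' * bs' ≤ 4 * (bt * bs) := by
    calc bt' * bs' ≤ (2 * bt) * (2 * bs) := by gcongr <;> linarith
      _ = _ := by ring
  have h3 : (κ n + q : ℕ) * (C * (C * (2 * μ.real (V n))) * (bt' * bs')) ≤ 1 / 4 * (bt * bs) := by
    calc _ = (κ n + q : ℕ) * (C * (C * (2 * μ.real (V n)))) * (bt' * bs') := by ring
      _ ≤ (κ n + q : ℕ) * (C * (C * (2 * μ.real (V n)))) * (4 * (bt * bs)) := by gcongr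
      _ = (κ n + q : ℕ) * (C * (C * (2 * μ.real (V n)))) * 4 * (bt * bs) := by ring
      _ ≤ _ := by gcongr
  linarith

/-- The time K is fixed first, so that the limiting probability of no return up to K is close to α
and the tail of ∑ i^(-p) is small; then n is large, and finally t. The upper bound keeps only the
returns up to K. The lower bound pays for those between K and K + κ + q through the hulls. -/
theorem eventually_abs_hole_inter_survivors_sub_le (hM : IsMixingTower T 𝒜 R μ C)
    (hV : IsShrinkingHoleSystem T 𝒜 μ V κ α) (hs : IsDecayScale T R μ V κ η) {δ : ℝ}
    (hδ : 0 < δ) :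
    ∀ᶠ n in atTop, ∀ᶠ t in atTop, |μ.real (V n ∩ survivors T R (V n) 0 t) -
      α * μ.real (V n) * μ.real (survivors T R (V n) (κ n) t)| ≤
        δ * μ.real (V n) * μ.real (survivors T R (V n) (κ n) t) := by
  have hC := hM.pos
  obtain ⟨a, haK, ha⟩ := hV.extremal
  obtain ⟨C', p, hC', hp, hhull⟩ := hV.exists_hull
  obtain ⟨ε, hε0, hε1, hεδ, hεδ'⟩ : ∃ ε : ℝ, 0 < ε ∧ ε ≤ 1 / 2 ∧
      ε * (20 + 4 * |α|) ≤ δ ∧ ε * (4 + 4 * C ^ 2 * C') ≤ δ := by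
    have hC'0 : 0 < C' := by linarith
    refine ⟨min (1 / 2) (min (δ / (20 + 4 * |α|)) (δ / (4 + 4 * C ^ 2 * C'))), by positivity,
      min_le_left _ _, ?_, ?_⟩
    · rw [← le_div_iff₀ (by positivity)]
      exact (min_le_right _ _).trans (min_le_left _ _)
    · rw [← le_div_iff₀ (by positivity)]
      exact (min_le_right _ _).trans (min_le_right _ _)
  obtain ⟨q, k, δ₀, hδ₀, hq, hηq⟩ := hM.exists_gap_tail hε0
  obtain ⟨K, hKa, hKlim, hKsum⟩ := ((Metric.tendsto_nhds.1 ha ε hε0).and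
    (haK.and (exists_sum_Ioc_rpow_le hp hε0))).exists
  rw [Real.dist_eq] at hKa
  have hquot : ∀ᶠ n in atTop, |μ.real (V n ∩ {x | ∀ j, (1 ≤ j ∧ j ≤ K) → T^[j] x ∉ V n}) -
      α * μ.real (V n)| ≤ 2 * ε * μ.real (V n) := by
    filter_upwards [Metric.tendsto_nhds.1 hKlim ε hε0, hV.measure_pos] with n h1 h2
    rw [Real.dist_eq] at h1
    set v := μ.real (V n)
    set w := μ.real (V n ∩ {x | ∀ j, (1 ≤ j ∧ j ≤ K) → T^[j] x ∉ V n})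
    have h3 : w - α * v = (w / v - α) * v := by field_simp
    have h4 : |w / v - α| ≤ 2 * ε := by
      have := abs_sub_le (w / v) (a K) α
      linarith
    rw [h3, abs_mul, abs_of_pos h2]
    gcongr
  have hκq : ∀ᶠ n in atTop, (κ n + q : ℕ) * μ.real (V n) ≤ ε := by
    have h1 : Tendsto (fun n => (κ n + q : ℕ) * μ.real (V n)) atTop (𝓝 0) := by
      have := hs.tendsto_mul.add (hV.tendsto_measure.const_mul (q : ℝ))
      rw [mul_zero, add_zero] at this
      refine this.congr fun n => ?_
      push_cast
      ring
    exact (h1.eventually (gt_mem_nhds hε0)).mono fun n hn => hn.le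
  filter_upwards [hV.isCylinderSet, hs.pos, hs.slowDecay, hs.eventually_expMoment_le_two_mul,
    hs.survivors_le ε hε0, hs.tendsto_zero.eventually hηq, hs.expMoment_le K ε hε0, hhull, hquot,
    hκq] with n p1 p2 p3 p4 p5 p6 p7 p8 p9 p10
  have hexp : ∀ᶠ t : ℕ in atTop, Real.exp (-(η n * t)) < ε := by
    have h1 : Tendsto (fun t : ℕ => η n * (t : ℝ)) atTop atTop :=
      tendsto_natCast_atTop_atTop.const_mul_atTop p2
    exact (Real.tendsto_exp_neg_atTop_nhds_zero.comp h1).eventually (gt_mem_nhds hε0)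
  filter_upwards [hexp] with t ht
  have hup := hM.measureReal_hole_inter_survivors_le p1 p2.le p3 (by linarith) hδ₀
    hq.hasProductBound p6.1 p6.2 (by linarith) (m := (1 + ε) * μ.real (V n)) (by positivity) p7 t
  have hV0 : 0 ≤ μ.real (V n) := measureReal_nonneg
  have hA := p1.inter_forall_notMem K
  classical
  -- For i < κ n the hull comes from the hypothesis; from κ n on, the hole is itself a union of
  -- i-cylinders.
  have hWex : ∀ i ∈ Finset.Ioc K (K + κ n + q), ∃ W, IsCylinderSet T 𝒜 i W ∧ V n ⊆ W ∧
      μ.real W ≤ C' * (μ.real (V n) + (i : ℝ) ^ (-p)) := by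
    intro i hi
    have hi1 : 1 ≤ i := by have := (Finset.mem_Ioc.1 hi).1; omega
    rcases lt_or_ge i (κ n) with h | h
    · exact p8 i hi1 h
    · refine ⟨V n, p1.mono h, subset_rfl, ?_⟩
      have h1 : 0 ≤ (i : ℝ) ^ (-p) := Real.rpow_nonneg (Nat.cast_nonneg i) _
      nlinarith
  choose! W hWcyl hWV hWle using hWex
  have hlow := hM.le_measureReal_inter_survivors p1 p2.le p3 (by positivity) p4 hq hA
    (fun x hx j h1 h2 => hx.2 j ⟨h1, h2⟩) (W := W)
    (fun i hi => ⟨hWcyl i hi, Set.inter_subset_left.trans (hWV i hi)⟩) t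
  -- The κ n + q copies of μ(V n) have small total because κ n μ(V n) → 0. The powers i^(-p) are
  -- summed over i > K only, which is where p > 1 enters.
  have hWsum : ∑ i ∈ Finset.Ioc K (K + κ n + q), μ.real (W i) ≤ 2 * C' * ε := by
    calc _ ≤ ∑ i ∈ Finset.Ioc K (K + κ n + q), C' * (μ.real (V n) + (i : ℝ) ^ (-p)) :=
          Finset.sum_le_sum hWle
      _ = C' * ((κ n + q : ℕ) * μ.real (V n) +
          ∑ i ∈ Finset.Ioc K (K + κ n + q), (i : ℝ) ^ (-p)) := by
          rw [← Finset.mul_sum, Finset.sum_add_distrib, Finset.sum_const, Nat.card_Ioc,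
            nsmul_eq_mul, show K + κ n + q - K = κ n + q by omega]
      _ ≤ C' * (ε + ε) := by
          gcongr
          exact hKsum _
      _ = _ := by ring
  have hmono : μ.real ((V n ∩ {x | ∀ j, (1 ≤ j ∧ j ≤ K) → T^[j] x ∉ V n}) ∩
      survivors T R (V n) 0 t) ≤ μ.real (V n ∩ survivors T R (V n) 0 t) :=
    measureReal_mono (Set.inter_subset_inter_left _ Set.inter_subset_left)
  have hwv : μ.real (V n ∩ {x | ∀ j, (1 ≤ j ∧ j ≤ K) → T^[j] x ∉ V n}) ≤ μ.real (V n) :=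
    measureReal_mono Set.inter_subset_left
  have hbb := p5 t
  set v := μ.real (V n)
  set w := μ.real (V n ∩ {x | ∀ j, (1 ≤ j ∧ j ≤ K) → T^[j] x ∉ V n})
  set b := μ.real (survivors T R (V n) (κ n) t)
  set b₀ := μ.real (survivors T R (V n) 0 t)
  have hb0 : 0 ≤ b := measureReal_nonneg
  have hw0 : 0 ≤ w := measureReal_nonneg
  obtain ⟨p9l, p9u⟩ := abs_le.1 p9
  have hvb : 0 ≤ v * b := by positivity
  rw [abs_le]
  constructor
  · have e1 : (1 - ε) * (w * ((1 - ε) * b)) ≤ (1 - ε) * (w * b₀) := by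
      have : 0 ≤ 1 - ε := by linarith
      gcongr
    have e2 : C * (C * (2 * v)) * b * ∑ i ∈ Finset.Ioc K (K + κ n + q), μ.real (W i) ≤
        C * (C * (2 * v)) * b * (2 * C' * ε) := by gcongr
    have e3 : w - 2 * ε * v ≤ (1 - ε) * (w * (1 - ε)) := by
      linarith [mul_nonneg hε0.le (sub_nonneg.2 hwv), mul_nonneg (sq_nonneg ε) hw0]
    have e4 := mul_le_mul_of_nonneg_right e3 hb0
    have e5 : (α * v - 2 * ε * v) * b ≤ w * b := by gcongr; linarith
    have e6 := mul_le_mul_of_nonneg_right hεδ' hvb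
    nlinarith
  · have e1 : Real.exp (-(η n * t)) * ((1 + ε) * v) ≤ ε * ((1 + ε) * v) := by gcongr
    have e2 : (1 + 3 * ε) * (w + ((1 + ε) * v - v)) ≤ (1 + 3 * ε) * ((α + 3 * ε) * v) := by
      gcongr
      linarith
    have e3 : (1 + 3 * ε) * (α + 3 * ε) + ε * (1 + ε) ≤ α + δ := by
      have := le_abs_self α
      nlinarith
    have e4 := mul_le_mul_of_nonneg_right e3 hvb
    have e5 : b * ((1 + 3 * ε) * (w + ((1 + ε) * v - v)) +
        Real.exp (-(η n * t)) * ((1 + ε) * v)) ≤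
        b * ((1 + 3 * ε) * ((α + 3 * ε) * v) + ε * ((1 + ε) * v)) := by
      gcongr b * ?_
      exact add_le_add e2 e1
    linarith

end IsMixingTower

/-! ### From one-step ratios to exponential rates -/

theorem exists_tendsto_neg_log_div {b : ℕ → ℝ} (hb : ∀ t, 0 < b t) (hb1 : ∀ t, b t ≤ 1)
    (h : ∀ t s, 1 / 2 * (b t * b s) ≤ b (t + s)) :
    -- Fekete's lemma applies after adding log 2 to -log b, which absorbs the factor 1/2 and
    -- disappears on division by t.
    ∃ ρ, Tendsto (fun t : ℕ => -Real.log (b t) / t) atTop (𝓝 ρ) := by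
  have hsub : Subadditive fun t => Real.log 2 - Real.log (b t) := by
    intro t s
    have h1 := Real.log_le_log (by have := hb t; have := hb s; positivity) (h t s)
    rw [Real.log_mul (by norm_num) (mul_ne_zero (hb t).ne' (hb s).ne'),
      Real.log_mul (hb t).ne' (hb s).ne', one_div, Real.log_inv] at h1
    linarith
  have hbdd : BddBelow (Set.range fun t : ℕ => (Real.log 2 - Real.log (b t)) / t) := by
    refine ⟨0, ?_⟩
    rintro _ ⟨t, rfl⟩
    have h1 := Real.log_nonpos (hb t).le (hb1 t)
    have h2 := Real.log_pos one_lt_two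
    exact div_nonneg (by linarith) (Nat.cast_nonneg t)
  refine ⟨hsub.lim, ?_⟩
  have h1 := (hsub.tendsto_lim hbdd).sub (tendsto_const_div_atTop_nhds_zero_nat (Real.log 2))
  rw [sub_zero] at h1
  refine h1.congr fun t => ?_
  rw [← sub_div]
  ring

theorem tendsto_neg_log_div_of_le_of_le {b B : ℕ → ℝ} {ρ c₁ c₂ : ℝ} (hb : ∀ t, 0 < b t)
    (hc₁ : 0 < c₁) (h₁ : ∀ t, c₁ * b t ≤ B t) (h₂ : ∀ t, B t ≤ c₂ * b t)
    (h : Tendsto (fun t : ℕ => -Real.log (b t) / t) atTop (𝓝 ρ)) :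
    Tendsto (fun t : ℕ => -Real.log (B t) / t) atTop (𝓝 ρ) := by
  have hB : ∀ t, 0 < B t := fun t => (mul_pos hc₁ (hb t)).trans_le (h₁ t)
  have hc₂ : 0 < c₂ := pos_of_mul_pos_left ((hB 0).trans_le (h₂ 0)) (hb 0).le
  have e₁ := h.sub (tendsto_const_div_atTop_nhds_zero_nat (Real.log c₂))
  have e₂ := h.sub (tendsto_const_div_atTop_nhds_zero_nat (Real.log c₁))
  rw [sub_zero] at e₁ e₂
  refine tendsto_of_tendsto_of_tendsto_of_le_of_le e₁ e₂ (fun t => ?_) fun t => ?_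
  · have h3 := Real.log_le_log (hB t) (h₂ t)
    rw [Real.log_mul hc₂.ne' (hb t).ne'] at h3
    change -Real.log (b t) / t - Real.log c₂ / t ≤ -Real.log (B t) / t
    rw [← sub_div]
    exact div_le_div_of_nonneg_right (by linarith) (Nat.cast_nonneg t)
  · have h3 := Real.log_le_log (mul_pos hc₁ (hb t)) (h₁ t)
    rw [Real.log_mul hc₁.ne' (hb t).ne'] at h3
    change -Real.log (B t) / t ≤ -Real.log (b t) / t - Real.log c₁ / t
    rw [← sub_div]
    exact div_le_div_of_nonneg_right (by linarith) (Nat.cast_nonneg t)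

theorem le_of_tendsto_div_of_forall_le_sub {L : ℕ → ℝ} {ρ x : ℝ}
    (hL : Tendsto (fun t : ℕ => L t / t) atTop (𝓝 ρ))
    (h : ∀ᶠ t in atTop, x ≤ L (t + 1) - L t) : x ≤ ρ := by
  obtain ⟨t₀, ht₀⟩ := eventually_atTop.1 h
  have h1 : ∀ t, t₀ ≤ t → L t₀ + (t - t₀) * x ≤ L t := by
    intro t ht
    induction t, ht using Nat.le_induction with
    | base => simp
    | succ t ht ih =>
      have := ht₀ t ht
      push_cast
      linarith
  have h2 : Tendsto (fun t : ℕ => x + (L t₀ - t₀ * x) / t) atTop (𝓝 x) := by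
    simpa using (tendsto_const_div_atTop_nhds_zero_nat (L t₀ - t₀ * x)).const_add x
  refine le_of_tendsto_of_tendsto h2 hL ?_
  filter_upwards [eventually_ge_atTop t₀, eventually_gt_atTop 0] with t h3 h4
  have h5 : (0 : ℝ) < t := Nat.cast_pos.2 h4
  rw [le_div_iff₀ h5, add_mul, div_mul_cancel₀ _ h5.ne']
  linarith [h1 t h3]

/-- The ratio z = B(t+1)/B(t) eventually lies between 1 - (x + d) and 1 - (x - d). The inequalities
1 - 1/z ≤ log z ≤ z - 1 bound the increments of -log B, and averaging them bounds the rate. -/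
theorem rate_mem_Icc_of_forall_abs_sub_le {B : ℕ → ℝ} {ρ x d : ℝ} (hB : ∀ t, 0 < B t)
    (hx : x + d < 1) (hρ : Tendsto (fun t : ℕ => -Real.log (B t) / t) atTop (𝓝 ρ))
    (h : ∀ᶠ t in atTop, |B t - B (t + 1) - x * B t| ≤ d * B t) :
    x - d ≤ ρ ∧ ρ ≤ (x + d) / (1 - (x + d)) := by
  constructor
  · refine le_of_tendsto_div_of_forall_le_sub hρ ?_
    filter_upwards [h] with t ht
    have h1 := Real.log_le_sub_one_of_pos (div_pos (hB (t + 1)) (hB t))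
    rw [Real.log_div (hB _).ne' (hB _).ne'] at h1
    have h2 : B (t + 1) / B t ≤ 1 - (x - d) := by
      rw [div_le_iff₀ (hB t)]
      linarith [(abs_le.1 ht).1]
    linarith
  · have hρ' : Tendsto (fun t : ℕ => Real.log (B t) / t) atTop (𝓝 (-ρ)) := by
      refine hρ.neg.congr fun t => ?_
      rw [neg_div, neg_neg]
    rw [← neg_le_neg_iff]
    refine le_of_tendsto_div_of_forall_le_sub hρ' ?_
    filter_upwards [h] with t ht
    have hz : 0 < 1 - (x + d) := by linarith
    have h1 := Real.one_sub_inv_le_log_of_pos (div_pos (hB (t + 1)) (hB t))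
    rw [Real.log_div (hB _).ne' (hB _).ne'] at h1
    have h2 : 1 - (x + d) ≤ B (t + 1) / B t := by
      rw [le_div_iff₀ (hB t)]
      linarith [(abs_le.1 ht).2]
    have h3 := inv_anti₀ hz h2
    have h4 : (x + d) / (1 - (x + d)) = (1 - (x + d))⁻¹ - 1 := by
      rw [div_eq_mul_inv]
      field_simp
      ring
    linarith

theorem tendsto_of_forall_pos_eventually_mem_Icc {q w : ℕ → ℝ} {α : ℝ}
    (hw : Tendsto w atTop (𝓝 0)) (h : ∀ δ : ℝ, 0 < δ → ∀ᶠ n in atTop,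
      α - δ ≤ q n ∧ q n ≤ (α + δ) / (1 - (α + δ) * w n)) : Tendsto q atTop (𝓝 α) := by
  rw [Metric.tendsto_nhds]
  intro ε hε
  have h1 : Tendsto (fun n => (α + ε / 2) / (1 - (α + ε / 2) * w n)) atTop (𝓝 (α + ε / 2)) := by
    have h2 : Tendsto (fun n => 1 - (α + ε / 2) * w n) atTop (𝓝 1) := by
      simpa using (hw.const_mul (α + ε / 2)).const_sub 1
    have h3 := (tendsto_const_nhds (x := α + ε / 2)).div h2 one_ne_zero
    rw [div_one] at h3
    exact h3
  filter_upwards [h (ε / 2) (half_pos hε),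
    h1.eventually (gt_mem_nhds (show α + ε / 2 < α + ε by linarith))] with n hn hn'
  rw [Real.dist_eq, abs_lt]
  constructor <;> linarith [hn.1, hn.2]

/-! ### Decay rate of tower survival -/

namespace IsMixingTower

variable {X : Type*} [MeasurableSpace X] {T : X → X} {𝒜 : Set (Set X)} {R : X → ℕ+}
  {μ : Measure X} [IsProbabilityMeasure μ] {C : ℝ} {V : ℕ → Set X} {κ : ℕ → ℕ} {α : ℝ}
  {η : ℕ → ℝ}

theorem one_le_toReal_lintegral_returnTime (hM : IsMixingTower T 𝒜 R μ C) :
    1 ≤ (∫⁻ x, ((R x : ℕ) : ENNReal) ∂μ).toReal := by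
  have := ENNReal.toReal_mono hM.lintegral_returnTime_lt_top.ne
    (one_le_lintegral_returnTime (μ := μ) R)
  simpa using this

/-- Tower survival is comparable, up to constants independent of t, to survival in the base, whose
rate exists by near-supermultiplicativity. Positivity comes from slow decay. -/
theorem eventually_towerSurvival_rate (hM : IsMixingTower T 𝒜 R μ C)
    (hV : IsShrinkingHoleSystem T 𝒜 μ V κ α) (hs : IsDecayScale T R μ V κ η) :
    ∀ᶠ n in atTop, (∀ t, 0 < (towerSurvival T R μ (V n) t).toReal) ∧ ∃ ρ, Tendsto
      (fun t : ℕ => -Real.log (towerSurvival T R μ (V n) t).toReal / t) atTop (𝓝 ρ) := by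
  have hr1 := hM.one_le_toReal_lintegral_returnTime
  set r := (∫⁻ x, ((R x : ℕ) : ENNReal) ∂μ).toReal
  filter_upwards [hM.eventually_abs_towerSurvival_sub_le hV hs (δ := 1 / 2) (by norm_num),
    hM.eventually_half_mul_le_survivors_add hV hs, hs.slowDecay,
    hs.survivors_le (1 / 2) (by norm_num)] with n p1 p2 p3 p4
  have hb' : ∀ t, 0 < μ.real (survivors T R (V n) (κ n) t) := fun t =>
    (Real.exp_pos _).trans_le (p3.exp_neg_le t)
  have hb : ∀ t, 0 < μ.real (survivors T R (V n) 0 t) := fun t => by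
    have h1 := p4 t
    have h2 := hb' t
    linarith
  have hle : ∀ t, μ.real (survivors T R (V n) 0 t) ≤ μ.real (survivors T R (V n) (κ n) t) :=
    fun t => measureReal_mono survivors_zero_subset
  have h₁ : ∀ t, 1 / 2 * μ.real (survivors T R (V n) 0 t) ≤
      (towerSurvival T R μ (V n) t).toReal := fun t => by
    have h1 := (abs_le.1 (p1 t).2).1
    have h2 := mul_le_mul_of_nonneg_right hr1 (hb' t).le
    linarith [hle t]
  have h₂ : ∀ t, (towerSurvival T R μ (V n) t).toReal ≤
      2 * (r + 1 / 2) * μ.real (survivors T R (V n) 0 t) := fun t => by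
    have h1 := (abs_le.1 (p1 t).2).2
    have h2 := mul_le_mul_of_nonneg_left (p4 t) (show 0 ≤ 2 * (r + 1 / 2) by linarith)
    linarith
  obtain ⟨ρ, hρ⟩ := exists_tendsto_neg_log_div hb (fun t => measureReal_le_one) p2
  exact ⟨fun t => (mul_pos one_half_pos (hb t)).trans_le (h₁ t), ρ,
    tendsto_neg_log_div_of_le_of_le hb one_half_pos h₁ h₂ hρ⟩

/-- Combines the exact identity for one time step with the two asymptotics; the survivor measure of
the base is eliminated between them. -/
theorem eventually_abs_towerSurvival_sub_succ_le (hM : IsMixingTower T 𝒜 R μ C)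
    (hV : IsShrinkingHoleSystem T 𝒜 μ V κ α) (hs : IsDecayScale T R μ V κ η) {δ : ℝ}
    (hδ : 0 < δ) :
    ∀ᶠ n in atTop, ∀ᶠ t in atTop, |(towerSurvival T R μ (V n) t).toReal -
      (towerSurvival T R μ (V n) (t + 1)).toReal -
        α * (μ.real (V n) / (∫⁻ x, ((R x : ℕ) : ENNReal) ∂μ).toReal) *
          (towerSurvival T R μ (V n) t).toReal| ≤
        δ * (μ.real (V n) / (∫⁻ x, ((R x : ℕ) : ENNReal) ∂μ).toReal) *
          (towerSurvival T R μ (V n) t).toReal := by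
  have hr1 := hM.one_le_toReal_lintegral_returnTime
  set r := (∫⁻ x, ((R x : ℕ) : ENNReal) ∂μ).toReal
  obtain ⟨ε, hε0, hε1, hεδ⟩ : ∃ ε : ℝ, 0 < ε ∧ ε ≤ 1 / 2 ∧ ε * (2 * (r + |α|)) ≤ δ := by
    have : 0 < 2 * (r + |α|) := by positivity
    refine ⟨min (1 / 2) (δ / (2 * (r + |α|))), by positivity, min_le_left _ _, ?_⟩
    rw [← le_div_iff₀ this]
    exact min_le_right _ _
  filter_upwards [hM.eventually_abs_towerSurvival_sub_le hV hs hε0,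
    hM.eventually_abs_hole_inter_survivors_sub_le hV hs hε0, hV.isCylinderSet] with n p1 p2 p3
  filter_upwards [p2] with t p2
  have h1 := congrArg ENNReal.toReal (hM.towerSurvival_eq_add (hM.measurableSet _ _ p3) t)
  rw [ENNReal.toReal_add (p1 (t + 1)).1 (measure_ne_top _ _)] at h1
  have h2 : (towerSurvival T R μ (V n) t).toReal - (towerSurvival T R μ (V n) (t + 1)).toReal =
      μ.real (V n ∩ survivors T R (V n) 0 t) := by
    rw [h1, Measure.real]
    ring
  rw [h2]
  have p1 := (p1 t).2
  have hv : 0 ≤ μ.real (V n) := measureReal_nonneg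
  have hb : 0 ≤ μ.real (survivors T R (V n) (κ n) t) := measureReal_nonneg
  generalize μ.real (survivors T R (V n) (κ n) t) = b at *
  generalize (towerSurvival T R μ (V n) t).toReal = B at *
  generalize μ.real (V n ∩ survivors T R (V n) 0 t) = y at *
  obtain ⟨w, hw, hw0⟩ : ∃ w, w = μ.real (V n) / r ∧ 0 ≤ w := ⟨_, rfl, by positivity⟩
  have hvw : μ.real (V n) = r * w := by rw [hw]; field_simp
  rw [← hw]
  rw [hvw] at p2
  have h3 : |y - α * w * B| ≤ ε * (r * w) * b + |α| * w * (ε * b) := by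
    calc |y - α * w * B| = |(y - α * (r * w) * b) - α * w * (B - r * b)| := by ring_nf
      _ ≤ |y - α * (r * w) * b| + |α * w * (B - r * b)| := abs_sub _ _
      _ ≤ _ := by
        rw [abs_mul, abs_mul, abs_of_nonneg hw0]
        gcongr
  have h4 : b ≤ 2 * B := by
    have := mul_le_mul_of_nonneg_right hr1 hb
    have := mul_le_mul_of_nonneg_right hε1 hb
    linarith [(abs_le.1 p1).1]
  have hB : 0 ≤ B := by linarith
  calc |y - α * w * B| ≤ ε * (r + |α|) * w * b := by linarith
    _ ≤ ε * (r + |α|) * w * (2 * B) := by gcongr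
    _ = ε * (2 * (r + |α|)) * w * B := by ring
    _ ≤ δ * w * B := by gcongr

theorem exists_towerSurvival_rates (hM : IsMixingTower T 𝒜 R μ C)
    (hV : IsShrinkingHoleSystem T 𝒜 μ V κ α) :
    ∃ ρ : ℕ → ℝ, (∀ᶠ n in atTop, (∀ t, 0 < (towerSurvival T R μ (V n) t).toReal) ∧ Tendsto
      (fun t : ℕ => -Real.log (towerSurvival T R μ (V n) t).toReal / t) atTop (𝓝 (ρ n))) ∧
      Tendsto (fun n => ρ n / (μ.real (V n) / (∫⁻ x, ((R x : ℕ) : ENNReal) ∂μ).toReal)) atTop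
        (𝓝 α) := by
  obtain ⟨η, hs⟩ := hM.exists_decay_scale hV
  have hr1 := hM.one_le_toReal_lintegral_returnTime
  have hrate := hM.eventually_towerSurvival_rate hV hs
  have hstep := fun δ (hδ : (0 : ℝ) < δ) => hM.eventually_abs_towerSurvival_sub_succ_le hV hs hδ
  set r := (∫⁻ x, ((R x : ℕ) : ENNReal) ∂μ).toReal
  set B := fun n t => (towerSurvival T R μ (V n) t).toReal
  obtain ⟨ρ, hρ⟩ : ∃ ρ : ℕ → ℝ, ∀ᶠ n in atTop, (∀ t, 0 < B n t) ∧ Tendsto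
      (fun t : ℕ => -Real.log (B n t) / t) atTop (𝓝 (ρ n)) := by
    have h1 : ∀ n, ∃ ρ, ((∀ t, 0 < B n t) ∧ ∃ ρ, Tendsto
        (fun t : ℕ => -Real.log (B n t) / t) atTop (𝓝 ρ)) → (∀ t, 0 < B n t) ∧ Tendsto
        (fun t : ℕ => -Real.log (B n t) / t) atTop (𝓝 ρ) := fun n => by
      by_cases h : (∀ t, 0 < B n t) ∧ ∃ ρ, Tendsto
        (fun t : ℕ => -Real.log (B n t) / t) atTop (𝓝 ρ)
      · obtain ⟨h1, ρ, h2⟩ := h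
        exact ⟨ρ, fun _ => ⟨h1, h2⟩⟩
      · exact ⟨0, fun h' => absurd h' h⟩
    choose ρ hρ using h1
    exact ⟨ρ, hrate.mono fun n hn => hρ n hn⟩
  refine ⟨ρ, hρ, ?_⟩
  have hw : Tendsto (fun n => μ.real (V n) / r) atTop (𝓝 0) := by
    simpa using hV.tendsto_measure.div_const r
  refine tendsto_of_forall_pos_eventually_mem_Icc hw fun δ hδ => ?_
  have hsmall : ∀ᶠ n in atTop, (α + δ) * (μ.real (V n) / r) < 1 := by
    have := hw.const_mul (α + δ)
    rw [mul_zero] at this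
    exact this.eventually (gt_mem_nhds one_pos)
  filter_upwards [hρ, hstep δ hδ, hsmall, hV.measure_pos] with n h1 h2 h3 h4
  have hwpos : 0 < μ.real (V n) / r := div_pos h4 (by linarith)
  obtain ⟨h5, h6⟩ := rate_mem_Icc_of_forall_abs_sub_le h1.1 (by linarith) h1.2 h2
  rw [le_div_iff₀ hwpos, div_le_iff₀ hwpos]
  refine ⟨by linarith, h6.trans_eq ?_⟩
  rw [← add_mul, div_mul_eq_mul_div]

end IsMixingTower

/-! ### Entry times and escape rates of general systems -/

theorem lt_entryTime_iff {X : Type*} {T : X → X} {U : Set X} {x : X} {t : ℕ} :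
    (t : ℕ∞) < entryTime T U x ↔ ∀ j, 1 ≤ j → j ≤ t → T^[j] x ∉ U := by
  constructor
  · intro h j hj hjt hjU
    have h1 : entryTime T U x ≤ j := iInf₂_le j ⟨hj, hjU⟩
    exact absurd (h.trans_le h1) (not_lt.2 (Nat.cast_le.2 hjt))
  · intro h
    refine lt_of_lt_of_le (Nat.cast_lt.2 t.lt_succ_self) (le_iInf₂ fun j hj => ?_)
    rw [Nat.cast_le]
    by_contra hjt
    exact h j hj.1 (by omega) hj.2

theorem entryTime_anti {X : Type*} {T : X → X} {U V : Set X} (h : U ⊆ V) (x : X) :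
    entryTime T V x ≤ entryTime T U x :=
  le_iInf₂ fun j hj => iInf₂_le j ⟨hj.1, h hj.2⟩

section EscapeExponent

variable {X : Type*} [MeasurableSpace X] {T : X → X} {μ : Measure X} {U V : Set X}

theorem escapeExponent_mono (h : U ⊆ V) (t : ℕ) :
    escapeExponent T μ U t ≤ escapeExponent T μ V t := by
  refine EReal.div_le_div_right_of_nonneg (by positivity) ?_
  rw [EReal.neg_le_neg_iff]
  exact ENNReal.log_monotone (measure_mono fun x hx => lt_of_lt_of_le hx (entryTime_anti h x))

theorem lowerEscapeRate_mono (h : U ⊆ V) : lowerEscapeRate T μ U ≤ lowerEscapeRate T μ V :=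
  liminf_le_liminf (Eventually.of_forall fun t => escapeExponent_mono h t)

theorem upperEscapeRate_mono (h : U ⊆ V) : upperEscapeRate T μ U ≤ upperEscapeRate T μ V :=
  limsup_le_limsup (Eventually.of_forall fun t => escapeExponent_mono h t)

theorem lowerEscapeRate_le_upperEscapeRate : lowerEscapeRate T μ U ≤ upperEscapeRate T μ U :=
  liminf_le_limsup

theorem HasEscapeRate.lowerEscapeRate_eq {r : EReal} (h : HasEscapeRate T μ U r) :
    lowerEscapeRate T μ U = r := Tendsto.liminf_eq h

theorem HasEscapeRate.upperEscapeRate_eq {r : EReal} (h : HasEscapeRate T μ U r) :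
    upperEscapeRate T μ U = r := Tendsto.limsup_eq h

theorem hasEscapeRate_of_tendsto {ρ : ℝ}
    (hpos : ∀ t : ℕ, 0 < μ.real {x | (t : ℕ∞) < entryTime T U x})
    (h : Tendsto (fun t : ℕ => -Real.log (μ.real {x | (t : ℕ∞) < entryTime T U x}) / t) atTop
      (𝓝 ρ)) : HasEscapeRate T μ U ρ := by
  refine (EReal.tendsto_coe.2 h).congr fun t => ?_
  rw [escapeExponent, ENNReal.log_pos_real' (hpos t), EReal.coe_div, EReal.coe_neg,
    EReal.coe_natCast]
  rfl

end EscapeExponent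

/-! ### The measure on the tower -/

section Tower

variable {X : Type*} {T : X → X} {R : X → ℕ+} {U : Set X}

/-- Time is counted from the last passage through the base below p: after t steps the total p.1.2 +
t consists of j complete columns and the current height i. -/
theorem exists_towerMap_iterate_eq (p : Tower R) (t : ℕ) :
    ∃ j i, p.1.2 + t = returnSum T R j p.1.1 + i ∧ ((towerMap T R)^[t] p).1 = (T^[j] p.1.1, i) := by
  induction t with
  | zero => exact ⟨0, p.1.2, by simp [returnSum], rfl⟩
  | succ t ih =>
    obtain ⟨j, i, h1, h2⟩ := ih
    rw [Function.iterate_succ_apply']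
    have hi := ((towerMap T R)^[t] p).2
    generalize (towerMap T R)^[t] p = q at *
    obtain ⟨q, hq⟩ := q
    subst h2
    by_cases h : i + 1 < (R (T^[j] p.1.1) : ℕ)
    · refine ⟨j, i + 1, by omega, ?_⟩
      simp only [towerMap, dif_pos h]
    · refine ⟨j + 1, 0, ?_, ?_⟩
      · rw [returnSum_add, returnSum_one]
        simp only at hi
        omega
      · simp only [towerMap, dif_neg h]
        rw [Function.iterate_succ_apply']

theorem towerMap_iterate_mem_baseFloor_iff (p : Tower R) (t : ℕ) :
    (towerMap T R)^[t] p ∈ baseFloor R U ↔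
      ∃ j, returnSum T R j p.1.1 = p.1.2 + t ∧ T^[j] p.1.1 ∈ U := by
  obtain ⟨j, i, h1, h2⟩ := exists_towerMap_iterate_eq (T := T) p t
  have hi := ((towerMap T R)^[t] p).2
  rw [h2] at hi
  change (((towerMap T R)^[t] p).1.2 = 0 ∧ ((towerMap T R)^[t] p).1.1 ∈ U) ↔ _
  rw [h2]
  constructor
  · rintro ⟨h3, h4⟩
    simp only at h3
    exact ⟨j, by omega, h4⟩
  · rintro ⟨j', h3, h4⟩
    have h5 : returnSum T R (j + 1) p.1.1 = returnSum T R j p.1.1 + R (T^[j] p.1.1) := by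
      rw [returnSum_add, returnSum_one]
    have hmono := returnSum_strictMono (T := T) (R := R) p.1.1
    have h6 : j' = j := by
      rcases lt_trichotomy j' j with h | h | h
      · have := hmono h
        simp only at this
        omega
      · exact h
      · have := hmono.monotone (Nat.succ_le_of_lt h)
        simp only [Nat.succ_eq_add_one] at this
        simp only at hi
        omega
    subst h6
    exact ⟨by simp only; omega, h4⟩

theorem lt_entryTime_towerMap_iff (p : Tower R) (t : ℕ) :
    (t : ℕ∞) < entryTime (towerMap T R) (baseFloor R U) p ↔
      p.1.1 ∈ survivors T R U 0 (t + p.1.2) := by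
  rw [lt_entryTime_iff]
  constructor
  · intro h j hj hjt hjU
    -- The starting height is below the first return time, so every return j ≥ 1 happens at least
    -- one step after the start.
    have h1 : returnSum T R 1 p.1.1 ≤ returnSum T R j p.1.1 := returnSum_mono hj _
    rw [returnSum_one] at h1
    have h2 := p.2
    refine h (returnSum T R j p.1.1 - p.1.2) (by omega) ?_
      ((towerMap_iterate_mem_baseFloor_iff p _).2 ⟨j, by omega, hjU⟩)
    have : returnSum T R (j + 0) p.1.1 = returnSum T R j p.1.1 := rfl
    omega
  · intro h s hs hst hsU
    obtain ⟨j, h1, h2⟩ := (towerMap_iterate_mem_baseFloor_iff p _).1 hsU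
    refine h j (Nat.one_le_iff_ne_zero.2 ?_) (by rw [add_zero]; omega) h2
    rintro rfl
    rw [returnSum_zero] at h1
    omega

end Tower

theorem measurableSet_prod_nat {X : Type*} [MeasurableSpace X] {B : Set (X × ℕ)}
    (h : ∀ k, MeasurableSet {x | (x, k) ∈ B}) : MeasurableSet B := by
  have : B = ⋃ k, {x | (x, k) ∈ B} ×ˢ {k} := by
    ext ⟨x, k⟩
    simp
  rw [this]
  exact MeasurableSet.iUnion fun k => (h k).prod (measurableSet_singleton k)

theorem towerMeasure_preimage {X : Type*} [MeasurableSpace X] {R : X → ℕ+} {μ : Measure X}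
    [SFinite μ] (hR : ∀ k : ℕ, MeasurableSet {x | k < (R x : ℕ)}) {B : Set (X × ℕ)}
    (hB : MeasurableSet B) :
    towerMeasure R μ (Subtype.val ⁻¹' B) = (∫⁻ x, ((R x : ℕ) : ENNReal) ∂μ)⁻¹ *
      ∑' k : ℕ, μ {x | k < (R x : ℕ) ∧ (x, k) ∈ B} := by
  have hT : MeasurableSet {p : X × ℕ | p.2 < (R p.1 : ℕ)} := measurableSet_prod_nat hR
  have h1 : Measure.comap (Subtype.val : Tower R → X × ℕ) (μ.prod Measure.count)
      (Subtype.val ⁻¹' B) = ∑' k : ℕ, μ {x | k < (R x : ℕ) ∧ (x, k) ∈ B} := by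
    refine ((MeasurableEmbedding.subtype_coe hT).comap_apply _ _).trans ?_
    refine (congrArg _ (Subtype.image_preimage_coe {p : X × ℕ | p.2 < (R p.1 : ℕ)} B)).trans ?_
    rw [Measure.prod_apply_symm (hT.inter hB), lintegral_count]
    rfl
  rw [← h1]
  rfl

theorem ae_towerMeasure_of_ae {X : Type*} [MeasurableSpace X] {R : X → ℕ+} {μ : Measure X}
    [SFinite μ] (hR : ∀ k : ℕ, MeasurableSet {x | k < (R x : ℕ)}) {P : X → Prop}
    (h : ∀ᵐ x ∂μ, P x) : ∀ᵐ p ∂towerMeasure R μ, P p.1.1 := by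
  have h0 : μ (toMeasurable μ {x | ¬P x}) = 0 := by
    rw [measure_toMeasurable]
    exact h
  have h1 : MeasurableSet (Prod.fst ⁻¹' toMeasurable μ {x | ¬P x} : Set (X × ℕ)) :=
    measurable_fst (measurableSet_toMeasurable _ _)
  refine measure_mono_null (t := Subtype.val ⁻¹' (Prod.fst ⁻¹' toMeasurable μ {x | ¬P x}))
    (fun p hp => subset_toMeasurable μ {x | ¬P x} hp) ?_
  rw [towerMeasure_preimage hR h1]
  have h2 : ∀ k : ℕ, μ {x | k < (R x : ℕ) ∧
      (x, k) ∈ (Prod.fst ⁻¹' toMeasurable μ {x | ¬P x} : Set (X × ℕ))} = 0 := fun k =>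
    measure_mono_null (fun x hx => hx.2) h0
  simp only [h2, tsum_zero, mul_zero]

namespace IsMixingTower

variable {X : Type*} [MeasurableSpace X] {T : X → X} {𝒜 : Set (Set X)} {R : X → ℕ+}
  {μ : Measure X} [IsProbabilityMeasure μ] {C : ℝ} {U : Set X}

theorem towerMeasure_lt_entryTime (hM : IsMixingTower T 𝒜 R μ C) (hU : MeasurableSet U) (t : ℕ) :
    towerMeasure R μ {p | (t : ℕ∞) < entryTime (towerMap T R) (baseFloor R U) p} =
      (∫⁻ x, ((R x : ℕ) : ENNReal) ∂μ)⁻¹ * towerSurvival T R μ U t := by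
  have h1 : {p | (t : ℕ∞) < entryTime (towerMap T R) (baseFloor R U) p} =
      Subtype.val ⁻¹' {p : X × ℕ | p.1 ∈ survivors T R U 0 (t + p.2)} :=
    Set.ext fun p => lt_entryTime_towerMap_iff p t
  have h2 : MeasurableSet {p : X × ℕ | p.1 ∈ survivors T R U 0 (t + p.2)} :=
    measurableSet_prod_nat fun k => hM.measurableSet_survivors hU 0 (t + k)
  rw [h1, towerMeasure_preimage (fun k => hM.measurableSet_returnTime (k < ·)) h2]
  rfl

theorem towerMeasure_baseFloor (hM : IsMixingTower T 𝒜 R μ C) (hU : MeasurableSet U) :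
    towerMeasure R μ (baseFloor R U) = (∫⁻ x, ((R x : ℕ) : ENNReal) ∂μ)⁻¹ * μ U := by
  have h1 : (baseFloor R U) = Subtype.val ⁻¹' {p : X × ℕ | p.2 = 0 ∧ p.1 ∈ U} := rfl
  have h2 : MeasurableSet {p : X × ℕ | p.2 = 0 ∧ p.1 ∈ U} :=
    measurableSet_prod_nat fun k => (MeasurableSet.const (k = 0)).inter hU
  rw [h1, towerMeasure_preimage (fun k => hM.measurableSet_returnTime (k < ·)) h2,
    tsum_eq_single 0 fun k hk => ?_]
  · congr 2
    ext x
    simp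
  · refine measure_mono_null (t := ∅) (fun x hx => hk hx.2.1) measure_empty

theorem coe_towerMeasure_baseFloor (hM : IsMixingTower T 𝒜 R μ C) (hU : MeasurableSet U) :
    (towerMeasure R μ (baseFloor R U) : EReal) =
      ((μ.real U / (∫⁻ x, ((R x : ℕ) : ENNReal) ∂μ).toReal : ℝ) : EReal) := by
  have hr := one_le_lintegral_returnTime (μ := μ) R
  rw [hM.towerMeasure_baseFloor hU, ← EReal.coe_ennreal_toReal, ENNReal.toReal_mul,
    ENNReal.toReal_inv, Measure.real, div_eq_inv_mul]
  exact ENNReal.mul_ne_top (ENNReal.inv_ne_top.2 (one_pos.trans_le hr).ne') (measure_ne_top _ _)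

theorem exists_hasEscapeRate (hM : IsMixingTower T 𝒜 R μ C) {V : ℕ → Set X} {κ : ℕ → ℕ} {α : ℝ}
    (hV : IsShrinkingHoleSystem T 𝒜 μ V κ α) :
    ∃ ρ : ℕ → ℝ, (∀ᶠ n in atTop,
      HasEscapeRate (towerMap T R) (towerMeasure R μ) (baseFloor R (V n)) (ρ n)) ∧
      Tendsto (fun n => ρ n / (μ.real (V n) / (∫⁻ x, ((R x : ℕ) : ENNReal) ∂μ).toReal)) atTop
        (𝓝 α) := by
  obtain ⟨ρ, h1, h2⟩ := hM.exists_towerSurvival_rates hV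
  refine ⟨ρ, ?_, h2⟩
  have hr := hM.one_le_toReal_lintegral_returnTime
  filter_upwards [h1, hV.isCylinderSet] with n hn hc
  have h3 : ∀ t : ℕ, (towerMeasure R μ).real
      {p | (t : ℕ∞) < entryTime (towerMap T R) (baseFloor R (V n)) p} =
      (∫⁻ x, ((R x : ℕ) : ENNReal) ∂μ).toReal⁻¹ * (towerSurvival T R μ (V n) t).toReal := fun t => by
    rw [Measure.real, hM.towerMeasure_lt_entryTime (hM.measurableSet _ _ hc), ENNReal.toReal_mul,
      ENNReal.toReal_inv]
  have hr' : 0 < (∫⁻ x, ((R x : ℕ) : ENNReal) ∂μ).toReal⁻¹ := by positivity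
  refine hasEscapeRate_of_tendsto (fun t => ?_) ?_
  · rw [h3]
    exact mul_pos hr' (hn.1 t)
  · exact tendsto_neg_log_div_of_le_of_le hn.1 hr' (fun t => (h3 t).ge) (fun t => (h3 t).le) hn.2

end IsMixingTower

/-! ### Systems modelled by a tower -/

section TowerProj

variable {X M : Type*} {f : M → M} {ι : X → M} {T : X → X} {R : X → ℕ+} {U : Set X}

theorem towerProj_towerMap (hret : ∀ x, f^[(R x : ℕ)] (ι x) = ι (T x)) (p : Tower R) :
    towerProj f ι R (towerMap T R p) = f (towerProj f ι R p) := by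
  obtain ⟨⟨x, k⟩, hk⟩ := p
  by_cases h : k + 1 < (R x : ℕ)
  · simp only [towerMap, dif_pos h, towerProj, Function.iterate_succ_apply']
  · simp only [towerMap, dif_neg h, towerProj, Function.iterate_zero, id]
    simp only at hk
    rw [← Function.iterate_succ_apply' f, ← hret, show k.succ = (R x : ℕ) by omega]

theorem towerProj_iterate (hret : ∀ x, f^[(R x : ℕ)] (ι x) = ι (T x)) (p : Tower R) (t : ℕ) :
    towerProj f ι R ((towerMap T R)^[t] p) = f^[t] (towerProj f ι R p) := by
  induction t with
  | zero => rfl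
  | succ t ih =>
    rw [Function.iterate_succ_apply', Function.iterate_succ_apply', towerProj_towerMap hret, ih]

theorem towerProj_mem_image_iff (hι : Function.Injective ι) {p : Tower R}
    (hp : ∀ k : ℕ, 0 < k → k < (R p.1.1 : ℕ) → f^[k] (ι p.1.1) ∉ ι '' U) :
    towerProj f ι R p ∈ ι '' U ↔ p ∈ baseFloor R U := by
  obtain ⟨⟨x, k⟩, hk⟩ := p
  rcases Nat.eq_zero_or_pos k with rfl | h
  · change ι x ∈ ι '' U ↔ 0 = 0 ∧ x ∈ U
    rw [hι.mem_set_image]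
    simp
  · exact ⟨fun h' => absurd h' (hp k h hk), fun h' => absurd h'.1 h.ne'⟩

variable [MeasurableSpace X] {μ : Measure X}

/-- Since T preserves μ, almost every base point has no early entry in any of the columns along its
T-orbit. The projected orbit then meets the embedded set only when the tower orbit is in the base.
-/
theorem ae_forall_towerProj_iterate_mem_image_iff [SFinite μ]
    (hR : ∀ k : ℕ, MeasurableSet {x | k < (R x : ℕ)}) (hT : MeasurePreserving T μ μ)
    (hι : Function.Injective ι) (hret : ∀ x, f^[(R x : ℕ)] (ι x) = ι (T x))
    (hU : ∀ᵐ x ∂μ, ∀ k : ℕ, 0 < k → k < (R x : ℕ) → f^[k] (ι x) ∉ ι '' U) :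
    ∀ᵐ p ∂towerMeasure R μ, ∀ t,
      f^[t] (towerProj f ι R p) ∈ ι '' U ↔ (towerMap T R)^[t] p ∈ baseFloor R U := by
  have h1 : ∀ᵐ x ∂μ, ∀ j, ∀ k : ℕ, 0 < k → k < (R (T^[j] x) : ℕ) →
      f^[k] (ι (T^[j] x)) ∉ ι '' U :=
    ae_all_iff.2 fun j => (hT.iterate j).quasiMeasurePreserving.ae hU
  filter_upwards [ae_towerMeasure_of_ae hR h1] with p hp t
  rw [← towerProj_iterate hret]
  obtain ⟨j, i, -, h2⟩ := exists_towerMap_iterate_eq (T := T) p t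
  refine towerProj_mem_image_iff hι ?_
  rw [h2]
  exact hp j

variable [MeasurableSpace M]

theorem measurable_towerProj (hf : Measurable f) (hι : Measurable ι) :
    Measurable (towerProj f ι R) := by
  have h : Measurable fun p : X × ℕ => f^[p.2] (ι p.1) :=
    measurable_from_prod_countable_left fun k => (hf.iterate k).comp hι
  exact h.comp measurable_subtype_coe

theorem escapeExponent_map_towerProj [SFinite μ]
    (hR : ∀ k : ℕ, MeasurableSet {x | k < (R x : ℕ)}) (hT : MeasurePreserving T μ μ)
    (hf : Measurable f) (hι : MeasurableEmbedding ι)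
    (hret : ∀ x, f^[(R x : ℕ)] (ι x) = ι (T x)) (hUm : MeasurableSet U)
    (hU : ∀ᵐ x ∂μ, ∀ k : ℕ, 0 < k → k < (R x : ℕ) → f^[k] (ι x) ∉ ι '' U) :
    escapeExponent f ((towerMeasure R μ).map (towerProj f ι R)) (ι '' U) =
      escapeExponent (towerMap T R) (towerMeasure R μ) (baseFloor R U) := by
  funext t
  have hset : {x | (t : ℕ∞) < entryTime f (ι '' U) x} =
      ⋂ j ∈ Set.Icc 1 t, f^[j] ⁻¹' (ι '' U)ᶜ := by
    ext x
    simp only [Set.mem_ofPred_eq, lt_entryTime_iff, Set.mem_iInter, Set.mem_Icc, Set.mem_preimage,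
      Set.mem_compl_iff, and_imp]
  have hm : MeasurableSet {x | (t : ℕ∞) < entryTime f (ι '' U) x} := by
    rw [hset]
    exact MeasurableSet.biInter (Set.to_countable _) fun j _ =>
      hf.iterate j (hι.measurableSet_image.2 hUm).compl
  rw [escapeExponent, escapeExponent, Measure.map_apply (measurable_towerProj hf hι.measurable) hm]
  have h2 : towerMeasure R μ (towerProj f ι R ⁻¹' {x | (t : ℕ∞) < entryTime f (ι '' U) x}) =
      towerMeasure R μ {p | (t : ℕ∞) < entryTime (towerMap T R) (baseFloor R U) p} := by
    refine measure_congr ?_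
    filter_upwards [ae_forall_towerProj_iterate_mem_image_iff hR hT hι.injective hret hU] with p hp
    refine propext ?_
    change (t : ℕ∞) < entryTime f (ι '' U) (towerProj f ι R p) ↔
      (t : ℕ∞) < entryTime (towerMap T R) (baseFloor R U) p
    simp only [lt_entryTime_iff, hp]
  rw [h2]

theorem map_towerProj_image [SFinite μ]
    (hR : ∀ k : ℕ, MeasurableSet {x | k < (R x : ℕ)}) (hT : MeasurePreserving T μ μ)
    (hf : Measurable f) (hι : MeasurableEmbedding ι)
    (hret : ∀ x, f^[(R x : ℕ)] (ι x) = ι (T x)) (hUm : MeasurableSet U)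
    (hU : ∀ᵐ x ∂μ, ∀ k : ℕ, 0 < k → k < (R x : ℕ) → f^[k] (ι x) ∉ ι '' U) :
    (towerMeasure R μ).map (towerProj f ι R) (ι '' U) = towerMeasure R μ (baseFloor R U) := by
  rw [Measure.map_apply (measurable_towerProj hf hι.measurable) (hι.measurableSet_image.2 hUm)]
  refine measure_congr ?_
  filter_upwards [ae_forall_towerProj_iterate_mem_image_iff hR hT hι.injective hret hU] with p hp
  exact propext (hp 0)

end TowerProj

section Transfer

variable {X M : Type*} [MeasurableSpace X] [MeasurableSpace M] {f : M → M} {ι : X → M}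
  {T : X → X} {𝒜 : Set (Set X)} {R : X → ℕ+} {μ : Measure X} [IsProbabilityMeasure μ] {C : ℝ}
  {U : ℕ → Set X} {α : ℝ}

theorem IsModelledByTower.hasLocalizedEscapeRate (hf : Measurable f)
    (h : IsModelledByTower f ι T R μ U) (hM : IsMixingTower T 𝒜 R μ C)
    (hU : ∀ n, MeasurableSet (U n))
    (hα : HasLocalizedEscapeRate (towerMap T R) (towerMeasure R μ)
      (fun n => baseFloor R (U n)) α) :
    HasLocalizedEscapeRate f ((towerMeasure R μ).map (towerProj f ι R)) (fun n => ι '' U n) α := by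
  have hR := fun k => hM.measurableSet_returnTime (k < ·)
  simp only [HasLocalizedEscapeRate, HasEscapeRate, fun n => escapeExponent_map_towerProj hR
    hM.measurePreserving hf h.measurableEmbedding h.return_eq (hU n) (h.no_early_entry n),
    fun n => map_towerProj_image hR hM.measurePreserving hf h.measurableEmbedding h.return_eq (hU n)
    (h.no_early_entry n)]
  exact hα

theorem IsModelledByTower.hasLocalizedLowerUpperEscapeRate (hf : Measurable f)
    (h : IsModelledByTower f ι T R μ U) (hM : IsMixingTower T 𝒜 R μ C)
    (hU : ∀ n, MeasurableSet (U n))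
    (hα : HasLocalizedLowerUpperEscapeRate (towerMap T R) (towerMeasure R μ)
      (fun n => baseFloor R (U n)) α) :
    HasLocalizedLowerUpperEscapeRate f ((towerMeasure R μ).map (towerProj f ι R))
      (fun n => ι '' U n) α := by
  have hR := fun k => hM.measurableSet_returnTime (k < ·)
  simp only [HasLocalizedLowerUpperEscapeRate, lowerEscapeRate, upperEscapeRate,
    fun n => escapeExponent_map_towerProj hR
    hM.measurePreserving hf h.measurableEmbedding h.return_eq (hU n) (h.no_early_entry n),
    fun n => map_towerProj_image hR hM.measurePreserving hf h.measurableEmbedding h.return_eq (hU n)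
    (h.no_early_entry n)]
  exact hα

end Transfer

/-! ### Localized escape rates of towers -/

namespace IsMixingTower

variable {X : Type*} [MeasurableSpace X] {T : X → X} {𝒜 : Set (Set X)} {R : X → ℕ+}
  {μ : Measure X} [IsProbabilityMeasure μ] {C : ℝ} {κ : ℕ → ℕ} {α : ℝ}

theorem hasLocalizedEscapeRate (hM : IsMixingTower T 𝒜 R μ C) {V : ℕ → Set X}
    (hV : IsShrinkingHoleSystem T 𝒜 μ V κ α) :
    HasLocalizedEscapeRate (towerMap T R) (towerMeasure R μ) (fun n => baseFloor R (V n)) α := by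
  obtain ⟨ρ, h1, h2⟩ := hM.exists_hasEscapeRate hV
  refine ⟨fun n => ρ n, h1, (EReal.tendsto_coe.2 h2).congr' ?_⟩
  filter_upwards [hV.isCylinderSet] with n hn
  rw [hM.coe_towerMeasure_baseFloor (hM.measurableSet _ _ hn), EReal.coe_div]

/-- Escape rates increase with the hole, so both rates of U n lie between the rates of V n and W n.
Dividing by the measure of U n instead costs a factor that tends to 1. -/
theorem hasLocalizedLowerUpperEscapeRate (hM : IsMixingTower T 𝒜 R μ C) {U V W : ℕ → Set X}
    (hV : IsShrinkingHoleSystem T 𝒜 μ V κ α) (hW : IsShrinkingHoleSystem T 𝒜 μ W κ α)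
    (hU : ∀ n, MeasurableSet (U n)) (hVU : ∀ n, V n ⊆ U n) (hUW : ∀ n, U n ⊆ W n)
    (hVm : Tendsto (fun n => μ.real (V n) / μ.real (U n)) atTop (𝓝 1))
    (hWm : Tendsto (fun n => μ.real (W n) / μ.real (U n)) atTop (𝓝 1)) :
    HasLocalizedLowerUpperEscapeRate (towerMap T R) (towerMeasure R μ)
      (fun n => baseFloor R (U n)) α := by
  have hr := hM.one_le_toReal_lintegral_returnTime
  obtain ⟨ρ, h1, h2⟩ := hM.exists_hasEscapeRate hV
  obtain ⟨σ, h3, h4⟩ := hM.exists_hasEscapeRate hW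
  have hmU := fun n => hM.coe_towerMeasure_baseFloor (hU n)
  set r := (∫⁻ x, ((R x : ℕ) : ENNReal) ∂μ).toReal
  have key : ∀ {V' : ℕ → Set X} {ρ : ℕ → ℝ}, (∀ᶠ n in atTop, 0 < μ.real (V' n)) →
      Tendsto (fun n => ρ n / (μ.real (V' n) / r)) atTop (𝓝 α) →
      Tendsto (fun n => μ.real (V' n) / μ.real (U n)) atTop (𝓝 1) →
      Tendsto (fun n => (ρ n : EReal) / ((towerMeasure R μ (baseFloor R (U n)) : ENNReal) : EReal))
        atTop (𝓝 (α : EReal)) := by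
    intro V' ρ hp hρ hq
    have h5 := hρ.mul hq
    rw [mul_one] at h5
    refine (EReal.tendsto_coe.2 h5).congr' ?_
    filter_upwards [hp] with n hn
    rw [hmU, ← EReal.coe_div]
    congr 1
    have : r ≠ 0 := by positivity
    field_simp
  have hlow := key hV.measure_pos h2 hVm
  have hup := key hW.measure_pos h4 hWm
  have hsub : ∀ {A B : Set X}, A ⊆ B → baseFloor R A ⊆ baseFloor R B :=
    fun h p hp => ⟨hp.1, h hp.2⟩
  have h0 : ∀ n, (0 : EReal) ≤ (towerMeasure R μ (baseFloor R (U n)) : ENNReal) :=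
    fun n => EReal.coe_ennreal_nonneg _
  have e1 : ∀ᶠ n in atTop, (ρ n : EReal) / (towerMeasure R μ (baseFloor R (U n)) : ENNReal) ≤
      lowerEscapeRate (towerMap T R) (towerMeasure R μ) (baseFloor R (U n)) /
        (towerMeasure R μ (baseFloor R (U n)) : ENNReal) := by
    filter_upwards [h1] with n hn
    refine EReal.div_le_div_right_of_nonneg (h0 n) ?_
    rw [← hn.lowerEscapeRate_eq]
    exact lowerEscapeRate_mono (hsub (hVU n))
  have e2 : ∀ n, lowerEscapeRate (towerMap T R) (towerMeasure R μ) (baseFloor R (U n)) /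
        (towerMeasure R μ (baseFloor R (U n)) : ENNReal) ≤
      upperEscapeRate (towerMap T R) (towerMeasure R μ) (baseFloor R (U n)) /
        (towerMeasure R μ (baseFloor R (U n)) : ENNReal) := fun n =>
    EReal.div_le_div_right_of_nonneg (h0 n) lowerEscapeRate_le_upperEscapeRate
  have e3 : ∀ᶠ n in atTop,
      upperEscapeRate (towerMap T R) (towerMeasure R μ) (baseFloor R (U n)) /
        (towerMeasure R μ (baseFloor R (U n)) : ENNReal) ≤
      (σ n : EReal) / (towerMeasure R μ (baseFloor R (U n)) : ENNReal) := by
    filter_upwards [h3] with n hn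
    refine EReal.div_le_div_right_of_nonneg (h0 n) ?_
    rw [← hn.upperEscapeRate_eq]
    exact upperEscapeRate_mono (hsub (hUW n))
  exact ⟨tendsto_of_tendsto_of_tendsto_of_le_of_le' hlow hup e1
      (e3.mono fun n hn => (e2 n).trans hn),
    tendsto_of_tendsto_of_tendsto_of_le_of_le' hlow hup (e1.mono fun n hn => hn.trans (e2 n)) e3⟩

end IsMixingTower

theorem lintegral_exp_mul_lt_top {X : Type*} [MeasurableSpace X] {R : X → ℕ+} {μ : Measure X}
    [IsFiniteMeasure μ] (hm : ∀ k : ℕ, MeasurableSet {x | k < (R x : ℕ)})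
    (hR : HasExponentialTail R μ) :
    ∃ z : ℝ, 0 < z ∧ ∫⁻ x, ENNReal.ofReal (Real.exp (z * (R x : ℕ))) ∂μ < ⊤ := by
  obtain ⟨C, θ, hθ0, hθ1, htail⟩ := hR
  have hlog := Real.log_neg hθ0 hθ1
  refine ⟨-Real.log θ / 2, by linarith, ?_⟩
  -- Then θ exp(z) = √θ < 1, so the layer-cake sum is dominated by a convergent geometric series.
  set z := -Real.log θ / 2 with hz
  have hC : 0 ≤ C := by simpa using measureReal_nonneg.trans (htail 0)
  have hθz : θ * Real.exp z < 1 := by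
    rw [← Real.exp_log hθ0, ← Real.exp_add, Real.exp_lt_one_iff]
    linarith
  have hpt : ∀ x, ENNReal.ofReal (Real.exp (z * (R x : ℕ))) ≤ ∑' k : ℕ,
      {x | k < (R x : ℕ)}.indicator (fun _ => ENNReal.ofReal (Real.exp (z * (k + 1 : ℕ)))) x := by
    intro x
    have h1 : ((R x : ℕ) - 1) + 1 = (R x : ℕ) := Nat.sub_add_cancel (R x).pos
    refine le_trans ?_ (ENNReal.le_tsum ((R x : ℕ) - 1))
    rw [Set.indicator_of_mem (s := {x | (R _ : ℕ) - 1 < (R x : ℕ)})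
      (show (R x : ℕ) - 1 < (R x : ℕ) by omega), h1]
  calc ∫⁻ x, ENNReal.ofReal (Real.exp (z * (R x : ℕ))) ∂μ
      ≤ ∫⁻ x, ∑' k : ℕ, {x | k < (R x : ℕ)}.indicator
          (fun _ => ENNReal.ofReal (Real.exp (z * (k + 1 : ℕ)))) x ∂μ := lintegral_mono hpt
    _ = ∑' k : ℕ, ENNReal.ofReal (Real.exp (z * (k + 1 : ℕ))) * μ {x | k < (R x : ℕ)} := by
        rw [lintegral_tsum fun k => (measurable_const.indicator (hm k)).aemeasurable]
        exact tsum_congr fun k => lintegral_indicator_const (hm k) _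
    _ ≤ ∑' k : ℕ, ENNReal.ofReal (C * Real.exp z * (θ * Real.exp z) ^ k) := by
        refine ENNReal.tsum_le_tsum fun k => ?_
        rw [← ofReal_measureReal, ← ENNReal.ofReal_mul (Real.exp_pos _).le]
        refine ENNReal.ofReal_le_ofReal ?_
        calc _ ≤ Real.exp (z * (k + 1 : ℕ)) * (C * θ ^ k) :=
              mul_le_mul_of_nonneg_left (htail k) (Real.exp_pos _).le
          _ = _ := by
            rw [mul_pow, ← Real.exp_nat_mul, Nat.cast_succ, mul_add, mul_one, Real.exp_add,
              mul_comm z]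
            ring
    _ < ⊤ := by
        rw [← ENNReal.ofReal_tsum_of_nonneg (fun k => by positivity)
          ((summable_geometric_of_lt_one (by positivity) hθz).mul_left _)]
        exact ENNReal.ofReal_lt_top

theorem IsYoungTower.exists_isMixingTower {X : Type*} [MeasurableSpace X] [StandardBorelSpace X]
    {T : X → X} {𝒜 : Set (Set X)} {R : X → ℕ+} {μ : Measure X} [IsProbabilityMeasure μ]
    (hY : IsYoungTower T 𝒜 R μ) (hR : HasExponentialTail R μ) :
    ∃ C, IsMixingTower T 𝒜 R μ C := by
  have hG := hY.gibbsMarkov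
  obtain ⟨C, hC, hprod⟩ := hG.exists_hasProductBound
  have hconst : ∀ x, ∀ y ∈ cylinder T 𝒜 1 x, R y = R x := fun x y hy =>
    hY.returnTime_const _ (cylinder_one_mem hG.isPartition T x) y hy x (mem_cylinder_self T 𝒜 1 x)
  have hm : ∀ k : ℕ, MeasurableSet {x | k < (R x : ℕ)} := fun k =>
    hG.measurableSet_of_isCylinderSet (n := 1) (IsCylinderSet.setOf fun x y hy h => by
      rwa [hconst x y hy])
  exact ⟨C, fun n A hA => hG.measurableSet_of_isCylinderSet hA, hG.measurePreserving, hC, hprod,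
    fun δ hδ => hG.exists_hasMixingGap hY.mixing hδ, hconst, lintegral_exp_mul_lt_top hm hR⟩

/-! ### The extremal index -/

theorem entryTimes_one {X : Type*} (T : X → X) (U : Set X) (x : X) :
    entryTimes T U 1 x = entryTime T U x := by
  simp [entryTimes]

section ExtremalIndex

variable {X : Type*} [MeasurableSpace X] {T : X → X} {μ : Measure X} {U V D : ℕ → Set X} {α : ℝ}

theorem cond_real_lt_entryTime {A : Set X} (hA : MeasurableSet A) (K : ℕ) :
    (ProbabilityTheory.cond μ A).real {x | (K : ℕ∞) < entryTime T A x} =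
      μ.real (A ∩ {x | ∀ j, (1 ≤ j ∧ j ≤ K) → T^[j] x ∉ A}) / μ.real A := by
  have h1 : {x | (K : ℕ∞) < entryTime T A x} = {x | ∀ j, (1 ≤ j ∧ j ≤ K) → T^[j] x ∉ A} := by
    ext x
    simp only [Set.mem_ofPred_eq, lt_entryTime_iff, and_imp]
  rw [h1, Measure.real, ProbabilityTheory.cond_apply hA, ENNReal.toReal_mul, ENNReal.toReal_inv,
    div_eq_inv_mul]
  rfl

theorem isExtremalIndex_iff (hU : ∀ n, MeasurableSet (U n)) :
    IsExtremalIndex T μ U α ↔ ∃ a : ℕ → ℝ, (∀ᶠ K : ℕ in atTop, Tendsto (fun n =>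
      μ.real (U n ∩ {x | ∀ j, (1 ≤ j ∧ j ≤ K) → T^[j] x ∉ U n}) / μ.real (U n)) atTop
      (𝓝 (a K))) ∧ Tendsto a atTop (𝓝 α) := by
  simp only [IsExtremalIndex, fun n => cond_real_lt_entryTime (T := T) (μ := μ) (hU n)]

theorem measurableSet_lt_entryTime (hT : Measurable T) {A : Set X} (hA : MeasurableSet A) (t : ℕ) :
    MeasurableSet {x | (t : ℕ∞) < entryTime T A x} := by
  have : {x | (t : ℕ∞) < entryTime T A x} = ⋂ j ∈ Set.Icc 1 t, T^[j] ⁻¹' Aᶜ := by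
    ext x
    simp only [Set.mem_ofPred_eq, lt_entryTime_iff, Set.mem_iInter, Set.mem_Icc, Set.mem_preimage,
      Set.mem_compl_iff, and_imp]
  rw [this]
  exact MeasurableSet.biInter (Set.to_countable _) fun j _ => hT.iterate j hA.compl

/-- For ℓ = 2 the return limits concern τ¹ = τ. Passing to complements gives the extremal index 1 -
α̂₂. -/
theorem HasSummableReturnLimits.exists_isExtremalIndex [IsFiniteMeasure μ] (hT : Measurable T)
    (hU : ∀ n, MeasurableSet (U n)) (hpos : ∀ n, 0 < μ (U n))
    (h : HasSummableReturnLimits T μ U) : ∃ α, IsExtremalIndex T μ U α := by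
  obtain ⟨a, b, h1, -⟩ := h
  obtain ⟨h2, h3⟩ := h1 2 one_le_two
  refine ⟨1 - b 2, fun K => 1 - a 2 K, ?_, h3.const_sub 1⟩
  filter_upwards [h2] with K hK
  refine (hK.const_sub 1).congr fun n => ?_
  have := ProbabilityTheory.cond_isProbabilityMeasure (hpos n).ne'
  have hc : {x | entryTimes T (U n) (2 - 1) x ≤ (K : ℕ∞)} =
      {x | (K : ℕ∞) < entryTime T (U n) x}ᶜ := by
    ext x
    simp only [Set.mem_ofPred_eq, Set.mem_compl_iff, not_lt, Nat.add_one_sub_one, entryTimes_one]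
  rw [hc, probReal_compl_eq_one_sub (measurableSet_lt_entryTime hT (hU n) K)]
  ring

/-- If no iterate of x at times 0, …, K lies in E, then A and B are indistinguishable along this
piece of orbit. By invariance each of the K + 1 times costs μ(E). -/
theorem measureReal_inter_forall_notMem_le [IsFiniteMeasure μ] (hT : MeasurePreserving T μ μ)
    {A B E : Set X} (hE : MeasurableSet E) (h₁ : A \ B ⊆ E) (h₂ : B \ A ⊆ E) (K : ℕ) :
    μ.real (A ∩ {x | ∀ j, (1 ≤ j ∧ j ≤ K) → T^[j] x ∉ A}) ≤
      μ.real (B ∩ {x | ∀ j, (1 ≤ j ∧ j ≤ K) → T^[j] x ∉ B}) + (K + 1) * μ.real E := by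
  have hsub : A ∩ {x | ∀ j, (1 ≤ j ∧ j ≤ K) → T^[j] x ∉ A} ⊆
      (B ∩ {x | ∀ j, (1 ≤ j ∧ j ≤ K) → T^[j] x ∉ B}) ∪
        ⋃ j ∈ Finset.range (K + 1), T^[j] ⁻¹' E := by
    rintro x ⟨hxA, hx⟩
    by_contra hcon
    rw [Set.mem_union, not_or] at hcon
    have hE : ∀ j, j ≤ K → T^[j] x ∉ E := fun j hj hjE =>
      hcon.2 (Set.mem_biUnion (x := j) (Finset.mem_coe.2 (Finset.mem_range.2 (by omega))) hjE)
    refine hcon.1 ⟨by_contra fun hxB => hE 0 K.zero_le (h₁ ⟨hxA, hxB⟩), fun j hj hjB => ?_⟩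
    exact hE j hj.2 (h₂ ⟨hjB, hx j hj⟩)
  calc _ ≤ μ.real ((B ∩ {x | ∀ j, (1 ≤ j ∧ j ≤ K) → T^[j] x ∉ B}) ∪
        ⋃ j ∈ Finset.range (K + 1), T^[j] ⁻¹' E) := measureReal_mono hsub (measure_ne_top _ _)
    _ ≤ _ := measureReal_union_le _ _
    _ ≤ μ.real (B ∩ {x | ∀ j, (1 ≤ j ∧ j ≤ K) → T^[j] x ∉ B}) +
        ∑ j ∈ Finset.range (K + 1), μ.real (T^[j] ⁻¹' E) := by
        gcongr
        exact measureReal_biUnion_finset_le _ _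
    _ = _ := by
        have : ∀ j, μ.real (T^[j] ⁻¹' E) = μ.real E := fun j =>
          (hT.iterate j).measureReal_preimage hE.nullMeasurableSet
        simp only [this, Finset.sum_const, Finset.card_range, nsmul_eq_mul]
        push_cast
        ring

theorem tendsto_div_of_abs_sub_le {u x y d : ℕ → ℝ} {a c : ℝ} (hu : ∀ n, 0 < u n)
    (hx : Tendsto (fun n => x n / u n) atTop (𝓝 a)) (hd : Tendsto (fun n => d n / u n) atTop (𝓝 0))
    (h : ∀ n, |y n - x n| ≤ c * d n) : Tendsto (fun n => y n / u n) atTop (𝓝 a) := by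
  have h1 : Tendsto (fun n => (y n - x n) / u n) atTop (𝓝 0) := by
    refine squeeze_zero_norm (fun n => ?_) (by simpa using hd.const_mul c)
    rw [Real.norm_eq_abs, abs_div, abs_of_pos (hu n), ← mul_div_assoc]
    exact div_le_div_of_nonneg_right (h n) (hu n).le
  have h2 := h1.add hx
  rw [zero_add] at h2
  refine h2.congr fun n => ?_
  rw [← add_div, sub_add_cancel]

theorem tendsto_measureReal_div [IsFiniteMeasure μ] (hpos : ∀ n, 0 < μ.real (U n))
    (h₁ : ∀ n, U n \ V n ⊆ D n) (h₂ : ∀ n, V n \ U n ⊆ D n)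
    (hD0 : Tendsto (fun n => μ.real (D n) / μ.real (U n)) atTop (𝓝 0)) :
    Tendsto (fun n => μ.real (V n) / μ.real (U n)) atTop (𝓝 1) := by
  have h3 : ∀ {A B E : Set X}, A \ B ⊆ E → μ.real A ≤ μ.real B + μ.real E := fun h =>
    (measureReal_mono (Set.sdiff_subset_iff.1 h)).trans (measureReal_union_le _ _)
  refine tendsto_div_of_abs_sub_le (c := 1) (x := fun n => μ.real (U n)) hpos ?_ hD0 fun n => ?_
  · exact tendsto_const_nhds.congr fun n => (div_self (hpos n).ne').symm
  · rw [abs_le]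
    constructor <;> linarith [h3 (h₁ n), h3 (h₂ n)]

/-- For fixed K the exchange changes the numerators by at most (K + 1) μ(D n) = o(μ(U n)), and the
denominators are asymptotic to each other. The limits in n therefore agree before K → ∞. -/
theorem IsExtremalIndex.congr_of_sdiff_subset [IsFiniteMeasure μ] (hT : MeasurePreserving T μ μ)
    (hU : ∀ n, MeasurableSet (U n)) (hV : ∀ n, MeasurableSet (V n))
    (hD : ∀ n, MeasurableSet (D n)) (hpos : ∀ n, 0 < μ.real (U n))
    (h₁ : ∀ n, U n \ V n ⊆ D n) (h₂ : ∀ n, V n \ U n ⊆ D n)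
    (hD0 : Tendsto (fun n => μ.real (D n) / μ.real (U n)) atTop (𝓝 0))
    (h : IsExtremalIndex T μ U α) : IsExtremalIndex T μ V α := by
  rw [isExtremalIndex_iff hU] at h
  rw [isExtremalIndex_iff hV]
  obtain ⟨a, ha, ha'⟩ := h
  refine ⟨a, ?_, ha'⟩
  filter_upwards [ha] with K hK
  have h3 := tendsto_div_of_abs_sub_le (c := K + 1) (y := fun n =>
    μ.real (V n ∩ {x | ∀ j, (1 ≤ j ∧ j ≤ K) → T^[j] x ∉ V n})) hpos hK hD0 fun n => by
      rw [abs_le]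
      constructor <;> linarith [measureReal_inter_forall_notMem_le hT (hD n) (h₁ n) (h₂ n) K,
        measureReal_inter_forall_notMem_le hT (hD n) (h₂ n) (h₁ n) K]
  have h4 := h3.div (tendsto_measureReal_div hpos h₁ h₂ hD0) one_ne_zero
  rw [div_one] at h4
  exact h4.congr fun n => div_div_div_cancel_right₀ (hpos n).ne' _ _

end ExtremalIndex

/-! ### Inner and outer approximation by cylinders -/

section Hull

variable {X : Type*} {T : X → X} {𝒜 : Set (Set X)} {m n : ℕ} {U : Set X}

theorem IsCylinderSet.sUnion_of_subset_cylinders {𝒮 : Set (Set X)} (h : 𝒮 ⊆ cylinders T 𝒜 n) :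
    IsCylinderSet T 𝒜 n (⋃₀ 𝒮) := by
  rintro x ⟨A, hA, hx⟩
  obtain ⟨y, rfl⟩ := h hA
  rw [cylinder_eq_of_mem hx]
  exact Set.subset_sUnion_of_mem hA

/-- The union of the `n`-cylinders that meet `U`. -/
def cylinderHull (T : X → X) (𝒜 : Set (Set X)) (n : ℕ) (U : Set X) : Set X :=
  ⋃₀ {A ∈ cylinders T 𝒜 n | (A ∩ U).Nonempty}

/-- The union of the `n`-cylinders that are contained in `U`. -/
def cylinderCore (T : X → X) (𝒜 : Set (Set X)) (n : ℕ) (U : Set X) : Set X :=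
  ⋃₀ {A ∈ cylinders T 𝒜 n | A ⊆ U}

theorem isCylinderSet_cylinderHull : IsCylinderSet T 𝒜 n (cylinderHull T 𝒜 n U) :=
  IsCylinderSet.sUnion_of_subset_cylinders (Set.sep_subset _ _)

theorem isCylinderSet_cylinderCore : IsCylinderSet T 𝒜 n (cylinderCore T 𝒜 n U) :=
  IsCylinderSet.sUnion_of_subset_cylinders (Set.sep_subset _ _)

theorem subset_cylinderHull : U ⊆ cylinderHull T 𝒜 n U := fun x hx =>
  ⟨cylinder T 𝒜 n x, ⟨⟨x, rfl⟩, x, mem_cylinder_self T 𝒜 n x, hx⟩, mem_cylinder_self T 𝒜 n x⟩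

theorem cylinderCore_subset : cylinderCore T 𝒜 n U ⊆ U :=
  Set.sUnion_subset fun _ hA => hA.2

theorem cylinderHull_anti (h : m ≤ n) : cylinderHull T 𝒜 n U ⊆ cylinderHull T 𝒜 m U := by
  rintro x ⟨A, ⟨⟨y, rfl⟩, z, hz, hzU⟩, hx⟩
  exact ⟨cylinder T 𝒜 m y, ⟨⟨y, rfl⟩, z, cylinder_anti h y hz, hzU⟩, cylinder_anti h y hx⟩

theorem cylinderHull_subset_union (P : Set X → Prop) :
    cylinderHull T 𝒜 n U ⊆ U ∪ ⋃₀ {A ∈ cylinders T 𝒜 n |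
      P A ∨ ((A ∩ U).Nonempty ∧ (A \ U).Nonempty)} := by
  rintro x ⟨A, ⟨hA, hAU⟩, hx⟩
  by_cases hxU : x ∈ U
  · exact Or.inl hxU
  · exact Or.inr ⟨A, ⟨hA, Or.inr ⟨hAU, x, hx, hxU⟩⟩, hx⟩

variable [MetricSpace X] {r : ℝ}

theorem cylinderHull_subset_outerApprox
    (h : ∀ A ∈ cylinders T 𝒜 n, Metric.ediam A ≤ ENNReal.ofReal r) (hr : 0 ≤ r) :
    cylinderHull T 𝒜 n U ⊆ outerApprox r U := by
  rintro x ⟨A, ⟨hA, y, hyA, hyU⟩, hx⟩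
  refine Set.mem_biUnion hyU ?_
  rw [Metric.mem_closedBall, ← ENNReal.ofReal_le_ofReal_iff hr, ← edist_dist]
  exact (Metric.edist_le_ediam_of_mem hx hyA).trans (h A hA)

theorem innerApprox_subset_cylinderCore
    (h : ∀ A ∈ cylinders T 𝒜 n, Metric.ediam A ≤ ENNReal.ofReal r) (hr : 0 ≤ r) :
    innerApprox r U ⊆ cylinderCore T 𝒜 n U := by
  intro x hx
  refine ⟨cylinder T 𝒜 n x, ⟨⟨x, rfl⟩, fun y hy => hx ?_⟩, mem_cylinder_self T 𝒜 n x⟩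
  rw [Metric.mem_closedBall, ← ENNReal.ofReal_le_ofReal_iff hr, ← edist_dist]
  exact (Metric.edist_le_ediam_of_mem hy (mem_cylinder_self T 𝒜 n x)).trans (h _ ⟨x, rfl⟩)

end Hull

/-- Serves both cases: V n is U n itself in the cylinder case and an inner or outer cylinder
approximation in the open case. -/
theorem IsShrinkingHoleSystem.of_sdiff_subset {X : Type*} [MeasurableSpace X] {T : X → X}
    {𝒜 : Set (Set X)} {μ : Measure X} [IsFiniteMeasure μ] {U V D : ℕ → Set X} {κ : ℕ → ℕ}
    {α ε C p : ℝ} (hT : MeasurePreserving T μ μ)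
    (hU : ∀ n, MeasurableSet (U n)) (hV : ∀ n, MeasurableSet (V n))
    (hD : ∀ n, MeasurableSet (D n)) (hpos : ∀ n, 0 < μ (U n))
    (hlim : Tendsto (fun n => μ (U n)) atTop (𝓝 0)) (hα : IsExtremalIndex T μ U α)
    (h₁ : ∀ n, U n \ V n ⊆ D n) (h₂ : ∀ n, V n \ U n ⊆ D n)
    (hD0 : Tendsto (fun n => μ.real (D n) / μ.real (U n)) atTop (𝓝 0))
    (hcyl : ∀ n, IsCylinderSet T 𝒜 (κ n) (V n)) (hκ : ∀ᶠ n in atTop, 1 ≤ κ n)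
    (hε0 : 0 < ε) (hε1 : ε < 1)
    (hε : Tendsto (fun n => (κ n : ℝ) * μ.real (U n) ^ ε) atTop (𝓝 0)) (hp : 1 < p)
    (hhull : ∀ n j, 1 ≤ j → j < κ n → ∃ W, IsCylinderSet T 𝒜 j W ∧ V n ⊆ W ∧
      μ.real W ≤ μ.real (U n) + C * (j : ℝ) ^ (-p)) : IsShrinkingHoleSystem T 𝒜 μ V κ α := by
  have hpos' : ∀ n, 0 < μ.real (U n) := fun n => ENNReal.toReal_pos (hpos n).ne' (measure_ne_top _ _)
  have hlim' : Tendsto (fun n => μ.real (U n)) atTop (𝓝 0) :=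
    (ENNReal.tendsto_toReal ENNReal.zero_ne_top).comp hlim
  have hq := tendsto_measureReal_div hpos' h₁ h₂ hD0
  have hmul : ∀ n, μ.real (V n) = μ.real (U n) * (μ.real (V n) / μ.real (U n)) := fun n =>
    (mul_div_cancel₀ _ (hpos' n).ne').symm
  have hhalf := hq.eventually (lt_mem_nhds (show (1 / 2 : ℝ) < 1 by norm_num))
  refine ⟨Eventually.of_forall hcyl, hκ, ?_, ?_, ⟨ε, hε0, hε1, ?_⟩,
    -- The 2 comes from μ(U n) ≤ 2 μ(V n), used to express the hull bound through μ(V n).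
    ⟨max C 2, p, le_max_of_le_right one_le_two, hp, ?_⟩,
    (isExtremalIndex_iff hV).1 (hα.congr_of_sdiff_subset hT hU hV hD hpos' h₁ h₂ hD0)⟩
  · filter_upwards [hhalf] with n hn
    have := (lt_div_iff₀ (hpos' n)).1 hn
    linarith [hpos' n]
  · have h3 := hlim'.mul hq
    rw [zero_mul] at h3
    exact h3.congr fun n => (hmul n).symm
  · have h3 := hε.mul (hq.rpow_const (p := ε) (Or.inl one_ne_zero))
    rw [zero_mul] at h3
    refine h3.congr fun n => ?_
    rw [mul_assoc, ← Real.mul_rpow measureReal_nonneg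
      (div_nonneg measureReal_nonneg measureReal_nonneg), ← hmul]
  · filter_upwards [hhalf] with n hn j hj hjκ
    obtain ⟨W, hW, hVW, hle⟩ := hhull n j hj hjκ
    refine ⟨W, hW, hVW, hle.trans ?_⟩
    have h3 := (lt_div_iff₀ (hpos' n)).1 hn
    have h4 : (0 : ℝ) ≤ (j : ℝ) ^ (-p) := Real.rpow_nonneg (Nat.cast_nonneg j) _
    have h5 := mul_le_mul_of_nonneg_right (le_max_left C 2) h4
    have h6 := mul_le_mul_of_nonneg_right (le_max_right C 2) (measureReal_nonneg (μ := μ) (s := V n))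
    linarith

/-! ### From the hypotheses on the sets to shrinking holes -/

section Main

variable {X : Type*} [MeasurableSpace X] {T : X → X} {𝒜 : Set (Set X)}
  {μ : Measure X} {U : ℕ → Set X} {α : ℝ}

theorem IsGoodNeighborhoodSystem.isShrinkingHoleSystem [IsFiniteMeasure μ]
    (hT : MeasurePreserving T μ μ) (hU : IsGoodNeighborhoodSystem T 𝒜 μ U) (hUm : ∀ n, MeasurableSet (U n))
    (hα : IsExtremalIndex T μ U α) : ∃ κ, IsShrinkingHoleSystem T 𝒜 μ U κ α := by
  obtain ⟨κ, hcyl, -, hκ, ⟨ε, hε0, hε1, hε⟩, C, p, -, hp, hhull⟩ := hU.exists_good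
  refine ⟨κ, .of_sdiff_subset hT hUm hUm (D := fun _ => ∅) (fun _ => MeasurableSet.empty)
    hU.measure_pos hU.tendsto_measure hα (fun n => (Set.sdiff_self).subset)
    (fun n => (Set.sdiff_self).subset) (by simp) (fun n => ?_) (hκ.eventually_ge_atTop 1)
    hε0 hε1 hε hp fun n j hj hjκ => ⟨cylinderHull T 𝒜 j (U n), isCylinderSet_cylinderHull,
      subset_cylinderHull, hhull n j hj hjκ⟩⟩
  obtain ⟨𝒮, h𝒮, h⟩ := hcyl n
  rw [h]
  exact .sUnion_of_subset_cylinders h𝒮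

theorem IsGoodNeighborhoodSystem.measurableSet (hG : IsGibbsMarkov T 𝒜 μ)
    (hU : IsGoodNeighborhoodSystem T 𝒜 μ U) (n : ℕ) : MeasurableSet (U n) := by
  obtain ⟨κ, hcyl, -⟩ := hU.exists_good
  obtain ⟨𝒮, h𝒮, h⟩ := hcyl n
  rw [h]
  exact hG.measurableSet_of_isCylinderSet (.sUnion_of_subset_cylinders h𝒮)

end Main

section Open

variable {X : Type*} [MetricSpace X] [MeasurableSpace X] {T : X → X}
  {𝒜 : Set (Set X)} {μ : Measure X} {U : ℕ → Set X} {α : ℝ}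

theorem IsGoodOpenSystem.measurableSet [BorelSpace X] (hU : IsGoodOpenSystem T 𝒜 μ U)
    (n : ℕ) : MeasurableSet (U n) := by
  obtain ⟨φ, u, r, κ, hφ, -, -, -, -, -, h, -⟩ := hU
  rw [h n]
  exact (isOpen_lt continuous_const hφ).measurableSet

theorem IsGoodOpenSystem.measure_pos (hU : IsGoodOpenSystem T 𝒜 μ U) (n : ℕ) : 0 < μ (U n) := by
  obtain ⟨φ, u, r, κ, -, -, -, -, -, -, -, h, -⟩ := hU
  exact h n

/-- The sets decrease, and a point in all of them satisfies φ ≥ lim u_n = sup φ, so it belongs to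
the null set of maxima. -/
theorem IsGoodOpenSystem.tendsto_measure [BorelSpace X] [IsFiniteMeasure μ]
    (hU : IsGoodOpenSystem T 𝒜 μ U) :
    Tendsto (fun n => μ (U n)) atTop (𝓝 0) := by
  have hm := hU.measurableSet
  obtain ⟨φ, u, r, κ, hφ, -, -, hnull, humono, hulim, hUφ, -⟩ := hU
  have hanti : Antitone U := fun m n hmn x hx => by
    rw [hUφ] at hx ⊢
    exact lt_of_le_of_lt (EReal.coe_le_coe_iff.2 (humono hmn)) hx
  have h1 := tendsto_measure_iInter_atTop (fun n => (hm n).nullMeasurableSet) hanti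
    ⟨0, measure_ne_top μ _⟩
  have h2 : μ (⋂ n, U n) = 0 := by
    refine measure_mono_null (t := {x | ∀ y, φ y ≤ φ x}) (fun x hx y => ?_) hnull
    refine (le_iSup φ y).trans (le_of_tendsto' hulim fun n => ?_)
    have := Set.mem_iInter.1 hx n
    rw [hUφ] at this
    exact le_of_lt this
  rwa [h2] at h1

/-- The approximations are the unions of the κ n-cylinders contained in U n and meeting U n. These
cylinders have diameter at most r n, so the difference of the two unions lies between the metric
inner and outer approximations and has measure o(μ(U n)). -/
theorem IsGoodOpenSystem.exists_isShrinkingHoleSystem [BorelSpace X] [IsFiniteMeasure μ]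
    (hG : IsGibbsMarkov T 𝒜 μ) (hU : IsGoodOpenSystem T 𝒜 μ U) (hα : IsExtremalIndex T μ U α) :
    ∃ (V W : ℕ → Set X) (κ : ℕ → ℕ), IsShrinkingHoleSystem T 𝒜 μ V κ α ∧
      IsShrinkingHoleSystem T 𝒜 μ W κ α ∧ (∀ n, V n ⊆ U n) ∧ (∀ n, U n ⊆ W n) ∧
      Tendsto (fun n => μ.real (V n) / μ.real (U n)) atTop (𝓝 1) ∧
      Tendsto (fun n => μ.real (W n) / μ.real (U n)) atTop (𝓝 1) := by
  have hm := hU.measurableSet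
  have hpos := hU.measure_pos
  have hlim := hU.tendsto_measure
  have hT := hG.measurePreserving
  obtain ⟨φ, u, r, κ, -, -, -, -, -, -, -, -, hr, -, -, happ, hκ, ⟨ε, hε0, hε1, hε⟩,
    C, p, -, hp, hbd⟩ := hU
  have hpos' : ∀ n, 0 < μ.real (U n) := fun n => ENNReal.toReal_pos (hpos n).ne' (measure_ne_top _ _)
  set V := fun n => cylinderCore T 𝒜 (κ n) (U n) with hVdef
  set W := fun n => cylinderHull T 𝒜 (κ n) (U n) with hWdef
  have hVc : ∀ n, IsCylinderSet T 𝒜 (κ n) (V n) := fun n => isCylinderSet_cylinderCore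
  have hWc : ∀ n, IsCylinderSet T 𝒜 (κ n) (W n) := fun n => isCylinderSet_cylinderHull
  have hVm : ∀ n, MeasurableSet (V n) := fun n => hG.measurableSet_of_isCylinderSet (hVc n)
  have hWm : ∀ n, MeasurableSet (W n) := fun n => hG.measurableSet_of_isCylinderSet (hWc n)
  have hVU : ∀ n, V n ⊆ U n := fun n => cylinderCore_subset
  have hUW : ∀ n, U n ⊆ W n := fun n => subset_cylinderHull
  have hDm : ∀ n, MeasurableSet (W n \ V n) := fun n => (hWm n).diff (hVm n)
  have hD0 : Tendsto (fun n => μ.real (W n \ V n) / μ.real (U n)) atTop (𝓝 0) := by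
    refine squeeze_zero (fun n => div_nonneg measureReal_nonneg measureReal_nonneg) (fun n => ?_) happ
    refine div_le_div_of_nonneg_right (measureReal_mono ?_) (hpos' n).le
    exact Set.sdiff_subset_sdiff
      (cylinderHull_subset_outerApprox (hκ n).1.2 (hr n).le)
      (innerApprox_subset_cylinderCore (hκ n).1.2 (hr n).le)
  have hκ1 : ∀ᶠ n in atTop, 1 ≤ κ n := Eventually.of_forall fun n => (hκ n).1.1
  -- A j-cylinder in the hull that is not contained in U n meets both U n and its complement, so the
  -- boundary hypothesis bounds what the hull adds.
  have hhull : ∀ n j, 1 ≤ j → j < κ n →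
      μ.real (cylinderHull T 𝒜 j (U n)) ≤ μ.real (U n) + C * (j : ℝ) ^ (-p) := fun n j hj hjκ =>
    (measureReal_mono (cylinderHull_subset_union _)).trans
      ((measureReal_union_le _ _).trans (add_le_add_right (hbd n j hj hjκ.le) _))
  have v₁ : ∀ n, U n \ V n ⊆ W n \ V n := fun n => Set.sdiff_subset_sdiff_left (hUW n)
  have v₂ : ∀ n, V n \ U n ⊆ W n \ V n := fun n x hx => absurd (hVU n hx.1) hx.2
  have w₁ : ∀ n, U n \ W n ⊆ W n \ V n := fun n x hx => absurd (hUW n hx.1) hx.2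
  have w₂ : ∀ n, W n \ U n ⊆ W n \ V n := fun n => Set.sdiff_subset_sdiff_right (hVU n)
  refine ⟨V, W, κ, ?_, ?_, hVU, hUW, tendsto_measureReal_div hpos' v₁ v₂ hD0,
    tendsto_measureReal_div hpos' w₁ w₂ hD0⟩
  · exact .of_sdiff_subset hT hm hVm hDm hpos hlim hα v₁ v₂ hD0 hVc hκ1 hε0 hε1 hε hp
      fun n j hj hjκ => ⟨_, isCylinderSet_cylinderHull, (hVU n).trans subset_cylinderHull,
        hhull n j hj hjκ⟩
  -- For j < κ n the outer approximation is itself contained in the j-cylinder hull of U n, so the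
  -- same hull serves both approximations.
  · exact .of_sdiff_subset hT hm hWm hDm hpos hlim hα w₁ w₂ hD0 hWc hκ1 hε0 hε1 hε hp
      fun n j hj hjκ => ⟨_, isCylinderSet_cylinderHull, cylinderHull_anti hjκ.le,
        hhull n j hj hjκ⟩

end Open

theorem mainTheorem5
    {X : Type*} [MetricSpace X] [MeasurableSpace X] [BorelSpace X] [StandardBorelSpace X]
    (T : X → X) (𝒜 : Set (Set X)) (R : X → ℕ+) (μ : Measure X) [IsProbabilityMeasure μ]
    (hY : IsYoungTower T 𝒜 R μ) (hR : HasExponentialTail R μ)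
    (U : ℕ → Set X) (hU : HasSummableReturnLimits T μ U)
    {E : Type*} [NormedAddCommGroup E] [NormedSpace ℝ E] {H : Type*} [TopologicalSpace H]
    (I : ModelWithCorners ℝ E H) {M : Type*} [TopologicalSpace M] [ChartedSpace H M]
    [IsManifold I 2 M] [MeasurableSpace M] [BorelSpace M]
    (f : M → M) (hf : ContMDiff I I 2 f) (ι : X → M) :
    (IsGoodNeighborhoodSystem T 𝒜 μ U →
      ∃ α₁ : ℝ, IsExtremalIndex T μ U α₁ ∧
        HasLocalizedEscapeRate (towerMap T R) (towerMeasure R μ) (fun n => baseFloor R (U n)) α₁ ∧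
        (IsModelledByTower f ι T R μ U →
          HasLocalizedEscapeRate f ((towerMeasure R μ).map (towerProj f ι R))
            (fun n => ι '' U n) α₁)) ∧
    (IsGoodOpenSystem T 𝒜 μ U →
      ∃ α₁ : ℝ, IsExtremalIndex T μ U α₁ ∧
        HasLocalizedLowerUpperEscapeRate (towerMap T R) (towerMeasure R μ)
          (fun n => baseFloor R (U n)) α₁ ∧
        (IsModelledByTower f ι T R μ U →
          HasLocalizedLowerUpperEscapeRate f ((towerMeasure R μ).map (towerProj f ι R))
            (fun n => ι '' U n) α₁)) := by
  obtain ⟨C, hM⟩ := hY.exists_isMixingTower hR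
  have hG := hY.gibbsMarkov
  have hT := hG.measurePreserving
  have hfm : Measurable f := hf.continuous.measurable
  constructor
  · intro hgood
    have hUm := hgood.measurableSet hG
    obtain ⟨α, hα⟩ := hU.exists_isExtremalIndex hT.measurable hUm hgood.measure_pos
    obtain ⟨κ, hκ⟩ := hgood.isShrinkingHoleSystem hT hUm hα
    have hrate := hM.hasLocalizedEscapeRate hκ
    exact ⟨α, hα, hrate, fun hmod => hmod.hasLocalizedEscapeRate hfm hM hUm hrate⟩
  · intro hgood
    have hUm := hgood.measurableSet
    obtain ⟨α, hα⟩ := hU.exists_isExtremalIndex hT.measurable hUm hgood.measure_pos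
    obtain ⟨V, W, κ, hV, hW, hVU, hUW, hVl, hWl⟩ := hgood.exists_isShrinkingHoleSystem hG hα
    have hrate := hM.hasLocalizedLowerUpperEscapeRate hV hW hUm hVU hUW hVl hWl
    exact ⟨α, hα, hrate, fun hmod => hmod.hasLocalizedLowerUpperEscapeRate hfm hM hUm hrate⟩
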